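/- Let $d\ge 2$ and let $\Omega\subset\mathbb R^d$ be a bounded domain whose boundary $\Gamma=\partial\Omega$ is a smooth closed hypersurface, with outer unit normal $n$. Let $C^\infty(\Gamma,\mathbb R^d)$ carry its Fréchet topology, given by the increasing norms $\|r\|_k=\sup_{m\le k}\sup_{x\in\mathbb R^d}|D^mr(x)|$ (infimum over smooth extensions of $r$ to $\mathbb R^d$), and let $B^\infty(0,\varepsilon)$ be the ball $\{r: d_\infty(0,r)<\varepsilon\}$ for the distance $d_\infty(r,s)=\sum_{k\ge0}2^{-k}\frac{\|r-s\|_k}{1+\|r-s\|_k}$. For $r\in C^\infty(\Gamma,\mathbb R^d)$ such that $\mathrm{Id}+r$ is a diffeomorphism from $\Gamma$ onto $\Gamma_r=\{x+r(x):x\in\Gamma\}$, put $(\tau_rv)(x)=v(x+r(x))$ for functions $v$ on $\Gamma_r$. The outer unit normal $n_r$ of $\Gamma_r$ is given by $\mathcal N(r):=\tau_rn_r=w_r/\|w_r\|$, where $w_r=\mathrm{cof}(\mathrm{Id}+Dr)\,n$ and $\mathrm{cof}$ denotes the matrix of cofactors. For smooth complex-valued functions $v$ and $\mathbb C^d$-valued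 functions $\mathbf v$ on $\Gamma_r$ with smooth extensions $\tilde v,\tilde{\mathbf v}$ to $\mathbb R^d$, the tangential gradient and the surface divergence are $$\nabla_{\Gamma_r}v=\nabla\tilde v-(\nabla\tilde v\cdot n_r)\,n_r,\qquad \operatorname{div}_{\Gamma_r}\mathbf v=\operatorname{div}\tilde{\mathbf v}-n_r\cdot\frac{\partial\tilde{\mathbf v}}{\partial n_r}\qquad\text{on }\Gamma_r .$$ For $t\in\mathbb R$ let $H^t(\Gamma)$ be the $L^2$-based Sobolev space of complex-valued functions or distributions on $\Gamma$ (the completion of $C^\infty(\Gamma,\mathbb C)$ for the $H^t(\mathbb R^{d-1})$-norms of localizations in charts), and $\mathbf H^t(\Gamma)=H^t(\Gamma)^d$. Operators on Sobolev spaces are understood as continuous extensions from smooth functions, and $\mathscr L(\cdot,\cdot)$ carries the operator norm topology. A map $f$ from an open subset $U$ of a Fréchet space $X$ to a Fréchet space $Y$ is called $C^1$-Gâteaux differentiable if for all $r_0\in U$, $\xi\in X$ the limit $df[r_0;\xi]=\lim_{s\to0}(f(r_0+s\xi)-f(r_0))/s$ exists in $Y$, is linear and continuous in $\xi$, and $(r_0,\xi)\mapsto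 df[r_0;\xi]$ is continuous on $U\times X$; it is called $C^{m+1}$-Gâteaux differentiable if it is $C^m$-Gâteaux differentiable and $r\mapsto d^mf[r;\xi_1,\dots,\xi_m]$ is $C^1$-Gâteaux differentiable for all $\xi_1,\dots,\xi_m\in X$; and $C^\infty$-Gâteaux differentiable if it is $C^m$-Gâteaux differentiable for all $m$. **Theorem.** There is $\varepsilon>0$ such that $\mathrm{Id}+r$ is a diffeomorphism from $\Gamma$ onto $\Gamma_r$ for every $r\in B^\infty(0,\varepsilon)$. For every such $\varepsilon$ and every $t\in\mathbb R$, the operators $\mathcal G(r)=\tau_r\nabla_{\Gamma_r}\tau_r^{-1}$ and $\mathcal D(r)=\tau_r\operatorname{div}_{\Gamma_r}\tau_r^{-1}$, $r\in B^\infty(0,\varepsilon)$, are bounded from $H^{t+1}(\Gamma)$ to $\mathbf H^t(\Gamma)$ and from $\mathbf H^{t+1}(\Gamma)$ to $H^t(\Gamma)$ respectively, the mapping $$\mathcal D:B^\infty(0,\varepsilon)\to\mathscr L(\mathbf H^{t+1}(\Gamma),H^t(\Gamma)),\qquad r\mapsto\tau_r\operatorname{div}_{\Gamma_r}\tau_r^{-1},$$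 is $C^\infty$-Gâteaux differentiable, and its first derivative at $r_0\in B^\infty(0,\varepsilon)$ in the direction $\xi\in C^\infty(\Gamma,\mathbb R^d)$ is, for all $\mathbf u\in\mathbf H^{t+1}(\Gamma)$, $$d\mathcal D[r_0;\xi]\mathbf u=-\operatorname{Tr}\big([\mathcal G(r_0)\xi][\mathcal G(r_0)\mathbf u]\big)+\big([\mathcal G(r_0)\mathbf u]\mathcal N(r_0)\cdot[\mathcal G(r_0)\xi]\mathcal N(r_0)\big),$$ where $[\mathcal G(r_0)\mathbf u]$ is the $d\times d$ matrix whose $i$-th column is $\mathcal G(r_0)u_i$ (likewise for $\xi$), and $a\cdot b=\sum_ka_kb_k$. -/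

import Mathlib

open Set Filter Topology MeasureTheory TopologicalSpace
open scoped ContDiff SchwartzMap Matrix

noncomputable section

namespace ShapeCalc

/-- The Euclidean space `ℝ^d`. -/
abbrev Eu (d : ℕ) := EuclideanSpace ℝ (Fin d)

/-! ### Gâteaux differentiability of maps between topological vector spaces -/

section Gateaux

variable {X Y : Type*} [AddCommGroup X] [Module ℝ X] [TopologicalSpace X]
  [AddCommGroup Y] [Module ℝ Y] [TopologicalSpace Y]

/-- `y = lim_{t → 0} (f (r₀ + t ξ) - f r₀) / t`: the Gâteaux semiderivative of `f` at `r₀` in the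
direction `ξ` exists and equals `y`. -/
def HasGateauxSemideriv (f : X → Y) (r₀ ξ : X) (y : Y) : Prop :=
  Tendsto (fun t : ℝ => t⁻¹ • (f (r₀ + t • ξ) - f r₀)) (𝓝[≠] 0) (𝓝 y)

/-- The Gâteaux semiderivative `df[r₀; ξ]` (meaningful when the limit exists). -/
def gateauxDeriv (f : X → Y) (r₀ ξ : X) : Y :=
  limUnder (𝓝[≠] (0 : ℝ)) (fun t : ℝ => t⁻¹ • (f (r₀ + t • ξ) - f r₀))

/-- Gâteaux differentiability at `r₀`: all semiderivatives exist, and `ξ ↦ df[r₀; ξ]` is linear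
and continuous. -/
def GateauxDifferentiableAt (f : X → Y) (r₀ : X) : Prop :=
  ∃ L : X →L[ℝ] Y, ∀ ξ, HasGateauxSemideriv f r₀ ξ (L ξ)

/-- Continuous (`C¹`-) Gâteaux differentiability on `U`: Gâteaux differentiable at all points of
`U`, and `U × X ∋ (r₀, ξ) ↦ df[r₀; ξ]` is continuous. -/
def IsC1Gateaux (U : Set X) (f : X → Y) : Prop :=
  (∀ r₀ ∈ U, GateauxDifferentiableAt f r₀) ∧
    ContinuousOn (fun p : X × X => gateauxDeriv f p.1 p.2) (U ×ˢ univ)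

/-- The iterated semiderivative `d^m f[r; ξ₁, …, ξ_m]`: the derivative at `r` in the direction
`ξ_m` of `r ↦ d^(m-1) f[r; ξ₁, …, ξ_{m-1}]`. -/
def iterGateauxDeriv (f : X → Y) : (m : ℕ) → (Fin m → X) → X → Y
  | 0, _ => f
  | m + 1, ξ => fun r => gateauxDeriv (iterGateauxDeriv f m (Fin.init ξ)) r (ξ (Fin.last m))

/-- `C^m`-Gâteaux differentiability on `U`: `f` is `C^(m+1)` if it is `C^m` and all the maps
`r ↦ d^m f[r; ξ₁, …, ξ_m]` are continuously Gâteaux differentiable. -/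
def IsCmGateaux (U : Set X) (f : X → Y) : ℕ → Prop
  | 0 => ContinuousOn f U
  | m + 1 => IsCmGateaux U f m ∧ ∀ ξ : Fin m → X, IsC1Gateaux U (iterGateauxDeriv f m ξ)

/-- `C^∞`-Gâteaux differentiability on `U`. -/
def IsCInftyGateaux (U : Set X) (f : X → Y) : Prop := ∀ m, IsCmGateaux U f m

end Gateaux

/-! ### Smooth functions on subsets of `ℝ^d` -/

section Smooth

variable {d : ℕ} {F : Type*} [NormedAddCommGroup F] [NormedSpace ℝ F]

/-- `f : S → F` is smooth: it is the restriction to `S` of a smooth function on `ℝ^d`. (On a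
compact smooth hypersurface this is the usual notion of smoothness.) -/
def IsSmoothOn (S : Set (Eu d)) (f : S → F) : Prop :=
  ∃ g : Eu d → F, ContDiff ℝ ∞ g ∧ ∀ x : S, g x = f x

open Classical in
/-- A smooth extension of `f : S → F` to the whole of `ℝ^d` (the zero function if there is
none). -/
def smoothExt (S : Set (Eu d)) (f : S → F) : Eu d → F :=
  if h : IsSmoothOn S f then h.choose else 0

/-- The real vector space of smooth functions on `Γ` with values in `F`. -/
def smoothSubmodule (Γ : Compacts (Eu d)) (F : Type*) [NormedAddCommGroup F] [NormedSpace ℝ F] :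
    Submodule ℝ (↥(Γ : Set (Eu d)) → F) where
  carrier := {f | IsSmoothOn (Γ : Set (Eu d)) f}
  add_mem' := by
    rintro f g ⟨f', hf, hf'⟩ ⟨g', hg, hg'⟩
    exact ⟨f' + g', hf.add hg, fun x => by simp [hf', hg']⟩
  zero_mem' := ⟨0, contDiff_const, fun x => rfl⟩
  smul_mem' := by
    rintro c f ⟨f', hf, hf'⟩
    exact ⟨c • f', hf.const_smul c, fun x => by simp [hf']⟩

/-- The Fréchet space `C^∞(Γ, F)` (its topology is defined below). -/
def SmoothVec (Γ : Compacts (Eu d)) (F : Type*) [NormedAddCommGroup F] [NormedSpace ℝ F] :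
    Type _ := ↥(smoothSubmodule Γ F)

instance (Γ : Compacts (Eu d)) : AddCommGroup (SmoothVec Γ F) :=
  inferInstanceAs (AddCommGroup ↥(smoothSubmodule Γ F))

instance (Γ : Compacts (Eu d)) : Module ℝ (SmoothVec Γ F) :=
  inferInstanceAs (Module ℝ ↥(smoothSubmodule Γ F))

instance (Γ : Compacts (Eu d)) : CoeFun (SmoothVec Γ F) (fun _ => ↥(Γ : Set (Eu d)) → F) :=
  ⟨fun f => f.1⟩

/-- The bounds `C` such that `r` has a smooth extension to `ℝ^d` all of whose derivatives of
order at most `k` are bounded by `C` on `ℝ^d`. -/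
def ckBounds {Γ : Compacts (Eu d)} (k : ℕ) (r : SmoothVec Γ F) : Set ℝ :=
  {C | 0 ≤ C ∧ ∃ g : Eu d → F, ContDiff ℝ ∞ g ∧ (∀ x : (Γ : Set (Eu d)), g x = r x) ∧
    ∀ m ≤ k, ∀ x, ‖iteratedFDeriv ℝ m g x‖ ≤ C}

theorem ckBounds_nonempty {Γ : Compacts (Eu d)} (k : ℕ) (r : SmoothVec Γ F) :
    (ckBounds k r).Nonempty := by
  obtain ⟨g, hg, hgr⟩ := r.2
  obtain ⟨b, hb1, -, hbc, hbs⟩ : ∃ b : Eu d → ℝ, (∀ x ∈ (Γ : Set (Eu d)), b x = 1) ∧ True ∧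
      HasCompactSupport b ∧ ContDiff ℝ ∞ b := by
    obtain ⟨R, hR⟩ := Γ.isCompact.isBounded.subset_closedBall (0 : Eu d)
    let b : ContDiffBump (0 : Eu d) := ⟨max R 1, max R 1 + 1, by positivity, by linarith⟩
    refine ⟨b, fun x hx => b.one_of_mem_closedBall ?_, trivial, b.hasCompactSupport, b.contDiff⟩
    exact Metric.closedBall_subset_closedBall (le_max_left _ _) (hR hx)
  have hs : ContDiff ℝ ∞ (fun x => b x • g x) := hbs.smul hg
  have hc : HasCompactSupport (fun x => b x • g x) := hbc.smul_right
  have hbd : ∀ m : ℕ, ∃ C, ∀ x, ‖iteratedFDeriv ℝ m (fun x => b x • g x) x‖ ≤ C := fun m =>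
    (hc.iteratedFDeriv m).exists_bound_of_continuous
      (hs.continuous_iteratedFDeriv (by exact_mod_cast le_top))
  choose C hC using hbd
  refine ⟨∑ m ∈ Finset.range (k + 1), |C m|, by positivity, fun x => b x • g x, hs, ?_, ?_⟩
  · intro x
    simp [hb1 x x.2, hgr]
  · intro m hm x
    refine (hC m x).trans ((le_abs_self _).trans ?_)
    exact Finset.single_le_sum (f := fun m => |C m|) (fun i _ => abs_nonneg _)
      (Finset.mem_range.2 (by omega))

/-- The norm `‖r‖_k = sup_{m ≤ k} sup_{x ∈ ℝ^d} |D^m r (x)|` on `C^∞(Γ, F)`, where a function on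
`Γ` is measured by its best smooth extension to `ℝ^d`, that is, the quotient norm for the
restriction to `Γ`. -/
def ckNorm (Γ : Compacts (Eu d)) (F : Type*) [NormedAddCommGroup F] [NormedSpace ℝ F] (k : ℕ) :
    Seminorm ℝ (SmoothVec Γ F) :=
  Seminorm.ofSMulLE (fun r => sInf (ckBounds k r))
    (by
      refine le_antisymm (csInf_le ⟨0, fun C hC => hC.1⟩ ⟨le_rfl, 0, contDiff_const, ?_, ?_⟩)
        (Real.sInf_nonneg fun C hC => hC.1)
      · intro x; rfl
      · intro m _ x; simp)
    (by
      intro r s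
      rw [← csInf_add (ckBounds_nonempty k r) ⟨0, fun C hC => hC.1⟩ (ckBounds_nonempty k s)
        ⟨0, fun C hC => hC.1⟩]
      refine csInf_le_csInf ⟨0, fun C hC => hC.1⟩
        ((ckBounds_nonempty k r).add (ckBounds_nonempty k s)) ?_
      rintro _ ⟨C, ⟨hC, g, hg, hgr, hgC⟩, D, ⟨hD, h, hh, hhs, hhD⟩, rfl⟩
      refine ⟨add_nonneg hC hD, g + h, hg.add hh, fun x => ?_, fun m hm x => ?_⟩
      · change g x + h x = r x + s x
        rw [hgr, hhs]
      · rw [iteratedFDeriv_add (hg.of_le (by exact_mod_cast le_top))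
          (hh.of_le (by exact_mod_cast le_top))]
        exact (norm_add_le _ _).trans (add_le_add (hgC m hm x) (hhD m hm x)))
    (by
      intro c r
      rw [← smul_eq_mul, ← Real.sInf_smul_of_nonneg (norm_nonneg c)]
      refine csInf_le_csInf ⟨0, fun C hC => hC.1⟩ ((ckBounds_nonempty k r).image _) ?_
      rintro _ ⟨C, ⟨hC, g, hg, hgr, hgC⟩, rfl⟩
      refine ⟨mul_nonneg (norm_nonneg c) hC, c • g, hg.const_smul c, fun x => ?_,
        fun m hm x => ?_⟩
      · change c • g x = c • r x
        rw [hgr]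
      · rw [iteratedFDeriv_const_smul_apply (hg.of_le (by exact_mod_cast le_top)).contDiffAt,
          norm_smul]
        exact mul_le_mul_of_nonneg_left (hgC m hm x) (norm_nonneg c))

/-- The Fréchet topology of `C^∞(Γ, F)`, given by the norms `‖·‖_k`. -/
instance (Γ : Compacts (Eu d)) : TopologicalSpace (SmoothVec Γ F) :=
  (SeminormFamily.moduleFilterBasis (𝕜 := ℝ) (fun k => ckNorm Γ F k)).topology

/-- The distance on `C^∞(Γ, F)` induced by the family of norms `‖·‖_k`. -/
def dInfty {Γ : Compacts (Eu d)} (r s : SmoothVec Γ F) : ℝ :=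
  ∑' k : ℕ, (1 / 2 : ℝ) ^ k * (ckNorm Γ F k (r - s) / (1 + ckNorm Γ F k (r - s)))

/-- The ball `B^∞(0, ε)` of `C^∞(Γ, ℝ^d)`. -/
def ballInfty (Γ : Compacts (Eu d)) (ε : ℝ) : Set (SmoothVec Γ (Eu d)) :=
  {r | dInfty 0 r < ε}

/-- The algebra `C^∞(Γ, ℂ)`. -/
def smoothAlg (Γ : Compacts (Eu d)) : Subalgebra ℂ (↥(Γ : Set (Eu d)) → ℂ) where
  carrier := {f | IsSmoothOn (Γ : Set (Eu d)) f}
  add_mem' := by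
    rintro f g ⟨f', hf, hf'⟩ ⟨g', hg, hg'⟩
    exact ⟨f' + g', hf.add hg, fun x => by simp [hf', hg']⟩
  mul_mem' := by
    rintro f g ⟨f', hf, hf'⟩ ⟨g', hg, hg'⟩
    exact ⟨f' * g', hf.mul hg, fun x => by simp [hf', hg']⟩
  algebraMap_mem' := fun c => ⟨fun _ => c, contDiff_const, fun x => rfl⟩

/-- `C^∞(Γ, ℂ)` as a type. -/
abbrev SmoothFun (Γ : Compacts (Eu d)) := ↥(smoothAlg Γ)

end Smooth

/-! ### Sobolev spaces on a compact smooth hypersurface -/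

section Sobolev

variable {d : ℕ}

/-- A smooth local parametrization of the hypersurface `S ⊆ ℝ^d`: a homeomorphism from an open
subset of `ℝ^(d-1)` onto an open subset of `S` that is smooth with injective differential as a
map into `ℝ^d`. -/
structure LocalParam (S : Set (Eu d)) where
  /-- the parametrization -/
  φ : OpenPartialHomeomorph (Eu (d - 1)) S
  smooth : ContDiffOn ℝ ∞ (fun y => (φ y : Eu d)) φ.source
  immersive : ∀ y ∈ φ.source, Function.Injective (fderiv ℝ (fun y => (φ y : Eu d)) y)

/-- A local parametrization together with a smooth cutoff function supported in its image. -/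
structure Localization (Γ : Compacts (Eu d)) extends LocalParam (Γ : Set (Eu d)) where
  /-- the cutoff function -/
  χ : SmoothFun Γ
  support_subset : tsupport (χ : ↥(Γ : Set (Eu d)) → ℂ) ⊆ φ.target

/-- The local representative `(χ u) ∘ φ` of `u`, extended by zero to `ℝ^(d-1)`. -/
def localRep {Γ : Compacts (Eu d)} (i : Localization Γ) (u : ↥(Γ : Set (Eu d)) → ℂ) :
    Eu (d - 1) → ℂ :=
  i.φ.source.indicator (fun y => i.χ.1 (i.φ y) * u (i.φ y))

theorem localRep_hasCompactSupport {Γ : Compacts (Eu d)} (i : Localization Γ)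
    (u : ↥(Γ : Set (Eu d)) → ℂ) : HasCompactSupport (localRep i u) := by
  have : CompactSpace (Γ : Set (Eu d)) := isCompact_iff_compactSpace.1 Γ.isCompact
  have hK : IsCompact (i.φ.symm '' tsupport (i.χ : ↥(Γ : Set (Eu d)) → ℂ)) :=
    (isClosed_tsupport _).isCompact.image_of_continuousOn
      (i.φ.continuousOn_symm.mono i.support_subset)
  refine HasCompactSupport.intro hK fun y hy => ?_
  by_cases hs : y ∈ i.φ.source
  · rw [localRep, indicator_of_mem hs, image_eq_zero_of_notMem_tsupport (f := i.χ.1), zero_mul]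
    exact fun h => hy ⟨_, h, i.φ.left_inv hs⟩
  · exact indicator_of_notMem hs _

theorem localRep_contDiff {Γ : Compacts (Eu d)} (i : Localization Γ) (u : SmoothFun Γ) :
    ContDiff ℝ ∞ (localRep i u.1) := by
  have : CompactSpace (Γ : Set (Eu d)) := isCompact_iff_compactSpace.1 Γ.isCompact
  have hK : IsCompact (i.φ.symm '' tsupport (i.χ : ↥(Γ : Set (Eu d)) → ℂ)) :=
    (isClosed_tsupport _).isCompact.image_of_continuousOn
      (i.φ.continuousOn_symm.mono i.support_subset)
  rw [contDiff_iff_contDiffAt]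
  intro y
  by_cases hs : y ∈ i.φ.source
  · obtain ⟨g, hg, hgu⟩ := (i.χ * u).2
    have h1 : ContDiffAt ℝ ∞ (fun z => g (i.φ z)) y :=
      hg.contDiffAt.comp y (i.smooth.contDiffAt (i.φ.open_source.mem_nhds hs))
    refine h1.congr_of_eventuallyEq ?_
    filter_upwards [i.φ.open_source.mem_nhds hs] with z hz
    rw [localRep, indicator_of_mem hz, hgu]
    rfl
  · have hy : y ∈ (i.φ.symm '' tsupport (i.χ : ↥(Γ : Set (Eu d)) → ℂ))ᶜ := by
      rintro ⟨x, hx, rfl⟩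
      exact hs (i.φ.map_target (i.support_subset hx))
    refine (contDiffAt_const (c := (0 : ℂ))).congr_of_eventuallyEq ?_
    filter_upwards [hK.isClosed.isOpen_compl.mem_nhds hy] with z hz
    by_cases hzs : z ∈ i.φ.source
    · rw [localRep, indicator_of_mem hzs, image_eq_zero_of_notMem_tsupport (f := i.χ.1), zero_mul]
      exact fun h => hz ⟨_, h, i.φ.left_inv hzs⟩
    · exact indicator_of_notMem hzs _

/-- The localization map `u ↦ (χ u) ∘ φ`, with values in the Schwartz space of `ℝ^(d-1)`. -/
def localize {Γ : Compacts (Eu d)} (i : Localization Γ) :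
    SmoothFun Γ →ₗ[ℂ] 𝓢(Eu (d - 1), ℂ) where
  toFun u := (localRep_hasCompactSupport i u.1).toSchwartzMap (localRep_contDiff i u)
  map_add' u v := by
    ext y
    change localRep i (u.1 + v.1) y = localRep i u.1 y + localRep i v.1 y
    by_cases hs : y ∈ i.φ.source
    · simp [localRep, hs, mul_add]
    · simp [localRep, hs]
  map_smul' c u := by
    ext y
    change localRep i (c • u.1) y = c * localRep i u.1 y
    by_cases hs : y ∈ i.φ.source
    · simp only [localRep, hs, indicator_of_mem, Pi.smul_apply, smul_eq_mul]
      ring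
    · simp [localRep, hs]

/-- The norm of `H^t(ℝ^n)` on Schwartz functions: the `L²` norm of the Bessel potential, that is,
of the Fourier multiplier with symbol `(1 + |ξ|²)^(t/2)`. -/
def sobolevNorm (n : ℕ) (t : ℝ) : Seminorm ℂ (𝓢(Eu n, ℂ)) :=
  (normSeminorm ℂ (Lp ℂ 2 (volume : Measure (Eu n)))).comp
    ((SchwartzMap.toLpCLM ℂ ℂ 2 (volume : Measure (Eu n))).toLinearMap ∘ₗ
      (SchwartzMap.fourierMultiplierCLM (𝕜 := ℂ) ℂ
        (fun ξ : Eu n => (((1 + ‖ξ‖ ^ 2) ^ (t / 2) : ℝ) : ℂ))).toLinearMap)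

/-- The space `C^∞(Γ, ℂ)` with the topology of `H^t(Γ)`. -/
def PreSobolev (Γ : Compacts (Eu d)) (_t : ℝ) : Type := SmoothFun Γ

variable (Γ : Compacts (Eu d)) (t : ℝ)

instance : AddCommGroup (PreSobolev Γ t) := inferInstanceAs (AddCommGroup (SmoothFun Γ))

instance : Module ℂ (PreSobolev Γ t) := inferInstanceAs (Module ℂ (SmoothFun Γ))

/-- The seminorms `u ↦ ‖(χ u) ∘ φ‖_{H^t(ℝ^(d-1))}`. -/
def sobolevSeminorm : SeminormFamily ℂ (PreSobolev Γ t) (Localization Γ) :=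
  fun i => (sobolevNorm (d - 1) t).comp (localize i)

instance : TopologicalSpace (PreSobolev Γ t) :=
  (sobolevSeminorm Γ t).moduleFilterBasis.topology

theorem withSeminorms_preSobolev : WithSeminorms (sobolevSeminorm Γ t) := ⟨rfl⟩

instance : IsTopologicalAddGroup (PreSobolev Γ t) :=
  (withSeminorms_preSobolev Γ t).topologicalAddGroup

instance : ContinuousSMul ℂ (PreSobolev Γ t) :=
  (withSeminorms_preSobolev Γ t).continuousSMul

instance : UniformSpace (PreSobolev Γ t) :=
  IsTopologicalAddGroup.rightUniformSpace (PreSobolev Γ t)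

instance : IsUniformAddGroup (PreSobolev Γ t) := isUniformAddGroup_of_addCommGroup

instance : UniformContinuousConstSMul ℂ (PreSobolev Γ t) :=
  uniformContinuousConstSMul_of_continuousConstSMul ℂ (PreSobolev Γ t)

/-- The Sobolev space `H^t(Γ)` of complex-valued functions (distributions if `t < 0`), `t ∈ ℝ`:
the completion of `C^∞(Γ, ℂ)` for the topology given by the norms `‖(χ u) ∘ φ‖_{H^t(ℝ^(d-1))}`
of the representatives of `u` in all smooth local parametrizations `φ` with cutoffs `χ`. Since
`H^t(ℝ^(d-1))` is locally invariant under diffeomorphisms, finitely many of them, for a finite atlas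
and a subordinate partition of unity, already give this (Hilbert space) topology. -/
abbrev Sobolev : Type := UniformSpace.Completion (PreSobolev Γ t)

variable {Γ}

/-- The element of `H^t(Γ)` defined by a smooth function. -/
def toSobolev (u : SmoothFun Γ) : Sobolev Γ t :=
  UniformSpace.Completion.coe' (α := PreSobolev Γ t) u

/-- Multiplication by the smooth function `a` on `C^∞(Γ, ℂ)` with the topology of `H^t(Γ)`. -/
def preMul (a : SmoothFun Γ) : PreSobolev Γ t →L[ℂ] PreSobolev Γ t where
  toLinearMap := (LinearMap.mulLeft ℂ a : SmoothFun Γ →ₗ[ℂ] SmoothFun Γ)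
  cont := by
    refine (withSeminorms_preSobolev Γ t).continuous_of_isBounded
      (withSeminorms_preSobolev Γ t) _ fun i => ?_
    let j : Localization Γ :=
      { i with
        χ := i.χ * a
        support_subset := (tsupport_mul_subset_left (f := i.χ.1) (g := a.1)).trans
          i.support_subset }
    refine ⟨{j}, 1, fun u => ?_⟩
    have : localize i (a * (show SmoothFun Γ from u)) = localize j u := by
      ext y
      change localRep i (a.1 * (show SmoothFun Γ from u).1) y =
        localRep j (show SmoothFun Γ from u).1 y
      by_cases hs : y ∈ i.φ.source
      · simp only [localRep]
        rw [indicator_of_mem hs, indicator_of_mem (show y ∈ j.φ.source from hs)]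
        exact (mul_assoc _ _ _).symm
      · simp only [localRep]
        rw [indicator_of_notMem hs, indicator_of_notMem (show y ∉ j.φ.source from hs)]
    rw [Finset.sup_singleton, one_smul]
    exact (congrArg (sobolevNorm (d - 1) t) this).le

/-- Multiplication `w ↦ a w` by the smooth function `a` on `H^t(Γ)`. -/
def sobolevMul (a : SmoothFun Γ) : Sobolev Γ t →L[ℂ] Sobolev Γ t := (preMul t a).completion

theorem sobolevMul_toSobolev (a u : SmoothFun Γ) :
    sobolevMul t a (toSobolev t u) = toSobolev t (a * u) :=
  ContinuousLinearMap.completion_apply_coe (preMul t a) u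

end Sobolev

/-! ### Surface differential operators -/

section Surface

variable {d : ℕ}

/-- The tangential gradient `∇_S u = ∇ũ - (∇ũ · n) n` of a scalar function on the hypersurface `S`
with unit normal field `n`. -/
def tangentialGrad (S : Set (Eu d)) (n : S → Eu d) (u : S → ℂ) : S → Fin d → ℂ := fun x k =>
  fderiv ℝ (smoothExt S u) x (EuclideanSpace.single k 1) -
    (∑ l, fderiv ℝ (smoothExt S u) x (EuclideanSpace.single l 1) * (n x l : ℂ)) * (n x k : ℂ)

/-- The surface divergence `div_S u = div ũ - n · ∂ũ/∂n` of a vector function on the hypersurface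
`S` with unit normal field `n`. -/
def surfaceDiv (S : Set (Eu d)) (n : S → Eu d) (u : S → Fin d → ℂ) : S → ℂ := fun x =>
  ∑ i, fderiv ℝ (smoothExt S u) x (EuclideanSpace.single i 1) i -
    ∑ i, (n x i : ℂ) * fderiv ℝ (smoothExt S u) x (n x) i

/-- `ν` is the outer unit normal of `Ω` at `x`: near `x` the set `Ω` is `{ρ < 0}` for a smooth `ρ`
with `∇ρ(x) ≠ 0`, and `ν = ∇ρ(x) / |∇ρ(x)|`. -/
def IsOuterUnitNormal (Ω : Set (Eu d)) (x ν : Eu d) : Prop :=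
  ∃ ρ : Eu d → ℝ, ContDiff ℝ ∞ ρ ∧ gradient ρ x ≠ 0 ∧ (∀ᶠ y in 𝓝 x, y ∈ Ω ↔ ρ y < 0) ∧
    ν = ‖gradient ρ x‖⁻¹ • gradient ρ x

/-- The boundary of `Ω` is a smooth hypersurface, with `Ω` locally on one side of it. -/
def HasSmoothBoundary (Ω : Set (Eu d)) : Prop :=
  ∀ x ∈ frontier Ω, ∃ ν, IsOuterUnitNormal Ω x ν

open Classical in
/-- The outer unit normal of `Ω` at `x`. -/
def outerUnitNormal (Ω : Set (Eu d)) (x : Eu d) : Eu d :=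
  if h : ∃ ν, IsOuterUnitNormal Ω x ν then h.choose else 0

variable {Γ : Compacts (Eu d)}

/-- The deformed surface `Γ_r = {x + r(x) : x ∈ Γ}`. -/
def deformed (r : SmoothVec Γ (Eu d)) : Set (Eu d) :=
  range fun x : ↥(Γ : Set (Eu d)) => (x : Eu d) + r x

/-- `Id + r` is a diffeomorphism from `Γ` onto `Γ_r`: it has an inverse `Γ_r → Γ` which is
smooth. -/
def IsDeformation (r : SmoothVec Γ (Eu d)) : Prop :=
  ∃ s : deformed r → ↥(Γ : Set (Eu d)), IsSmoothOn (deformed r) (fun y => (s y : Eu d)) ∧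
    ∀ x, s ⟨x + r x, x, rfl⟩ = x

/-- The pullback `τ_r`: `(τ_r v)(x) = v(x + r(x))`. -/
def tau (r : SmoothVec Γ (Eu d)) {A : Type*} (v : deformed r → A) : ↥(Γ : Set (Eu d)) → A :=
  fun x => v ⟨x + r x, x, rfl⟩

/-- The inverse `τ_r⁻¹` of the pullback (for `Id + r` injective): `(τ_r⁻¹ u)(x + r(x)) = u(x)`. -/
def tauInv (r : SmoothVec Γ (Eu d)) {A : Type*} (u : ↥(Γ : Set (Eu d)) → A) : deformed r → A :=
  fun y => u y.2.choose

/-- The matrix of `Id + D r` at the point `x` of `Γ`. -/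
def deformationMatrix (r : SmoothVec Γ (Eu d)) (x : Eu d) : Matrix (Fin d) (Fin d) ℝ :=
  1 + Matrix.of fun i j => fderiv ℝ (smoothExt Γ (fun x => r x)) x (EuclideanSpace.single j 1) i

/-- `w_r = cof(Id + D r) n`, with `cof(A)` the matrix of cofactors of `A`. -/
def normalW (Ω : Set (Eu d)) (r : SmoothVec Γ (Eu d)) (x : Eu d) : Eu d :=
  WithLp.toLp 2 ((deformationMatrix r x).adjugateᵀ *ᵥ (outerUnitNormal Ω x).ofLp)

/-- `𝒩(r) = τ_r n_r = w_r / ‖w_r‖`. -/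
def pulledNormal (Ω : Set (Eu d)) (r : SmoothVec Γ (Eu d)) : ↥(Γ : Set (Eu d)) → Eu d :=
  fun x => ‖normalW Ω r x‖⁻¹ • normalW Ω r x

/-- The outer unit normal `n_r = τ_r⁻¹ (w_r / ‖w_r‖)` of `Γ_r`. -/
def deformedNormal (Ω : Set (Eu d)) (r : SmoothVec Γ (Eu d)) : deformed r → Eu d :=
  tauInv r (pulledNormal Ω r)

/-- The pulled-back tangential gradient `τ_r ∇_{Γ_r} τ_r⁻¹ u`. -/
def pulledGrad (Ω : Set (Eu d)) (r : SmoothVec Γ (Eu d)) (u : ↥(Γ : Set (Eu d)) → ℂ) :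
    ↥(Γ : Set (Eu d)) → Fin d → ℂ :=
  tau r (tangentialGrad (deformed r) (deformedNormal Ω r) (tauInv r u))

/-- The pulled-back surface divergence `τ_r div_{Γ_r} τ_r⁻¹ u`. -/
def pulledDiv (Ω : Set (Eu d)) (r : SmoothVec Γ (Eu d)) (u : ↥(Γ : Set (Eu d)) → Fin d → ℂ) :
    ↥(Γ : Set (Eu d)) → ℂ :=
  tau r (surfaceDiv (deformed r) (deformedNormal Ω r) (tauInv r u))

/-- `G : H^(t+1)(Γ) → H^t(Γ)^d` is the operator `𝒢(r) = τ_r ∇_{Γ_r} τ_r⁻¹`, that is, the continuous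
extension of that operator from (the dense subspace of) smooth functions. -/
def IsPulledGrad (Ω : Set (Eu d)) (t : ℝ) (r : SmoothVec Γ (Eu d))
    (G : Sobolev Γ (t + 1) →L[ℂ] (Fin d → Sobolev Γ t)) : Prop :=
  ∀ u : SmoothFun Γ, ∃ v : Fin d → SmoothFun Γ,
    (∀ x k, (v k).1 x = pulledGrad Ω r u.1 x k) ∧
      G (toSobolev (t + 1) u) = fun k => toSobolev t (v k)

/-- `D : H^(t+1)(Γ)^d → H^t(Γ)` is the operator `𝒟(r) = τ_r div_{Γ_r} τ_r⁻¹`, that is, the continuous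
extension of that operator from (the dense subspace of) smooth vector functions. -/
def IsPulledDiv (Ω : Set (Eu d)) (t : ℝ) (r : SmoothVec Γ (Eu d))
    (D : (Fin d → Sobolev Γ (t + 1)) →L[ℂ] Sobolev Γ t) : Prop :=
  ∀ u : Fin d → SmoothFun Γ, ∃ v : SmoothFun Γ,
    (∀ x, v.1 x = pulledDiv Ω r (fun x i => (u i).1 x) x) ∧
      D (fun i => toSobolev (t + 1) (u i)) = toSobolev t v

/-- `A` is the matrix `[𝒢(r) ξ]`, with smooth entries, whose `i`-th column is the pulled-back
tangential gradient `𝒢(r) ξ_i` of the `i`-th component of `ξ`. -/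
def IsPulledGradMatrix (Ω : Set (Eu d)) (r ξ : SmoothVec Γ (Eu d))
    (A : Matrix (Fin d) (Fin d) (SmoothFun Γ)) : Prop :=
  ∀ x k i, (A k i).1 x = pulledGrad Ω r (fun y => ((ξ y i : ℝ) : ℂ)) x k

/-- `N` is the normal field `𝒩(r)`, as a vector of smooth functions. -/
def IsPulledNormal (Ω : Set (Eu d)) (r : SmoothVec Γ (Eu d)) (N : Fin d → SmoothFun Γ) : Prop :=
  ∀ x i, (N i).1 x = ((pulledNormal Ω r x i : ℝ) : ℂ)

/-- `-Tr(A B) + (B N · A N)` for matrices `A` with smooth entries and `B` with entries in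
`H^t(Γ)`, and a vector `N` with smooth entries. -/
def divDerivFormula (t : ℝ) (A : Matrix (Fin d) (Fin d) (SmoothFun Γ)) (N : Fin d → SmoothFun Γ)
    (B : Matrix (Fin d) (Fin d) (Sobolev Γ t)) : Sobolev Γ t :=
  -(∑ j, ∑ k, sobolevMul t (A j k) (B k j)) +
    ∑ k, sobolevMul t ((A *ᵥ N) k) (∑ i, sobolevMul t (N i) (B k i))

end Surface

end ShapeCalc

end

/-! All dependence on `r` is pushed into finitely many coefficient functions on `Γ`. Let `∂_l` be
the derivative along the tangential projection of the `l`-th basis vector; it is a derivation of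
`C^∞(Γ, ℂ)`. Let `J` be the matrix `∂_j r_i`, which is linear in `r` and kills the normal `n`, and
write `w = w_r`, `N = w / ‖w‖`. The matrix `T = 1 + J - n nᵀ + N nᵀ` maps the tangent space of `Γ`
to that of `Γ_r`, and `n` to `N`. Its determinant is `w · N = ‖w‖`, so its inverse is `M = ‖w‖⁻¹ adj
T`. The chain rule gives `(𝒢(r) u)_k = ∑ l, M l k ∂_l u` and `𝒟(r) u = ∑ k, ∑ l, M l k ∂_l u_k`
(`IsDeformation.pulledGrad_eq`, `IsDeformation.pulledDiv_eq`).

Hence `𝒟(r)` is a finite sum of `Λ_p (M_p(r))`, where `Λ_p = mulDerivProj h t p` sends a coefficient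
`a` to the operator `u ↦ a ∂_l u_k`. This map is continuous when `C^∞(Γ, ℂ)` has the topology of
uniform convergence of all iterated tangential derivatives: products in `H^t` are estimated in
charts by the inequalities of Peetre and Young (`sobolevNorm_mul_le`), and `∂_l` has order one
(`exists_localize_tangentialDeriv_eq`). What remains is the differentiation of `M` as a map into a
topological algebra.

The entries of `N` and `M` are polynomials in the entries of `J` and in `(w · w)^(-1/2)`, so they
have semiderivatives because the inverse square root does (`invSqrt_mem_gateauxSubalgebra`). Once
these exist, differentiating `N · N = 1`, `Nᵀ (T - N nᵀ) = 0` and `T M = 1` gives, with `Y = J_ξ M`,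
the formulas `dN = -Yᵀ N` and `dM = -M Y + (M Yᵀ N) Nᵀ`. They are polynomial in `N` and `M` and
linear in the entries of `J_ξ`. The algebra generated by `N` and `M` is therefore stable under
differentiation (`isDifferentialModule_coefficientMaps`), and smoothness of every order follows by
induction (`IsCombination.isCInftyGateaux`). Since `Yᵀ = [𝒢(r) ξ]`, inserting `dM` into the
expression for `𝒟` yields the derivative formula.

The existence of `ε` is the fact that the identity plus a map with small derivative is invertible
with smooth inverse. -/

noncomputable section

namespace ShapeCalc

/-! ### Sobolev norms of Schwartz functions -/

section SobolevSchwartz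

open FourierTransform LineDeriv
open scoped ENNReal

variable {n : ℕ}

/-- The Bessel weight `(1 + |ξ|²)^(t/2)`. -/
def besselWeight (n : ℕ) (t : ℝ) (ξ : Eu n) : ℝ := (1 + ‖ξ‖ ^ 2) ^ (t / 2)

theorem besselWeight_pos (t : ℝ) (ξ : Eu n) : 0 < besselWeight n t ξ := by
  unfold besselWeight; positivity

theorem besselWeight_hasTemperateGrowth (t : ℝ) :
    (fun ξ : Eu n => ((besselWeight n t ξ : ℝ) : ℂ)).HasTemperateGrowth := by
  unfold besselWeight; fun_prop

theorem one_add_norm_sq_le (ξ η : Eu n) :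
    1 + ‖ξ‖ ^ 2 ≤ 2 * (1 + ‖ξ - η‖ ^ 2) * (1 + ‖η‖ ^ 2) := by
  have h : ‖ξ‖ ≤ ‖ξ - η‖ + ‖η‖ := by simpa using norm_add_le (ξ - η) η
  have h1 : ‖ξ‖ ^ 2 ≤ (‖ξ - η‖ + ‖η‖) ^ 2 := by gcongr
  nlinarith [sq_nonneg (‖ξ - η‖ - ‖η‖), mul_nonneg (sq_nonneg ‖ξ - η‖) (sq_nonneg ‖η‖)]

/-- Peetre's inequality. -/
theorem besselWeight_le (t : ℝ) (ξ η : Eu n) :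
    besselWeight n t ξ ≤ 2 ^ (|t| / 2) * besselWeight n |t| (ξ - η) * besselWeight n t η := by
  unfold besselWeight
  rcases le_total 0 t with ht | ht
  · rw [abs_of_nonneg ht, ← Real.mul_rpow (by positivity) (by positivity),
      ← Real.mul_rpow (by positivity) (by positivity)]
    exact Real.rpow_le_rpow (by positivity) (one_add_norm_sq_le ξ η) (by positivity)
  -- For negative order the roles of `ξ` and `η` are exchanged, the weight being the inverse of the
  -- one of order `|t|`.
  · have h := Real.rpow_le_rpow (by positivity) (one_add_norm_sq_le η ξ)
      (show (0 : ℝ) ≤ |t| / 2 by positivity)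
    rw [Real.mul_rpow (by positivity) (by positivity),
      Real.mul_rpow (by positivity) (by positivity), norm_sub_rev] at h
    have e : t / 2 = -(|t| / 2) := by rw [abs_of_nonpos ht]; ring
    rw [e, Real.rpow_neg (by positivity), Real.rpow_neg (by positivity),
      inv_le_iff_one_le_mul₀ (by positivity)]
    have hp : (0 : ℝ) < (1 + ‖η‖ ^ 2) ^ (|t| / 2) := by positivity
    calc (1 : ℝ) = (1 + ‖η‖ ^ 2) ^ (|t| / 2) * ((1 + ‖η‖ ^ 2) ^ (|t| / 2))⁻¹ := by
          field_simp
      _ ≤ (2 ^ (|t| / 2) * (1 + ‖ξ - η‖ ^ 2) ^ (|t| / 2) * (1 + ‖ξ‖ ^ 2) ^ (|t| / 2)) *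
          ((1 + ‖η‖ ^ 2) ^ (|t| / 2))⁻¹ := by gcongr
      _ = _ := by ring

/-- The Fourier transform multiplied by the Bessel weight. -/
def weightedFourier (n : ℕ) (t : ℝ) : 𝓢(Eu n, ℂ) →L[ℂ] 𝓢(Eu n, ℂ) :=
  SchwartzMap.smulLeftCLM ℂ (fun ξ : Eu n => ((besselWeight n t ξ : ℝ) : ℂ)) ∘L
    fourierCLM ℂ 𝓢(Eu n, ℂ)

theorem weightedFourier_apply (t : ℝ) (f : 𝓢(Eu n, ℂ)) (ξ : Eu n) :
    weightedFourier n t f ξ = (besselWeight n t ξ : ℂ) * 𝓕 f ξ := by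
  simp [weightedFourier, SchwartzMap.smulLeftCLM_apply_apply (besselWeight_hasTemperateGrowth t)]

theorem norm_weightedFourier (t : ℝ) (f : 𝓢(Eu n, ℂ)) (ξ : Eu n) :
    ‖weightedFourier n t f ξ‖ = besselWeight n t ξ * ‖𝓕 f ξ‖ := by
  rw [weightedFourier_apply, norm_mul, Complex.norm_real, Real.norm_of_nonneg
    (besselWeight_pos t ξ).le]

/-- Plancherel removes the outer inverse transform of the multiplier. Estimates of Sobolev norms
then become pointwise estimates on the Fourier side. -/
theorem sobolevNorm_eq (t : ℝ) (f : 𝓢(Eu n, ℂ)) :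
    sobolevNorm n t f = ‖(weightedFourier n t f).toLp 2‖ := by
  have h := SchwartzMap.norm_fourier_toL2_eq (𝓕⁻ (weightedFourier n t f))
  rw [FourierTransform.fourier_fourierInv_eq] at h
  rw [h]
  rfl

theorem norm_toLp_two_le_of_le {f g : 𝓢(Eu n, ℂ)} {C : ℝ} (hC : 0 ≤ C)
    (h : ∀ x, ‖f x‖ ≤ C * ‖g x‖) :
    ‖f.toLp 2 (volume : Measure (Eu n))‖ ≤ C * ‖g.toLp 2 (volume : Measure (Eu n))‖ := by
  rw [SchwartzMap.norm_toLp, SchwartzMap.norm_toLp]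
  have := eLpNorm_le_mul_eLpNorm_of_ae_le_mul (μ := (volume : Measure (Eu n)))
    (.of_forall h : ∀ᵐ x, ‖f x‖ ≤ C * ‖g x‖) 2
  refine (ENNReal.toReal_mono (ENNReal.mul_ne_top ENNReal.ofReal_ne_top
    (g.memLp 2 volume).eLpNorm_ne_top) this).trans ?_
  rw [ENNReal.toReal_mul, ENNReal.toReal_ofReal hC]

theorem sobolevNorm_le_succ (t : ℝ) (f : 𝓢(Eu n, ℂ)) :
    sobolevNorm n t f ≤ sobolevNorm n (t + 1) f := by
  rw [sobolevNorm_eq, sobolevNorm_eq, ← one_mul ‖(weightedFourier n (t + 1) f).toLp 2 volume‖]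
  refine norm_toLp_two_le_of_le zero_le_one fun ξ => ?_
  rw [norm_weightedFourier, norm_weightedFourier, one_mul]
  gcongr
  unfold besselWeight
  exact Real.rpow_le_rpow_of_exponent_le (by nlinarith [sq_nonneg ‖ξ‖]) (by linarith)

/-- The derivative multiplies the transform by `2πi ⟨ξ, v⟩`, and `‖ξ‖ ≤ (1 + ‖ξ‖²)^(1/2)` is paid
for by one more order in the weight. -/
theorem sobolevNorm_lineDeriv_le (t : ℝ) (v : Eu n) (f : 𝓢(Eu n, ℂ)) :
    sobolevNorm n t (∂_{v} f) ≤ 2 * Real.pi * ‖v‖ * sobolevNorm n (t + 1) f := by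
  rw [sobolevNorm_eq, sobolevNorm_eq]
  refine norm_toLp_two_le_of_le (by positivity) fun ξ => ?_
  rw [norm_weightedFourier, norm_weightedFourier, SchwartzMap.fourier_lineDerivOp_eq]
  have hv : (inner ℝ · v : Eu n → ℝ).HasTemperateGrowth :=
    ((innerSL ℝ).flip v).hasTemperateGrowth
  have h1 : besselWeight n t ξ * ‖ξ‖ ≤ besselWeight n (t + 1) ξ := by
    unfold besselWeight
    have : (t + 1) / 2 = t / 2 + 1 / 2 := by ring
    rw [this, Real.rpow_add (by positivity), ← Real.sqrt_eq_rpow]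
    gcongr
    exact Real.le_sqrt_of_sq_le (by linarith)
  have h2 : ‖inner ℝ ξ v‖ ≤ ‖ξ‖ * ‖v‖ := norm_inner_le_norm ξ v
  simp only [smul_apply, SchwartzMap.smulLeftCLM_apply_apply hv, norm_smul, norm_mul]
  have h3 : ‖(2 : ℂ)‖ * ‖(Real.pi : ℂ)‖ * ‖Complex.I‖ = 2 * Real.pi := by
    simp [abs_of_pos Real.pi_pos]
  rw [h3]
  have hb := (besselWeight_pos t ξ).le
  have hpi := Real.pi_pos.le
  calc besselWeight n t ξ * (2 * Real.pi * (‖inner ℝ ξ v‖ * ‖𝓕 f ξ‖))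
      ≤ besselWeight n t ξ * (2 * Real.pi * (‖ξ‖ * ‖v‖ * ‖𝓕 f ξ‖)) := by gcongr
    _ = 2 * Real.pi * ‖v‖ * (besselWeight n t ξ * ‖ξ‖ * ‖𝓕 f ξ‖) := by ring
    _ ≤ _ := by gcongr

/-- Young's inequality `L¹ * L² ⊆ L²` for nonnegative functions. -/
theorem lintegral_convolution_sq_le {k h : Eu n → ℝ≥0∞} (hk : Measurable k) (hh : Measurable h) :
    ∫⁻ ξ, (∫⁻ η, k η * h (ξ - η)) ^ (2 : ℝ) ≤ (∫⁻ η, k η) ^ (2 : ℝ) * ∫⁻ η, h η ^ (2 : ℝ) := by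
  -- Cauchy–Schwarz after splitting `k = k^(1/2) k^(1/2)`; the second factor `∫ k` appears when the
  -- order of integration is exchanged.
  have key : ∀ ξ, (∫⁻ η, k η * h (ξ - η)) ^ (2 : ℝ) ≤
      (∫⁻ η, k η) * ∫⁻ η, k η * h (ξ - η) ^ (2 : ℝ) := by
    intro ξ
    have hm : Measurable fun η => h (ξ - η) := hh.comp (measurable_const.sub measurable_id)
    have := ENNReal.lintegral_mul_le_Lp_mul_Lq (volume : Measure (Eu n))
      (Real.HolderConjugate.two_two) (f := fun η => k η ^ (1 / 2 : ℝ))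
      (g := fun η => k η ^ (1 / 2 : ℝ) * h (ξ - η))
      (hk.pow_const _).aemeasurable ((hk.pow_const _).mul hm).aemeasurable
    have e1 : ∀ x : ℝ≥0∞, (x ^ (1 / 2 : ℝ)) ^ (2 : ℝ) = x := fun x => by
      rw [← ENNReal.rpow_mul]; norm_num
    have e2 : ∀ x : ℝ≥0∞, x ^ (1 / 2 : ℝ) * x ^ (1 / 2 : ℝ) = x := fun x => by
      rw [← ENNReal.rpow_add_of_nonneg _ _ (by norm_num) (by norm_num)]; norm_num
    simp only [Pi.mul_apply, ENNReal.mul_rpow_of_nonneg _ _ (zero_le_two : (0 : ℝ) ≤ 2), e1,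
      ← mul_assoc, e2] at this
    calc _ ≤ _ := ENNReal.rpow_le_rpow this (zero_le_two)
      _ = _ := by rw [ENNReal.mul_rpow_of_nonneg _ _ (zero_le_two : (0 : ℝ) ≤ 2), e1, e1]
  calc ∫⁻ ξ, (∫⁻ η, k η * h (ξ - η)) ^ (2 : ℝ)
      ≤ ∫⁻ ξ, (∫⁻ η, k η) * ∫⁻ η, k η * h (ξ - η) ^ (2 : ℝ) := lintegral_mono key
    _ = (∫⁻ η, k η) * ∫⁻ ξ, ∫⁻ η, k η * h (ξ - η) ^ (2 : ℝ) := by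
        rw [lintegral_const_mul]
        refine Measurable.lintegral_prod_right' (f := fun p : Eu n × Eu n =>
          k p.2 * h (p.1 - p.2) ^ (2 : ℝ)) ?_
        exact (hk.comp measurable_snd).mul
          ((hh.comp (measurable_fst.sub measurable_snd)).pow_const _)
    _ = (∫⁻ η, k η) * ∫⁻ η, k η * ∫⁻ ξ, h ξ ^ (2 : ℝ) := by
        rw [lintegral_lintegral_swap]
        · congr 1
          refine lintegral_congr fun η => ?_
          have hm : Measurable fun ξ => h (ξ - η) ^ (2 : ℝ) :=
            (hh.comp (measurable_id.sub measurable_const)).pow_const _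
          rw [lintegral_const_mul _ hm]
          congr 1
          exact lintegral_sub_right_eq_self (fun ξ => h ξ ^ (2 : ℝ)) η
        · exact ((hk.comp measurable_snd).mul
            ((hh.comp (measurable_fst.sub measurable_snd)).pow_const _)).aemeasurable
    _ = _ := by
        rw [lintegral_mul_const _ hk, ← mul_assoc, ENNReal.rpow_two, sq]

/-- The convolution theorem is applied to the inverse transforms of `f` and `g`, and the reflection
`𝓕 u y = 𝓕⁻ u (-y)` brings it back to `𝓕`. -/
theorem fourier_mul_apply {f g h : 𝓢(Eu n, ℂ)} (hfg : ∀ x, h x = f x * g x) (ξ : Eu n) :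
    𝓕 h ξ = ∫ η, 𝓕 f η * 𝓕 g (ξ - η) := by
  let B := ContinuousLinearMap.mul ℂ ℂ
  have e : h = 𝓕 (SchwartzMap.convolution B (𝓕⁻ f) (𝓕⁻ g)) := by
    rw [SchwartzMap.fourier_convolution]
    ext x
    simp [hfg, B]
  have e' : 𝓕⁻ h = SchwartzMap.convolution B (𝓕⁻ f) (𝓕⁻ g) := by rw [e]; simp
  have hneg : ∀ (u : 𝓢(Eu n, ℂ)) (y : Eu n), 𝓕 u y = 𝓕⁻ u (-y) := fun u y => by
    rw [SchwartzMap.fourierInv_coe, SchwartzMap.fourier_coe, Real.fourierInv_eq_fourier_neg,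
      neg_neg]
  rw [hneg, e', SchwartzMap.convolution_apply, convolution_def,
    ← integral_neg_eq_self (fun η => 𝓕 f η * 𝓕 g (ξ - η))]
  refine integral_congr_ae (.of_forall fun η => ?_)
  simp only [hneg, B, ContinuousLinearMap.mul_apply', neg_neg]
  congr 2
  abel

/-- Multiplication in `H^t(ℝ^n)`. -/
theorem sobolevNorm_mul_le (t : ℝ) {f g h : 𝓢(Eu n, ℂ)} (hfg : ∀ x, h x = f x * g x) :
    sobolevNorm n t h ≤ 2 ^ (|t| / 2) *
      ‖SchwartzMap.toLpCLM ℂ ℂ 1 (volume : Measure (Eu n)) (weightedFourier n |t| f)‖ *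
        sobolevNorm n t g := by
  rw [sobolevNorm_eq, sobolevNorm_eq, SchwartzMap.toLpCLM_apply, SchwartzMap.norm_toLp,
    SchwartzMap.norm_toLp, SchwartzMap.norm_toLp]
  set k := weightedFourier n |t| f
  set G := weightedFourier n t g
  -- Peetre's inequality for `ξ = η + (ξ - η)` leaves the weight of order `t` on `g` and puts one of
  -- order `|t|` on `f`.
  have hpt : ∀ ξ, ‖weightedFourier n t h ξ‖ₑ ≤
      ENNReal.ofReal (2 ^ (|t| / 2)) * ∫⁻ η, ‖k η‖ₑ * ‖G (ξ - η)‖ₑ := by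
    intro ξ
    rw [weightedFourier_apply, fourier_mul_apply hfg, ← integral_const_mul]
    refine (enorm_integral_le_lintegral_enorm _).trans ?_
    rw [← lintegral_const_mul' _ _ ENNReal.ofReal_ne_top]
    refine lintegral_mono fun η => ?_
    rw [← ofReal_norm, ← ofReal_norm, ← ofReal_norm,
      ← ENNReal.ofReal_mul (norm_nonneg _), ← ENNReal.ofReal_mul (by positivity)]
    refine ENNReal.ofReal_le_ofReal ?_
    rw [norm_weightedFourier, norm_weightedFourier, norm_mul, norm_mul, Complex.norm_real,
      Real.norm_of_nonneg (besselWeight_pos t ξ).le]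
    have := besselWeight_le t ξ (ξ - η)
    rw [sub_sub_cancel] at this
    calc _ ≤ (2 ^ (|t| / 2) * besselWeight n |t| η * besselWeight n t (ξ - η)) *
          (‖𝓕 f η‖ * ‖𝓕 g (ξ - η)‖) := by gcongr
      _ = _ := by ring
  have h2 : eLpNorm (weightedFourier n t h) 2 volume ≤
      ENNReal.ofReal (2 ^ (|t| / 2)) * eLpNorm k 1 volume * eLpNorm G 2 volume := by
    rw [eLpNorm_one_eq_lintegral_enorm,
      eLpNorm_eq_lintegral_rpow_enorm_toReal (by norm_num) (by norm_num),
      eLpNorm_eq_lintegral_rpow_enorm_toReal (by norm_num) (by norm_num)]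
    simp only [ENNReal.toReal_ofNat]
    have e2 : ∀ x : ℝ≥0∞, (x ^ (2 : ℝ)) ^ (1 / 2 : ℝ) = x := fun x => by
      rw [← ENNReal.rpow_mul]; norm_num
    calc (∫⁻ ξ, ‖weightedFourier n t h ξ‖ₑ ^ (2 : ℝ)) ^ (1 / 2 : ℝ)
        ≤ (∫⁻ ξ, (ENNReal.ofReal (2 ^ (|t| / 2)) *
            ∫⁻ η, ‖k η‖ₑ * ‖G (ξ - η)‖ₑ) ^ (2 : ℝ)) ^ (1 / 2 : ℝ) := by
          gcongr with ξ
          exact hpt ξ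
      _ ≤ (ENNReal.ofReal (2 ^ (|t| / 2)) ^ (2 : ℝ) * ((∫⁻ η, ‖k η‖ₑ) ^ (2 : ℝ) *
            ∫⁻ η, ‖G η‖ₑ ^ (2 : ℝ))) ^ (1 / 2 : ℝ) := by
          gcongr
          simp only [ENNReal.mul_rpow_of_nonneg _ _ (zero_le_two : (0 : ℝ) ≤ 2)]
          rw [lintegral_const_mul' _ _ (by finiteness)]
          gcongr
          exact lintegral_convolution_sq_le k.continuous.measurable.enorm
            G.continuous.measurable.enorm
      _ = _ := by
          rw [ENNReal.mul_rpow_of_nonneg _ _ (by norm_num),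
            ENNReal.mul_rpow_of_nonneg _ _ (by norm_num), e2, e2, mul_assoc]
  refine (ENNReal.toReal_mono ?_ h2).trans ?_
  · exact ENNReal.mul_ne_top (ENNReal.mul_ne_top ENNReal.ofReal_ne_top
      (k.memLp 1 volume).eLpNorm_ne_top) (G.memLp 2 volume).eLpNorm_ne_top
  · rw [ENNReal.toReal_mul, ENNReal.toReal_mul, ENNReal.toReal_ofReal (by positivity)]

end SobolevSchwartz

/-! ### Smooth functions on a smooth hypersurface -/

section Glue

variable {d : ℕ} {F : Type*} [NormedAddCommGroup F] [NormedSpace ℝ F]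

/-- `f : S → F` is, near `x`, the restriction of a smooth function. -/
def IsLocallySmoothAt (S : Set (Eu d)) (f : S → F) (x : S) : Prop :=
  ∃ U ∈ 𝓝 (x : Eu d), ∃ g : Eu d → F, ContDiffOn ℝ ∞ g U ∧ ∀ y : S, (y : Eu d) ∈ U → g y = f y

open scoped Manifold in
/-- On a closed set, locally smooth functions are smooth. -/
theorem isSmoothOn_of_forall_isLocallySmoothAt {S : Set (Eu d)} (hS : IsClosed S) {f : S → F}
    (h : ∀ x, IsLocallySmoothAt S f x) : IsSmoothOn S f := by
  -- The admissible values are a single point on `S` and all of `F` off `S`. Both are convex, so a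
  -- partition of unity glues the local extensions.
  have hconv : ∀ x : Eu d, Convex ℝ {z : F | ∀ hx : x ∈ S, z = f ⟨x, hx⟩} := by
    intro x a ha b hb s t _ _ hst hx
    rw [ha hx, hb hx, ← add_smul, hst, one_smul]
  obtain ⟨g, hg⟩ := exists_contMDiffMap_forall_mem_convex_of_local (n := (⊤ : ℕ∞)) (𝓘(ℝ, Eu d))
    hconv fun x => by
      by_cases hx : x ∈ S
      · obtain ⟨U, hU, g, hg, hgf⟩ := h ⟨x, hx⟩
        exact ⟨U, hU, g, hg.contMDiffOn, fun y hy hyS => hgf ⟨y, hyS⟩ hy⟩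
      · exact ⟨Sᶜ, hS.isOpen_compl.mem_nhds hx, 0, contMDiffOn_const,
          fun y hy hyS => absurd hyS hy⟩
  exact ⟨g, g.contMDiff.contDiff, fun x => hg x x.2⟩

theorem IsSmoothOn.isLocallySmoothAt {S : Set (Eu d)} {f : S → F} (h : IsSmoothOn S f) (x : S) :
    IsLocallySmoothAt S f x := by
  obtain ⟨g, hg, hgf⟩ := h
  exact ⟨univ, univ_mem, g, hg.contDiffOn, fun y _ => hgf y⟩

theorem smoothExt_contDiff {S : Set (Eu d)} (f : S → F) : ContDiff ℝ ∞ (smoothExt S f) := by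
  unfold smoothExt
  split_ifs with h
  · exact h.choose_spec.1
  · exact contDiff_const

theorem smoothExt_apply {S : Set (Eu d)} {f : S → F} (h : IsSmoothOn S f) (x : S) :
    smoothExt S f x = f x := by
  unfold smoothExt
  rw [dif_pos h]
  exact h.choose_spec.2 x

end Glue

/-! ### The outer normal, tangent vectors, and independence of tangential derivatives from the
extension. -/

section Normal

theorem norm_inv_norm_smul {E : Type*} [NormedAddCommGroup E] [NormedSpace ℝ E] {v : E}
    (hv : v ≠ 0) : ‖‖v‖⁻¹ • v‖ = 1 := by
  rw [norm_smul, norm_inv, norm_norm, inv_mul_cancel₀ (norm_ne_zero_iff.2 hv)]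

variable {d : ℕ}

theorem eq_zero_of_mem_frontier {Ω : Set (Eu d)} (hΩ : IsOpen Ω) {x : Eu d} (hx : x ∈ frontier Ω)
    {ρ : Eu d → ℝ} (hρ : Continuous ρ) (hρΩ : ∀ᶠ y in 𝓝 x, y ∈ Ω ↔ ρ y < 0) : ρ x = 0 := by
  rw [hΩ.frontier_eq] at hx
  refine le_antisymm ?_ (not_lt.1 fun h => hx.2 (hρΩ.self_of_nhds.2 h))
  have hfr : ∃ᶠ y in 𝓝 x, y ∈ Ω := mem_closure_iff_frequently.1 hx.1
  refine le_of_tendsto_of_frequently hρ.continuousAt (b := 0) ?_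
  exact (hfr.and_eventually hρΩ).mono fun y hy => (hy.2.1 hy.1).le

/-- If the two unit normals differed, the direction `ν' - ν` would strictly decrease `ρ` and
strictly increase `σ`, and nearby points along it would lie both inside and outside `Ω`. -/
theorem IsOuterUnitNormal.unique {Ω : Set (Eu d)} {x ν ν' : Eu d} (hx : x ∈ frontier Ω)
    (hΩ : IsOpen Ω) (h : IsOuterUnitNormal Ω x ν) (h' : IsOuterUnitNormal Ω x ν') : ν = ν' := by
  obtain ⟨ρ, hρ, hρ0, hρΩ, rfl⟩ := h
  obtain ⟨σ, hσ, hσ0, hσΩ, rfl⟩ := h'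
  have zero : ∀ τ : Eu d → ℝ, ContDiff ℝ ∞ τ → (∀ᶠ y in 𝓝 x, y ∈ Ω ↔ τ y < 0) → τ x = 0 :=
    fun τ hτ hτΩ => eq_zero_of_mem_frontier hΩ hx hτ.continuous hτΩ
  have key : ∀ v : Eu d, ¬ (inner ℝ (gradient ρ x) v < 0 ∧ 0 < inner ℝ (gradient σ x) v) := by
    rintro v ⟨h1, h2⟩
    have hline : Tendsto (fun s : ℝ => x + s • v) (𝓝[>] 0) (𝓝 x) := by
      have : Continuous fun s : ℝ => x + s • v := by fun_prop
      simpa using (this.tendsto 0).mono_left nhdsWithin_le_nhds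
    have der : ∀ τ : Eu d → ℝ, ContDiff ℝ ∞ τ →
        HasDerivAt (fun s : ℝ => τ (x + s • v)) (inner ℝ (gradient τ x) v) 0 := by
      intro τ hτ
      rw [inner_gradient_left]
      have hl : HasDerivAt (fun s : ℝ => x + s • v) v 0 := by
        simpa using ((hasDerivAt_id (0 : ℝ)).smul_const v).const_add x
      have hf : HasFDerivAt τ (fderiv ℝ τ x) (x + (0 : ℝ) • v) := by
        simpa using (hτ.differentiable (by simp) x).hasFDerivAt
      exact hf.comp_hasDerivAt 0 hl
    have e1 : ∀ᶠ s in 𝓝[>] (0 : ℝ), ρ (x + s • v) < 0 := by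
      have := (hasDerivAt_iff_tendsto_slope.1 (der ρ hρ)).eventually_lt_const h1
      have := this.filter_mono (nhdsWithin_mono _ fun s (hs : 0 < s) => hs.ne')
      filter_upwards [this, self_mem_nhdsWithin] with s hs (hs0 : 0 < s)
      rw [slope_def_field] at hs
      simp only [zero_smul, add_zero, zero ρ hρ hρΩ, sub_zero] at hs
      exact (div_neg_iff.1 hs).elim (fun h => absurd hs0 (not_lt.2 h.2.le)) fun h => h.1
    have e2 : ∀ᶠ s in 𝓝[>] (0 : ℝ), 0 < σ (x + s • v) := by
      have := (hasDerivAt_iff_tendsto_slope.1 (der σ hσ)).eventually_const_lt h2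
      have := this.filter_mono (nhdsWithin_mono _ fun s (hs : 0 < s) => hs.ne')
      filter_upwards [this, self_mem_nhdsWithin] with s hs (hs0 : 0 < s)
      rw [slope_def_field] at hs
      simp only [zero_smul, add_zero, zero σ hσ hσΩ, sub_zero] at hs
      exact (div_pos_iff_of_pos_right hs0).1 hs
    obtain ⟨s, h1, h2, h3, h4⟩ :=
      (e1.and (e2.and ((hline.eventually hρΩ).and (hline.eventually hσΩ)))).exists
    exact absurd (h4.1 (h3.2 h1)) (not_lt.2 h2.le)
  set a := ‖gradient ρ x‖⁻¹ • gradient ρ x with ha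
  set b := ‖gradient σ x‖⁻¹ • gradient σ x with hb
  have na : ‖a‖ = 1 := norm_inv_norm_smul hρ0
  have nb : ‖b‖ = 1 := norm_inv_norm_smul hσ0
  by_contra hab
  have hlt : inner ℝ a b < 1 := by
    refine lt_of_le_of_ne (by simpa [na, nb] using real_inner_le_norm a b) fun h => hab ?_
    exact (inner_eq_one_iff_of_norm_eq_one na nb).1 h
  have pa : gradient ρ x = ‖gradient ρ x‖ • a := by
    rw [ha, smul_smul, mul_inv_cancel₀ (norm_ne_zero_iff.2 hρ0), one_smul]
  have pb : gradient σ x = ‖gradient σ x‖ • b := by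
    rw [hb, smul_smul, mul_inv_cancel₀ (norm_ne_zero_iff.2 hσ0), one_smul]
  refine key (b - a) ⟨?_, ?_⟩
  · rw [pa, real_inner_smul_left, inner_sub_right, real_inner_self_eq_norm_sq, na]
    exact mul_neg_of_pos_of_neg (norm_pos_iff.2 hρ0) (by linarith)
  · rw [pb, real_inner_smul_left, inner_sub_right, real_inner_self_eq_norm_sq, nb,
      real_inner_comm]
    exact mul_pos (norm_pos_iff.2 hσ0) (by linarith)

/-- `Γ` is the boundary of the open set `Ω` with smooth boundary. -/
structure IsSmoothBoundary (Ω : Set (Eu d)) (Γ : Compacts (Eu d)) : Prop where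
  isOpen : IsOpen Ω
  smooth : HasSmoothBoundary Ω
  eq_frontier : (Γ : Set (Eu d)) = frontier Ω

variable {Ω : Set (Eu d)} {Γ : Compacts (Eu d)}

theorem IsSmoothBoundary.isOuterUnitNormal (h : IsSmoothBoundary Ω Γ) {x : Eu d}
    (hx : x ∈ (Γ : Set (Eu d))) : IsOuterUnitNormal Ω x (outerUnitNormal Ω x) := by
  have := h.smooth x (h.eq_frontier ▸ hx)
  rw [outerUnitNormal, dif_pos this]
  exact this.choose_spec

theorem IsSmoothBoundary.norm_outerUnitNormal (h : IsSmoothBoundary Ω Γ) {x : Eu d}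
    (hx : x ∈ (Γ : Set (Eu d))) : ‖outerUnitNormal Ω x‖ = 1 := by
  obtain ⟨ρ, -, hρ0, -, e⟩ := h.isOuterUnitNormal hx
  rw [e]
  exact norm_inv_norm_smul hρ0

theorem contDiff_gradient {ρ : Eu d → ℝ} (hρ : ContDiff ℝ ∞ ρ) : ContDiff ℝ ∞ (gradient ρ) :=
  ((InnerProductSpace.toDual ℝ (Eu d)).symm.contDiff).comp (hρ.fderiv_right (by simp))

/-- `outerUnitNormal` makes an independent choice at each point. Uniqueness identifies it near `x`
with `∇ρ / ‖∇ρ‖` for the one `ρ` that belongs to `x`. -/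
theorem IsSmoothBoundary.isSmoothOn_outerUnitNormal (h : IsSmoothBoundary Ω Γ) :
    IsSmoothOn (Γ : Set (Eu d)) (fun x => outerUnitNormal Ω x) := by
  refine isSmoothOn_of_forall_isLocallySmoothAt Γ.isCompact.isClosed fun x => ?_
  obtain ⟨ρ, hρ, hρ0, hρΩ, e⟩ := h.isOuterUnitNormal x.2
  have hg := contDiff_gradient hρ
  have hU : ∀ᶠ y in 𝓝 (x : Eu d), (∀ᶠ z in 𝓝 y, z ∈ Ω ↔ ρ z < 0) ∧ gradient ρ y ≠ 0 :=
    hρΩ.eventually_nhds.and (hg.continuous.continuousAt.eventually_ne hρ0)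
  refine ⟨_, hU, fun y => ‖gradient ρ y‖⁻¹ • gradient ρ y, ?_, fun y hy => ?_⟩
  · intro y hy
    have h0 : gradient ρ y ≠ 0 := hy.2
    exact (((hg.contDiffAt.norm ℝ h0).inv (norm_ne_zero_iff.2 h0)).smul
      hg.contDiffAt).contDiffWithinAt
  · exact IsOuterUnitNormal.unique (h.eq_frontier ▸ y.2) h.isOpen ⟨ρ, hρ, hy.2, hy.1, rfl⟩
      (h.isOuterUnitNormal y.2)

/-- The differential of a function that vanishes on the hypersurface vanishes on tangent
vectors. -/
theorem IsSmoothBoundary.fderiv_eq_zero {F : Type*} [NormedAddCommGroup F] [NormedSpace ℝ F]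
    (h : IsSmoothBoundary Ω Γ) {x : Eu d} (hx : x ∈ (Γ : Set (Eu d))) {f : Eu d → F}
    (hf : ContDiffAt ℝ 1 f x) (hf0 : ∀ᶠ y in 𝓝 x, y ∈ (Γ : Set (Eu d)) → f y = 0) {v : Eu d}
    (hv : inner ℝ (outerUnitNormal Ω x) v = 0) : fderiv ℝ f x v = 0 := by
  refine SeparatingDual.eq_zero_of_forall_dual_eq_zero (R := ℝ) fun L => ?_
  obtain ⟨ρ, hρ, hρ0, hρΩ, e⟩ := h.isOuterUnitNormal hx
  have hg := contDiff_gradient hρ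
  have hρx : ρ x = 0 := eq_zero_of_mem_frontier h.isOpen (h.eq_frontier ▸ hx) hρ.continuous hρΩ
  -- Near `x` the zero set of `ρ` lies in `Γ`: a zero of `ρ` outside the closure of `Ω` would be a
  -- local minimum, where the gradient vanishes.
  have hlev : ∀ᶠ y in 𝓝 x, ρ y = 0 → y ∈ (Γ : Set (Eu d)) := by
    filter_upwards [hρΩ.eventually_nhds, hg.continuous.continuousAt.eventually_ne hρ0] with y hy hy0
      hρy
    rw [h.eq_frontier, h.isOpen.frontier_eq]
    refine ⟨mem_closure_iff_frequently.2 fun hn => hy0 ?_, fun h' => ?_⟩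
    · have : IsLocalMin ρ y := by
        filter_upwards [hn, hy] with z hz hz'
        rw [hρy]
        exact not_lt.1 fun h' => hz (hz'.2 h')
      rw [gradient, this.fderiv_eq_zero, map_zero]
    · exact absurd (hy.self_of_nhds.1 h') (by simp [hρy])
  have hfx : f x = 0 := hf0.self_of_nhds hx
  -- `L ∘ f` is constant on the level set of `ρ` near `x`, so `x` is a constrained extremum, and the
  -- Lagrange multiplier rule makes the differential of `L ∘ f` a multiple of that of `ρ`.
  have hext : IsLocalExtrOn (fun y => L (f y)) {y | ρ y = ρ x} x := by
    left
    filter_upwards [nhdsWithin_le_nhds (hlev.and hf0), self_mem_nhdsWithin] with y hy hy'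
    rw [hfx, hy.2 (hy.1 (by rw [hy', hρx]))]
  have hLf : HasStrictFDerivAt (fun y => L (f y)) (L ∘L fderiv ℝ f x) x :=
    L.hasStrictFDerivAt.comp x (hf.hasStrictFDerivAt (by simp))
  obtain ⟨a, b, hab, hlin⟩ := hext.exists_multipliers_of_hasStrictFDerivAt_1d
    (hρ.contDiffAt.hasStrictFDerivAt (by simp)) hLf
  have hb : b ≠ 0 := by
    rintro rfl
    have ha : a ≠ 0 := by
      rintro rfl
      exact hab rfl
    have : fderiv ℝ ρ x = 0 := by simpa [ha] using hlin
    exact hρ0 (by rw [gradient, this, map_zero])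
  have hρv : fderiv ℝ ρ x v = 0 := by
    rw [e, real_inner_smul_left, inner_gradient_left] at hv
    exact (mul_eq_zero.1 hv).resolve_left (inv_ne_zero (norm_ne_zero_iff.2 hρ0))
  have := DFunLike.congr_fun hlin v
  simpa [hρv, hb] using this

/-- Curves and parametrized pieces of the hypersurface have tangent velocities. -/
theorem IsSmoothBoundary.inner_fderiv_eq_zero {E : Type*} [NormedAddCommGroup E] [NormedSpace ℝ E]
    (h : IsSmoothBoundary Ω Γ) {f : E → Eu d} {y : E} (hf : DifferentiableAt ℝ f y)
    (hfΓ : ∀ᶠ z in 𝓝 y, f z ∈ (Γ : Set (Eu d))) (v : E) :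
    inner ℝ (outerUnitNormal Ω (f y)) (fderiv ℝ f y v) = 0 := by
  obtain ⟨ρ, hρ, -, hρΩ, e⟩ := h.isOuterUnitNormal hfΓ.self_of_nhds
  have h0 : (fun z => ρ (f z)) =ᶠ[𝓝 y] fun _ => 0 := by
    filter_upwards [hfΓ, hf.continuousAt.eventually hρΩ.eventually_nhds] with z hz hz'
    exact eq_zero_of_mem_frontier h.isOpen (h.eq_frontier ▸ hz) hρ.continuous hz'
  have h1 := ((hρ.differentiable (by simp) (f y)).hasFDerivAt.comp y hf.hasFDerivAt).fderiv
  have h2 := h0.fderiv_eq (𝕜 := ℝ)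
  rw [show (fun z => ρ (f z)) = ρ ∘ f from rfl, h1, fderiv_fun_const] at h2
  rw [e, real_inner_smul_left, inner_gradient_left]
  have := DFunLike.congr_fun h2 v
  simp only [ContinuousLinearMap.comp_apply, Pi.zero_apply, _root_.zero_apply] at this
  rw [this, mul_zero]

/-- The orthogonal projection onto the tangent space. -/
def tangentProj (Ω : Set (Eu d)) (x : Eu d) (v : Eu d) : Eu d :=
  v - inner ℝ (outerUnitNormal Ω x) v • outerUnitNormal Ω x

theorem IsSmoothBoundary.inner_tangentProj (h : IsSmoothBoundary Ω Γ) {x : Eu d}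
    (hx : x ∈ (Γ : Set (Eu d))) (v : Eu d) :
    inner ℝ (outerUnitNormal Ω x) (tangentProj Ω x v) = 0 := by
  rw [tangentProj, inner_sub_right, real_inner_smul_right, real_inner_self_eq_norm_sq,
    h.norm_outerUnitNormal hx]
  simp

theorem tangentProj_of_inner_eq_zero {x v : Eu d} (hv : inner ℝ (outerUnitNormal Ω x) v = 0) :
    tangentProj Ω x v = v := by
  rw [tangentProj, hv, zero_smul, sub_zero]

/-- Tangential derivatives do not depend on the extension. -/
theorem IsSmoothBoundary.fderiv_eq_fderiv_smoothExt {F : Type*} [NormedAddCommGroup F]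
    [NormedSpace ℝ F] (h : IsSmoothBoundary Ω Γ) {f : ↥(Γ : Set (Eu d)) → F}
    (hf : IsSmoothOn (Γ : Set (Eu d)) f) (x : (Γ : Set (Eu d))) {g : Eu d → F}
    (hg : ContDiffAt ℝ 1 g x)
    (hgf : ∀ᶠ y in 𝓝 (x : Eu d), ∀ hy : y ∈ (Γ : Set (Eu d)), g y = f ⟨y, hy⟩) {v : Eu d}
    (hv : inner ℝ (outerUnitNormal Ω x) v = 0) :
    fderiv ℝ g x v = fderiv ℝ (smoothExt (Γ : Set (Eu d)) f) x v := by
  have hs : ContDiffAt ℝ 1 (smoothExt (Γ : Set (Eu d)) f) x :=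
    ((smoothExt_contDiff f).of_le (by exact_mod_cast le_top)).contDiffAt
  rw [← sub_eq_zero, ← _root_.sub_apply,
    ← fderiv_sub (hg.differentiableAt (by simp)) (hs.differentiableAt (by simp))]
  refine h.fderiv_eq_zero x.2 (hg.sub hs) ?_ hv
  filter_upwards [hgf] with y hy hyΓ
  rw [hy hyΓ, smoothExt_apply hf ⟨y, hyΓ⟩, sub_self]

end Normal

/-! ### The tangential derivations -/

section TangentialDerivation

variable {d : ℕ} {Ω : Set (Eu d)} {Γ : Compacts (Eu d)}

/-- The `l`-th basis vector projected to the tangent space. -/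
abbrev tangentBasis (Ω : Set (Eu d)) (x : Eu d) (l : Fin d) : Eu d :=
  tangentProj Ω x (EuclideanSpace.single l 1)

theorem IsSmoothBoundary.isSmoothOn_tangentialDeriv (h : IsSmoothBoundary Ω Γ) (u : SmoothFun Γ)
    (l : Fin d) : IsSmoothOn (Γ : Set (Eu d))
      (fun x => fderiv ℝ (smoothExt (Γ : Set (Eu d)) u.1) x (tangentBasis Ω x l)) := by
  obtain ⟨ν, hν, hνe⟩ := h.isSmoothOn_outerUnitNormal
  refine ⟨fun x => fderiv ℝ (smoothExt (Γ : Set (Eu d)) u.1) x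
    (EuclideanSpace.single l 1 - inner ℝ (ν x) (EuclideanSpace.single l 1) • ν x), ?_, fun x => ?_⟩
  · refine ContDiff.clm_apply ((smoothExt_contDiff u.1).fderiv_right (by simp)) ?_
    exact contDiff_const.sub ((hν.inner ℝ contDiff_const).smul hν)
  · simp only [hνe, tangentBasis, tangentProj]

/-- The `l`-th component of the tangential gradient, as a derivation of `C^∞(Γ, ℂ)`. -/
def tangentialDeriv (h : IsSmoothBoundary Ω Γ) (l : Fin d) :
    Derivation ℂ (SmoothFun Γ) (SmoothFun Γ) :=
  have hc : ∀ (u : SmoothFun Γ) (x : (Γ : Set (Eu d))),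
      DifferentiableAt ℝ (smoothExt (Γ : Set (Eu d)) u.1) x := fun u x =>
    (smoothExt_contDiff u.1).differentiable (by simp) x
  Derivation.mk'
    { toFun := fun u => ⟨fun x => fderiv ℝ (smoothExt (Γ : Set (Eu d)) u.1) x (tangentBasis Ω x l),
        h.isSmoothOn_tangentialDeriv u l⟩
      -- `smoothExt` is a choice and need not be additive. The sum of the chosen extensions is
      -- another extension of the sum, and tangential derivatives do not see the difference; scalar
      -- multiples and products are treated alike.
      map_add' := fun u v => by
        ext x
        change fderiv ℝ (smoothExt (Γ : Set (Eu d)) (u + v).1) x _ =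
          fderiv ℝ (smoothExt (Γ : Set (Eu d)) u.1) x _ +
          fderiv ℝ (smoothExt (Γ : Set (Eu d)) v.1) x _
        rw [← add_apply, ← fderiv_add (hc u x) (hc v x)]
        refine (h.fderiv_eq_fderiv_smoothExt (u + v).2 x ?_ (.of_forall fun y hy => ?_)
          (h.inner_tangentProj x.2 _)).symm
        · exact (((smoothExt_contDiff u.1).add (smoothExt_contDiff v.1)).of_le
            (by exact_mod_cast le_top)).contDiffAt
        · rw [Pi.add_apply, smoothExt_apply u.2 ⟨y, hy⟩, smoothExt_apply v.2 ⟨y, hy⟩]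
          rfl
      map_smul' := fun c u => by
        ext x
        change fderiv ℝ (smoothExt (Γ : Set (Eu d)) (c • u).1) x _ =
          c • fderiv ℝ (smoothExt (Γ : Set (Eu d)) u.1) x _
        rw [← smul_apply, ← fderiv_const_smul (hc u x)]
        refine (h.fderiv_eq_fderiv_smoothExt (c • u).2 x ?_ (.of_forall fun y hy => ?_)
          (h.inner_tangentProj x.2 _)).symm
        · exact (((smoothExt_contDiff u.1).const_smul c).of_le
            (by exact_mod_cast le_top)).contDiffAt
        · rw [Pi.smul_apply, smoothExt_apply u.2 ⟨y, hy⟩]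
          rfl }
    (fun u v => by
      ext x
      change fderiv ℝ (smoothExt (Γ : Set (Eu d)) (u * v).1) x _ =
        u.1 x * fderiv ℝ (smoothExt (Γ : Set (Eu d)) v.1) x _ +
        v.1 x * fderiv ℝ (smoothExt (Γ : Set (Eu d)) u.1) x _
      rw [← h.fderiv_eq_fderiv_smoothExt (u * v).2 x
        (g := smoothExt (Γ : Set (Eu d)) u.1 * smoothExt (Γ : Set (Eu d)) v.1) ?_
        (.of_forall fun y hy => ?_) (h.inner_tangentProj x.2 _), fderiv_mul (hc u x) (hc v x),
        smoothExt_apply u.2, smoothExt_apply v.2]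
      · rfl
      · exact (((smoothExt_contDiff u.1).mul (smoothExt_contDiff v.1)).of_le
          (by exact_mod_cast le_top)).contDiffAt
      · rw [Pi.mul_apply, smoothExt_apply u.2 ⟨y, hy⟩, smoothExt_apply v.2 ⟨y, hy⟩]
        rfl)

theorem tangentialDeriv_apply (h : IsSmoothBoundary Ω Γ) (l : Fin d) (u : SmoothFun Γ)
    (x : (Γ : Set (Eu d))) : (tangentialDeriv h l u).1 x =
      fderiv ℝ (smoothExt (Γ : Set (Eu d)) u.1) x (tangentBasis Ω x l) := rfl

/-- The tangential derivative computed with an arbitrary local extension. -/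
theorem tangentialDeriv_eq_fderiv (h : IsSmoothBoundary Ω Γ) (l : Fin d) (u : SmoothFun Γ)
    (x : (Γ : Set (Eu d))) {g : Eu d → ℂ} (hg : ContDiffAt ℝ 1 g x)
    (hgu : ∀ᶠ y in 𝓝 (x : Eu d), ∀ hy : y ∈ (Γ : Set (Eu d)), g y = u.1 ⟨y, hy⟩) :
    (tangentialDeriv h l u).1 x = fderiv ℝ g x (tangentBasis Ω x l) :=
  (h.fderiv_eq_fderiv_smoothExt u.2 x hg hgu (h.inner_tangentProj x.2 _)).symm

/-- The derivative in a tangent direction, in terms of the tangential gradient. -/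
theorem fderiv_eq_sum_tangentialDeriv (h : IsSmoothBoundary Ω Γ) (u : SmoothFun Γ)
    (x : (Γ : Set (Eu d))) {g : Eu d → ℂ} (hg : ContDiffAt ℝ 1 g x)
    (hgu : ∀ᶠ y in 𝓝 (x : Eu d), ∀ hy : y ∈ (Γ : Set (Eu d)), g y = u.1 ⟨y, hy⟩) {v : Eu d}
    (hv : inner ℝ (outerUnitNormal Ω x) v = 0) :
    fderiv ℝ g x v = ∑ l, ((v l : ℝ) : ℂ) * (tangentialDeriv h l u).1 x := by
  -- A tangent vector equals its projection, so the standard basis in its expansion may be replaced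
  -- by the projected one.
  have e : v = ∑ l, v l • tangentBasis Ω x l := by
    have e1 : v = ∑ l, v l • EuclideanSpace.single l (1 : ℝ) := by
      simpa using ((EuclideanSpace.basisFun (Fin d) ℝ).sum_repr v).symm
    conv_lhs => rw [← tangentProj_of_inner_eq_zero hv]
    conv_lhs => rw [tangentProj, e1]
    simp only [tangentBasis, tangentProj, smul_sub, Finset.sum_sub_distrib, inner_sum,
      Finset.sum_smul, real_inner_smul_right, mul_smul]
  conv_lhs => rw [e]
  simp only [map_sum, map_smul, Complex.real_smul,
    tangentialDeriv_eq_fderiv h _ u x hg hgu]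

end TangentialDerivation

/-! ### The topological algebra `C^∞(Γ, ℂ)` -/

section TopologicalAlgebra

variable {d : ℕ} {Ω : Set (Eu d)} {Γ : Compacts (Eu d)}

instance compactSpace_coe_compacts : CompactSpace ↥(Γ : Set (Eu d)) :=
  isCompact_iff_compactSpace.1 Γ.isCompact

theorem SmoothFun.continuous (u : SmoothFun Γ) : Continuous u.1 := by
  obtain ⟨g, hg, hgu⟩ := u.2
  have : u.1 = fun x : ↥(Γ : Set (Eu d)) => g x := funext fun x => (hgu x).symm
  rw [this]
  exact hg.continuous.comp continuous_subtype_val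

/-- The inclusion `C^∞(Γ, ℂ) → C(Γ, ℂ)`. -/
def toContinuousMapₐ (Γ : Compacts (Eu d)) : SmoothFun Γ →ₐ[ℂ] C(↥(Γ : Set (Eu d)), ℂ) where
  toFun u := ⟨u.1, u.continuous⟩
  map_one' := rfl
  map_mul' _ _ := rfl
  map_zero' := rfl
  map_add' _ _ := rfl
  commutes' _ := rfl

/-- The algebra `C^∞(Γ, ℂ)` with the topology of uniform convergence of all iterated tangential
derivatives. -/
def TopSmoothFun (_h : IsSmoothBoundary Ω Γ) : Type := SmoothFun Γ

variable (h : IsSmoothBoundary Ω Γ)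

instance : CommRing (TopSmoothFun h) := inferInstanceAs (CommRing (SmoothFun Γ))

instance : Algebra ℂ (TopSmoothFun h) := inferInstanceAs (Algebra ℂ (SmoothFun Γ))

/-- The tangential derivations on the topological algebra `C^∞(Γ, ℂ)`. -/
def topDeriv (l : Fin d) : Derivation ℂ (TopSmoothFun h) (TopSmoothFun h) := tangentialDeriv h l

/-- The embedding of the topological algebra `C^∞(Γ, ℂ)` into the continuous functions. -/
def topEval : TopSmoothFun h →ₐ[ℂ] C(↥(Γ : Set (Eu d)), ℂ) := toContinuousMapₐ Γ

theorem topEval_injective : Function.Injective (topEval h) := fun _ _ hab =>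
  Subtype.ext (funext fun x => DFunLike.congr_fun hab x)

/-- Iterated tangential derivatives. -/
def wordDeriv : List (Fin d) → TopSmoothFun h →ₗ[ℂ] TopSmoothFun h
  | [] => LinearMap.id
  | l :: w => wordDeriv w ∘ₗ (topDeriv h l).toLinearMap

instance : TopologicalSpace (TopSmoothFun h) :=
  TopologicalSpace.induced (fun a (w : List (Fin d)) => topEval h (wordDeriv h w a)) inferInstance

variable {h} {α : Type*} {f g : α → TopSmoothFun h} {l : Filter α} {a b : TopSmoothFun h}

/-- Uniform convergence of the iterated tangential derivatives of order at most `k`. -/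
def TendstoUpTo (k : ℕ) (f : α → TopSmoothFun h) (l : Filter α) (a : TopSmoothFun h) : Prop :=
  ∀ w : List (Fin d), w.length ≤ k →
    Tendsto (fun s => topEval h (wordDeriv h w (f s))) l (𝓝 (topEval h (wordDeriv h w a)))

theorem tendsto_iff_wordDeriv : Tendsto f l (𝓝 a) ↔ ∀ w : List (Fin d),
    Tendsto (fun s => topEval h (wordDeriv h w (f s))) l (𝓝 (topEval h (wordDeriv h w a))) := by
  rw [nhds_induced, tendsto_comap_iff, tendsto_pi_nhds]
  rfl

theorem tendsto_iff_tendstoUpTo : Tendsto f l (𝓝 a) ↔ ∀ k, TendstoUpTo k f l a := by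
  rw [tendsto_iff_wordDeriv]
  exact ⟨fun H k w _ => H w, fun H w => H w.length w le_rfl⟩

theorem tendstoUpTo_zero : TendstoUpTo 0 f l a ↔
    Tendsto (fun s => topEval h (f s)) l (𝓝 (topEval h a)) := by
  refine ⟨fun H => H [] le_rfl, fun H w hw => ?_⟩
  rw [List.eq_nil_of_length_eq_zero (Nat.le_zero.1 hw)]
  exact H

/-- A word applies its head first, so a nonempty word is one derivation followed by a shorter word.
This drives the inductions on the order for products and inverse square roots. -/
theorem tendstoUpTo_succ {k : ℕ} : TendstoUpTo (k + 1) f l a ↔ TendstoUpTo 0 f l a ∧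
    ∀ i, TendstoUpTo k (fun s => topDeriv h i (f s)) l (topDeriv h i a) := by
  refine ⟨fun H => ⟨fun w hw => H w (hw.trans (Nat.zero_le _)), fun i w hw =>
    H (i :: w) (Nat.succ_le_succ hw)⟩, fun H w hw => ?_⟩
  cases w with
  | nil => exact H.1 [] le_rfl
  | cons i w => exact H.2 i w (Nat.le_of_succ_le_succ hw)

theorem TendstoUpTo.of_succ {k : ℕ} (H : TendstoUpTo (k + 1) f l a) : TendstoUpTo k f l a :=
  fun w hw => H w (hw.trans (Nat.le_succ k))

theorem TendstoUpTo.congr' {k : ℕ} (H : TendstoUpTo k f l a) (hfg : f =ᶠ[l] g) :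
    TendstoUpTo k g l a := fun w hw =>
  (H w hw).congr' (hfg.mono fun s hs => by rw [hs])

theorem TendstoUpTo.add {k : ℕ} (hf : TendstoUpTo k f l a) (hg : TendstoUpTo k g l b) :
    TendstoUpTo k (fun s => f s + g s) l (a + b) := fun w hw => by
  simpa only [map_add] using (hf w hw).add (hg w hw)

theorem TendstoUpTo.const_smul {k : ℕ} (hf : TendstoUpTo k f l a) (c : ℂ) :
    TendstoUpTo k (fun s => c • f s) l (c • a) := fun w hw => by
  simpa only [map_smul] using (hf w hw).const_smul c

theorem TendstoUpTo.mul {k : ℕ} (hf : TendstoUpTo k f l a) (hg : TendstoUpTo k g l b) :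
    TendstoUpTo k (fun s => f s * g s) l (a * b) := by
  induction k generalizing f g a b with
  | zero =>
    rw [tendstoUpTo_zero] at *
    simpa only [map_mul] using hf.mul hg
  | succ k ih =>
    have hf' := tendstoUpTo_succ.1 hf
    have hg' := tendstoUpTo_succ.1 hg
    refine tendstoUpTo_succ.2 ⟨?_, fun i => ?_⟩
    · rw [tendstoUpTo_zero]
      simpa only [map_mul] using (tendstoUpTo_zero.1 hf'.1).mul (tendstoUpTo_zero.1 hg'.1)
    · simp only [Derivation.leibniz, smul_eq_mul]
      exact (ih hf.of_succ (hg'.2 i)).add (ih hg.of_succ (hf'.2 i))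

instance : IsTopologicalRing (TopSmoothFun h) where
  continuous_add := continuous_iff_continuousAt.2 fun p =>
    tendsto_iff_tendstoUpTo.2 fun k =>
      (tendsto_iff_tendstoUpTo.1 (continuous_fst.tendsto p) k).add
        (tendsto_iff_tendstoUpTo.1 (continuous_snd.tendsto p) k)
  continuous_mul := continuous_iff_continuousAt.2 fun p =>
    tendsto_iff_tendstoUpTo.2 fun k =>
      (tendsto_iff_tendstoUpTo.1 (continuous_fst.tendsto p) k).mul
        (tendsto_iff_tendstoUpTo.1 (continuous_snd.tendsto p) k)
  continuous_neg := continuous_iff_continuousAt.2 fun p =>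
    tendsto_iff_tendstoUpTo.2 fun k => by
      simpa using (tendsto_iff_tendstoUpTo.1 (tendsto_id (x := 𝓝 p)) k).const_smul (-1)

theorem continuous_topDeriv (i : Fin d) : Continuous (topDeriv h i) :=
  continuous_iff_continuousAt.2 fun p => tendsto_iff_tendstoUpTo.2 fun k =>
    (tendstoUpTo_succ.1 (tendsto_iff_tendstoUpTo.1 (tendsto_id (x := 𝓝 p)) (k + 1))).2 i

/-- All values are positive real numbers. -/
def IsPosReal (a : TopSmoothFun h) : Prop := ∀ x, ∃ c : ℝ, 0 < c ∧ topEval h a x = c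

/-- Here `a = p^(-1/2)` and `b = q^(-1/2)`. From `(a - b)(a + b) = a² b² (q - p)` one gets `|a - b|
≤ a b² δ ≤ (|a - b| + b) b² δ`, and `K ^ 2 * δ ≤ 1 / 2` absorbs the first term on the left. Only the
limit value `b` has to be bounded in advance. -/
theorem abs_sub_le_of_inv_sq {a b p q K δ : ℝ} (ha : 0 < a) (hb : 0 < b) (hap : a ^ 2 * p = 1)
    (hbq : b ^ 2 * q = 1) (hbK : b ≤ K) (hpq : |p - q| ≤ δ) (hK : K ^ 2 * δ ≤ 1 / 2) :
    |a - b| ≤ 2 * K ^ 3 * δ := by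
  have hδ : 0 ≤ δ := (abs_nonneg _).trans hpq
  have e : (a - b) * (a + b) = a ^ 2 * b ^ 2 * (q - p) := by
    linear_combination (-a ^ 2) * hbq + b ^ 2 * hap
  have e' : |a - b| * (a + b) = a ^ 2 * b ^ 2 * |p - q| := by
    rw [← abs_of_pos (add_pos ha hb), ← abs_mul, e, abs_mul, abs_of_nonneg (by positivity),
      abs_sub_comm]
  have h1 : |a - b| * a ≤ (a * (b ^ 2 * δ)) * a := by
    calc |a - b| * a ≤ |a - b| * (a + b) := by gcongr; linarith
      _ = a ^ 2 * b ^ 2 * |p - q| := e'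
      _ ≤ a ^ 2 * b ^ 2 * δ := by gcongr
      _ = _ := by ring
  have h2 := le_of_mul_le_mul_right h1 ha
  have h3 : a ≤ |a - b| + b := by linarith [le_abs_self (a - b)]
  have h4 : b ^ 2 * δ ≤ K ^ 2 * δ := by gcongr
  calc |a - b| = 2 * |a - b| - |a - b| := by ring
    _ ≤ 2 * ((|a - b| + b) * (b ^ 2 * δ)) - |a - b| := by
        have : a * (b ^ 2 * δ) ≤ (|a - b| + b) * (b ^ 2 * δ) := by gcongr
        linarith
    _ ≤ 2 * b * (b ^ 2 * δ) := by nlinarith [abs_nonneg (a - b)]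
    _ ≤ 2 * K * (K ^ 2 * δ) := by
        have : 0 ≤ K := hb.le.trans hbK
        gcongr
    _ = _ := by ring

/-- The map `q ↦ q^(-1/2)` is continuous on positive functions. -/
theorem tendsto_of_sq_mul_eq_one {q : α → TopSmoothFun h} {q₀ : TopSmoothFun h}
    (hq : Tendsto q l (𝓝 q₀)) (hf : ∀ᶠ s in l, IsPosReal (f s) ∧ f s ^ 2 * q s = 1)
    (ha : IsPosReal a) (haq : a ^ 2 * q₀ = 1) : Tendsto f l (𝓝 a) := by
  -- Differentiating `u ^ 2 * p = 1` expresses a derivative of `u` through `u` and the same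
  -- derivative of `p`, so convergence gains one order at a time.
  have hder : ∀ (i : Fin d) (u p : TopSmoothFun h), u ^ 2 * p = 1 →
      topDeriv h i u = (-(1 / 2) : ℂ) • (u * (u * u) * topDeriv h i p) := by
    intro i u p hup
    have h0 : topDeriv h i (u ^ 2 * p) = 0 := by rw [hup, Derivation.map_one_eq_zero]
    rw [Derivation.leibniz, sq, Derivation.leibniz] at h0
    simp only [smul_eq_mul] at h0
    have h1 : (2 : ℂ) • topDeriv h i u = -(u * (u * u) * topDeriv h i p) := by
      rw [two_smul]
      linear_combination u * h0 - 2 * topDeriv h i u * hup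
    calc topDeriv h i u = (1 / 2 : ℂ) • ((2 : ℂ) • topDeriv h i u) := by
          rw [smul_smul]; norm_num
      _ = _ := by rw [h1, neg_smul, smul_neg]
  have hreal : ∀ (u p : TopSmoothFun h) x, IsPosReal u → u ^ 2 * p = 1 →
      ∃ c e : ℝ, 0 < c ∧ topEval h u x = c ∧ topEval h p x = e ∧ c ^ 2 * e = 1 := by
    intro u p x hu hup
    obtain ⟨c, hc, hcx⟩ := hu x
    have h1 := DFunLike.congr_fun (congrArg (topEval h) hup) x
    simp only [map_mul, map_pow, map_one, ContinuousMap.mul_apply, ContinuousMap.pow_apply,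
      ContinuousMap.one_apply, hcx] at h1
    have hc' : (c : ℂ) ≠ 0 := by exact_mod_cast hc.ne'
    refine ⟨c, (c ^ 2)⁻¹, hc, hcx, ?_, by field_simp⟩
    push_cast
    field_simp
    linear_combination h1
  refine tendsto_iff_tendstoUpTo.2 fun k => ?_
  induction k with
  | zero =>
    rw [tendstoUpTo_zero, tendsto_iff_norm_sub_tendsto_zero]
    have hq0 := tendsto_iff_norm_sub_tendsto_zero.1
      (tendstoUpTo_zero.1 (tendsto_iff_tendstoUpTo.1 hq 0))
    set K := ‖topEval h a‖
    have hδ1 : Tendsto (fun s => K ^ 2 * ‖topEval h (q s) - topEval h q₀‖) l (𝓝 0) := by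
      simpa using hq0.const_mul (K ^ 2)
    have hδ2 : Tendsto (fun s => 2 * K ^ 3 * ‖topEval h (q s) - topEval h q₀‖) l (𝓝 0) := by
      simpa using hq0.const_mul (2 * K ^ 3)
    refine squeeze_zero' (.of_forall fun s => norm_nonneg _) ?_ hδ2
    filter_upwards [hf, hδ1.eventually_le_const (show (0 : ℝ) < 1 / 2 by norm_num)] with s hs hsK
    rw [ContinuousMap.norm_le _ (by positivity)]
    intro x
    obtain ⟨c, e, hc, hcx, hex, hce⟩ := hreal _ _ x hs.1 hs.2
    obtain ⟨c', e', hc', hcx', hex', hce'⟩ := hreal _ _ x ha haq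
    have h1 := (topEval h a).norm_coe_le_norm x
    have h2 := (topEval h (q s) - topEval h q₀).norm_coe_le_norm x
    rw [hcx', Complex.norm_real, Real.norm_of_nonneg hc'.le] at h1
    rw [ContinuousMap.sub_apply, hex, hex', ← Complex.ofReal_sub, Complex.norm_real,
      Real.norm_eq_abs] at h2
    rw [ContinuousMap.sub_apply, hcx, hcx', ← Complex.ofReal_sub, Complex.norm_real,
      Real.norm_eq_abs]
    exact abs_sub_le_of_inv_sq hc hc' hce hce' h1 h2 hsK
  | succ k ih =>
    refine tendstoUpTo_succ.2 ⟨fun w hw => ih w (hw.trans (Nat.zero_le _)), fun i => ?_⟩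
    rw [hder i a q₀ haq]
    have hqk := (tendstoUpTo_succ.1 (tendsto_iff_tendstoUpTo.1 hq (k + 1))).2 i
    exact (((ih.mul (ih.mul ih)).mul hqk).const_smul _).congr'
      (hf.mono fun s hs => (hder i _ _ hs.2).symm)

end TopologicalAlgebra

/-! ### Algebras of smooth maps in the Gâteaux sense -/

section GateauxAlgebra

set_option linter.unusedSectionVars false

variable {X Y E J I : Type*} [AddCommGroup X] [Module ℝ X] [TopologicalSpace X]
  [CommRing E] [Algebra ℝ E] [TopologicalSpace E] [IsTopologicalRing E] [Fintype J]

/-- A space `S` of maps that are continuous on `U` and whose semiderivatives are linear combinations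
of the continuous linear functions `δ j ξ` of the direction `ξ`, with coefficients in `S`. -/
structure IsDifferentialModule (U : Set X) (δ : J → X →L[ℝ] E) (S : Submodule E (X → E)) :
    Prop where
  eventually_mem : ∀ r ∈ U, ∀ ξ, ∀ᶠ s : ℝ in 𝓝 0, r + s • ξ ∈ U
  continuousOn : ∀ f ∈ S, ContinuousOn f U
  exists_deriv : ∀ f ∈ S, ∃ f' : J → X → E, (∀ j, f' j ∈ S) ∧
    ∀ r ∈ U, ∀ ξ, HasGateauxSemideriv f r ξ (∑ j, f' j r * δ j ξ)

theorem HasGateauxSemideriv.congr {X Y : Type*} [AddCommGroup X] [Module ℝ X]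
    [AddCommGroup Y] [Module ℝ Y] [TopologicalSpace Y] {f g : X → Y} {U : Set X} {r ξ : X} {y : Y}
    (hf : HasGateauxSemideriv f r ξ y) (hfg : EqOn g f U) (hr : r ∈ U)
    (hU : ∀ᶠ s : ℝ in 𝓝 0, r + s • ξ ∈ U) : HasGateauxSemideriv g r ξ y := by
  refine Tendsto.congr' ?_ hf
  filter_upwards [nhdsWithin_le_nhds hU] with s hs
  rw [hfg hs, hfg hr]

theorem HasGateauxSemideriv.gateauxDeriv_eq {X Y : Type*} [AddCommGroup X] [Module ℝ X]
    [AddCommGroup Y] [Module ℝ Y] [TopologicalSpace Y] [T2Space Y] {f : X → Y} {r ξ : X} {y : Y}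
    (hf : HasGateauxSemideriv f r ξ y) : gateauxDeriv f r ξ = y :=
  Tendsto.limUnder_eq hf

/-- The difference quotient splits as `(f_s - f) g_s + f (g_s - g)`. Nothing here makes `s ↦ r + s •
ξ` continuous, so the convergence of `g` along the line is a separate hypothesis. -/
theorem HasGateauxSemideriv.mul {X : Type*} [AddCommGroup X] [Module ℝ X] {f g : X → E}
    {r ξ : X} {a b : E} (hf : HasGateauxSemideriv f r ξ a) (hg : HasGateauxSemideriv g r ξ b)
    (hc : Tendsto (fun s : ℝ => g (r + s • ξ)) (𝓝[≠] 0) (𝓝 (g r))) :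
    HasGateauxSemideriv (f * g) r ξ (a * g r + f r * b) := by
  refine ((Tendsto.mul hf hc).add (tendsto_const_nhds.mul hg)).congr fun s => ?_
  simp only [Pi.mul_apply, Algebra.mul_smul_comm, Algebra.smul_mul_assoc, ← smul_add]
  congr 1
  ring

theorem HasGateauxSemideriv.add {X : Type*} [AddCommGroup X] [Module ℝ X] {f g : X → E}
    {r ξ : X} {a b : E} (hf : HasGateauxSemideriv f r ξ a) (hg : HasGateauxSemideriv g r ξ b) :
    HasGateauxSemideriv (f + g) r ξ (a + b) := by
  refine (Tendsto.add hf hg).congr fun s => ?_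
  simp only [Pi.add_apply, ← smul_add]
  congr 1
  ring

/-- The algebra generated by maps with semiderivatives in this algebra. -/
theorem isDifferentialModule_adjoin {U : Set X} {δ : J → X →L[ℝ] E} {G : Set (X → E)}
    (hU : ∀ r ∈ U, ∀ ξ, ∀ᶠ s : ℝ in 𝓝 0, r + s • ξ ∈ U)
    (hcont : ∀ f ∈ G, ContinuousOn f U)
    (hline : ∀ f ∈ G, ∀ r ∈ U, ∀ ξ,
      Tendsto (fun s : ℝ => f (r + s • ξ)) (𝓝[≠] 0) (𝓝 (f r)))
    (hder : ∀ f ∈ G, ∃ f' : J → X → E, (∀ j, f' j ∈ Algebra.adjoin E G) ∧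
      ∀ r ∈ U, ∀ ξ, HasGateauxSemideriv f r ξ (∑ j, f' j r * δ j ξ)) :
    IsDifferentialModule U δ (Subalgebra.toSubmodule (Algebra.adjoin E G)) := by
  refine ⟨hU, fun f hf => ?_, fun f hf => ?_⟩
  · refine Algebra.adjoin_induction (p := fun f _ => ContinuousOn f U) hcont (fun c => ?_)
      (fun f g _ _ hf hg => hf.add hg) (fun f g _ _ hf hg => hf.mul hg) hf
    exact continuousOn_const
  -- Continuity along lines is carried through the induction because the product rule needs it.
  · have key : ∀ f ∈ Algebra.adjoin E G, (∀ r ∈ U, ∀ ξ,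
        Tendsto (fun s : ℝ => f (r + s • ξ)) (𝓝[≠] 0) (𝓝 (f r))) ∧
        ∃ f' : J → X → E, (∀ j, f' j ∈ Algebra.adjoin E G) ∧
          ∀ r ∈ U, ∀ ξ, HasGateauxSemideriv f r ξ (∑ j, f' j r * δ j ξ) := by
      intro f hf
      induction hf using Algebra.adjoin_induction with
      | mem f hf => exact ⟨hline f hf, hder f hf⟩
      | algebraMap c =>
        refine ⟨fun r _ ξ => tendsto_const_nhds, 0, fun j => zero_mem _, fun r _ ξ => ?_⟩
        refine (tendsto_const_nhds (x := (0 : E))).congr' (.of_forall fun s => ?_) |>.trans_eq ?_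
        · simp
        · simp
      | add f g _ _ hf hg =>
        obtain ⟨hf, f', hf', hfd⟩ := hf
        obtain ⟨hg, g', hg', hgd⟩ := hg
        refine ⟨fun r hr ξ => (hf r hr ξ).add (hg r hr ξ), f' + g',
          fun j => add_mem (hf' j) (hg' j), fun r hr ξ => ?_⟩
        simpa only [Pi.add_apply, add_mul, Finset.sum_add_distrib] using
          (hfd r hr ξ).add (hgd r hr ξ)
      | mul f g hfS hgS hf hg =>
        obtain ⟨hf, f', hf', hfd⟩ := hf
        obtain ⟨hg, g', hg', hgd⟩ := hg
        refine ⟨fun r hr ξ => (hf r hr ξ).mul (hg r hr ξ), fun j => f' j * g + f * g' j,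
          fun j => add_mem (mul_mem (hf' j) hgS) (mul_mem hfS (hg' j)), fun r hr ξ => ?_⟩
        convert (hfd r hr ξ).mul (hgd r hr ξ) (hg r hr ξ) using 1
        rw [Finset.sum_mul, Finset.mul_sum, ← Finset.sum_add_distrib]
        refine Finset.sum_congr rfl fun j _ => ?_
        simp only [Pi.add_apply, Pi.mul_apply]
        ring
    exact (key f hf).2

variable [AddCommGroup Y] [Module ℝ Y] [TopologicalSpace Y] [IsTopologicalAddGroup Y] [T2Space Y]
  [Fintype I] {U : Set X} {δ : J → X →L[ℝ] E} {S : Submodule E (X → E)}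

/-- The maps `∑ i, Λ i (F i r)` on `U` with `F i ∈ S`. -/
def IsCombination (U : Set X) (S : Submodule E (X → E)) (Λ : I → E →L[ℝ] Y) (g : X → Y) : Prop :=
  ∃ F : I → X → E, (∀ i, F i ∈ S) ∧ ∀ r ∈ U, g r = ∑ i, Λ i (F i r)

theorem hasGateauxSemideriv_sum {Λ : I → E →L[ℝ] Y} {F : I → X → E} {D : I → E} {g : X → Y}
    {r ξ : X} (hU : ∀ᶠ s : ℝ in 𝓝 0, r + s • ξ ∈ U) (hr : r ∈ U)
    (hg : ∀ r ∈ U, g r = ∑ i, Λ i (F i r)) (hF : ∀ i, HasGateauxSemideriv (F i) r ξ (D i)) :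
    HasGateauxSemideriv g r ξ (∑ i, Λ i (D i)) := by
  refine HasGateauxSemideriv.congr (f := fun r => ∑ i, Λ i (F i r)) ?_ hg hr hU
  refine (tendsto_finsetSum _ fun i _ => ((Λ i).continuous.tendsto _).comp (hF i)).congr fun s => ?_
  simp only [Function.comp_apply, map_smul, map_sub, ← Finset.smul_sum, Finset.sum_sub_distrib]

/-- For a fixed direction the `δ j ξ` are elements of `E`, and `S` is a module over `E`, so the
semiderivative is again a combination with the same operators `Λ i`. Joint continuity follows from
that of the coefficients in `r`, of `δ j` in `ξ`, and of the multiplication of `E`. -/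
theorem IsCombination.isC1Gateaux (hS : IsDifferentialModule U δ S) {Λ : I → E →L[ℝ] Y}
    {g : X → Y} (hg : IsCombination U S Λ g) :
    IsC1Gateaux U g ∧ ∀ ξ, IsCombination U S Λ (fun r => gateauxDeriv g r ξ) := by
  obtain ⟨F, hF, hgF⟩ := hg
  choose F' hF' hd using fun i => hS.exists_deriv (F i) (hF i)
  have hder : ∀ r ∈ U, ∀ ξ, HasGateauxSemideriv g r ξ (∑ i, Λ i (∑ j, F' i j r * δ j ξ)) :=
    fun r hr ξ => hasGateauxSemideriv_sum (hS.eventually_mem r hr ξ) hr hgF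
      fun i => hd i r hr ξ
  refine ⟨⟨fun r hr => ?_, ?_⟩, fun ξ => ?_⟩
  · refine ⟨⟨∑ i, (Λ i).toLinearMap ∘ₗ (∑ j, LinearMap.mulLeft ℝ (F' i j r) ∘ₗ
      (δ j).toLinearMap), ?_⟩, fun ξ => ?_⟩
    · simp only [LinearMap.coe_sum, LinearMap.coe_comp, AddHom.toFun_eq_coe,
        LinearMap.coe_toAddHom]
      simp only [Finset.sum_fn, Function.comp_def, LinearMap.mulLeft_apply,
        ContinuousLinearMap.coe_coe]
      exact continuous_finsetSum _ fun i _ => (Λ i).continuous.comp <|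
        continuous_finsetSum _ fun j _ => continuous_const.mul (δ j).continuous
    · convert hder r hr ξ using 1
      simp
  · have : ContinuousOn (fun p : X × X => ∑ i, Λ i (∑ j, F' i j p.1 * δ j p.2)) (U ×ˢ univ) := by
      refine continuousOn_finsetSum _ fun i _ => (Λ i).continuous.comp_continuousOn <|
        continuousOn_finsetSum _ fun j _ => ContinuousOn.mul ?_ ?_
      · exact (hS.continuousOn _ (hF' i j)).comp continuousOn_fst fun p hp => hp.1
      · exact (δ j).continuous.comp_continuousOn continuousOn_snd
    exact this.congr fun p hp => (hder p.1 hp.1 p.2).gateauxDeriv_eq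
  · refine ⟨fun i => ∑ j, δ j ξ • F' i j, fun i => sum_mem fun j _ => S.smul_mem _ (hF' i j),
      fun r hr => ?_⟩
    refine (hder r hr ξ).gateauxDeriv_eq.trans ?_
    refine Finset.sum_congr rfl fun i _ => congrArg _ ?_
    change _ = (∑ j, δ j ξ • F' i j) r
    rw [Finset.sum_apply]
    exact Finset.sum_congr rfl fun j _ => mul_comm _ _

theorem IsCombination.isCInftyGateaux (hS : IsDifferentialModule U δ S) {Λ : I → E →L[ℝ] Y}
    {g : X → Y} (hg : IsCombination U S Λ g) : IsCInftyGateaux U g := by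
  have iter : ∀ (m : ℕ) (ξ : Fin m → X), IsCombination U S Λ (iterGateauxDeriv g m ξ) := by
    intro m
    induction m with
    | zero => exact fun ξ => hg
    | succ m ih => exact fun ξ => ((ih (Fin.init ξ)).isC1Gateaux hS).2 _
  intro m
  induction m with
  | zero =>
    obtain ⟨F, hF, hgF⟩ := hg
    refine ContinuousOn.congr (f := fun r => ∑ i, Λ i (F i r)) ?_ hgF
    exact continuousOn_finsetSum _ fun i _ =>
      (Λ i).continuous.comp_continuousOn (hS.continuousOn _ (hF i))
  | succ m ih => exact ⟨ih, fun ξ => ((iter m ξ).isC1Gateaux hS).1⟩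

end GateauxAlgebra

/-! ### Localizations and tangential derivatives -/

section Localizations

variable {d : ℕ} {Ω : Set (Eu d)} {Γ : Compacts (Eu d)}

/-- The inverse of a local parametrization extends locally to a smooth map. -/
theorem LocalParam.exists_leftInverse {S : Set (Eu d)} (p : LocalParam S) {x : S}
    (hx : x ∈ p.φ.target) : ∃ U : Set (Eu d), IsOpen U ∧ (x : Eu d) ∈ U ∧
      ∃ ψ : Eu d → Eu (d - 1), ContDiffOn ℝ ∞ ψ U ∧
        ∀ z : S, (z : Eu d) ∈ U → z ∈ p.φ.target ∧ ψ z = p.φ.symm z := by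
  set y := p.φ.symm x with hy
  have hys : y ∈ p.φ.source := p.φ.map_target hx
  set f₀ : Eu (d - 1) → Eu d := fun y => (p.φ y : Eu d) with hf₀
  obtain ⟨L₀, hL₀⟩ := LinearMap.exists_leftInverse_of_injective
    (fderiv ℝ f₀ y : Eu (d - 1) →ₗ[ℝ] Eu d) (LinearMap.ker_eq_bot.2 (p.immersive y hys))
  -- Followed by a linear left inverse `L` of its differential at `y`, the parametrization becomes a
  -- self-map of the parameter space with derivative the identity at `y`. Its local inverse `e.symm`
  -- gives `ψ = e.symm ∘ L`.
  set L : Eu d →L[ℝ] Eu (d - 1) := LinearMap.toContinuousLinearMap L₀ with hL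
  set f : Eu (d - 1) → Eu (d - 1) := fun y => L (f₀ y) with hf
  have hfs : ContDiffOn ℝ ∞ f p.φ.source := L.contDiff.comp_contDiffOn p.smooth
  have hsn : p.φ.source ∈ 𝓝 y := p.φ.open_source.mem_nhds hys
  have hfy : ContDiffAt ℝ ∞ f y := hfs.contDiffAt hsn
  have hfd : HasFDerivAt f
      ((ContinuousLinearEquiv.refl ℝ (Eu (d - 1)) : Eu (d - 1) ≃L[ℝ] Eu (d - 1)) :
        Eu (d - 1) →L[ℝ] Eu (d - 1)) y := by
    have h0 : HasFDerivAt f₀ (fderiv ℝ f₀ y) y :=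
      ((p.smooth.contDiffAt hsn).differentiableAt (by simp)).hasFDerivAt
    have h1 : L ∘L fderiv ℝ f₀ y = ((ContinuousLinearEquiv.refl ℝ (Eu (d - 1)) :
        Eu (d - 1) ≃L[ℝ] Eu (d - 1)) : Eu (d - 1) →L[ℝ] Eu (d - 1)) :=
      ContinuousLinearMap.ext fun v => LinearMap.congr_fun hL₀ v
    rw [← h1]
    exact L.hasFDerivAt.comp y h0
  set e := hfy.toOpenPartialHomeomorph f hfd (by simp) with he
  have hef : ∀ z, e z = f z := fun z => by rw [he, hfy.toOpenPartialHomeomorph_coe]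
  have hye : y ∈ e.source := hfy.mem_toOpenPartialHomeomorph_source hfd (by simp)
  -- Smoothness of `e.symm` is read off at points where the derivative of `f` is invertible, an open
  -- condition recorded by `W`.
  set W : Set (Eu (d - 1)) := p.φ.source ∩ fderiv ℝ f ⁻¹'
    range ((↑) : (Eu (d - 1) ≃L[ℝ] Eu (d - 1)) → Eu (d - 1) →L[ℝ] Eu (d - 1)) with hW
  have hWo : IsOpen W := (hfs.continuousOn_fderiv_of_isOpen p.φ.open_source (by simp)
    ).isOpen_inter_preimage p.φ.open_source ContinuousLinearEquiv.isOpen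
  have hyW : y ∈ W := ⟨hys, ⟨_, hfd.fderiv.symm⟩⟩
  set V : Set (Eu (d - 1)) := e.target ∩ e.symm ⁻¹' W with hV
  have hVo : IsOpen V := e.symm.isOpen_inter_preimage hWo
  have hO : IsOpen (p.φ.target ∩ p.φ.symm ⁻¹' e.source) :=
    p.φ.symm.isOpen_inter_preimage e.open_source
  -- The chart image is open only in `S`; `O` is an ambient open set that cuts out of `S` the points
  -- whose parameter lies in `e.source`.
  obtain ⟨O, hOo, hOe⟩ := isOpen_induced_iff.1 hO
  have hmem : ∀ z : S, (z : Eu d) ∈ O ↔ z ∈ p.φ.target ∧ p.φ.symm z ∈ e.source := fun z =>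
    (Set.ext_iff.1 hOe z)
  have hψ : ∀ z : S, z ∈ p.φ.target → p.φ.symm z ∈ e.source → e.symm (L z) = p.φ.symm z := by
    intro z hz hze
    have : L (z : Eu d) = e (p.φ.symm z) := by
      rw [hef, hf, hf₀]
      simp only [p.φ.right_inv hz]
    rw [this, e.left_inv hze]
  refine ⟨L ⁻¹' V ∩ O, (hVo.preimage L.continuous).inter hOo, ⟨?_, ?_⟩, fun z => e.symm (L z),
    ?_, fun z hz => ?_⟩
  · have : L (x : Eu d) = e y := by
      rw [hef, hf, hf₀, hy]
      simp only [p.φ.right_inv hx]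
    refine ⟨?_, ?_⟩
    · rw [this]
      exact e.map_source hye
    · rw [mem_preimage, hψ x hx hye]
      exact hyW
  · exact (hmem x).2 ⟨hx, hye⟩
  · intro z hz
    obtain ⟨hzt, hzW, g, hg⟩ := hz.1
    refine (ContDiffAt.comp z ?_ L.contDiff.contDiffAt).contDiffWithinAt
    have hfz : ContDiffAt ℝ ∞ f (e.symm (L z)) := hfs.contDiffAt (p.φ.open_source.mem_nhds hzW)
    have hec : (e : Eu (d - 1) → Eu (d - 1)) = f := funext hef
    refine e.contDiffAt_symm hzt (f₀' := g) ?_ ?_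
    · rw [hg, hec]
      exact (hfz.differentiableAt (by simp)).hasFDerivAt
    · rw [hec]
      exact hfz
  · have := (hmem z).1 hz.2
    exact ⟨this.1, hψ z this.1 this.2⟩

theorem IsLocallySmoothAt.mul {S : Set (Eu d)} {f g : S → ℂ} {x : S}
    (hf : IsLocallySmoothAt S f x) (hg : IsLocallySmoothAt S g x) :
    IsLocallySmoothAt S (fun y => f y * g y) x := by
  obtain ⟨U, hU, f', hf', hff⟩ := hf
  obtain ⟨V, hV, g', hg', hgg⟩ := hg
  exact ⟨U ∩ V, inter_mem hU hV, fun y => f' y * g' y,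
    (hf'.mono inter_subset_left).mul (hg'.mono inter_subset_right),
    fun y hy => congrArg₂ _ (hff y hy.1) (hgg y hy.2)⟩

/-- Multiplication by a cutoff function makes locally defined smooth functions smooth. -/
theorem exists_smoothFun_mul {T : Set ↥(Γ : Set (Eu d))} (χ : SmoothFun Γ)
    (hχ : tsupport χ.1 ⊆ T) {c : ↥(Γ : Set (Eu d)) → ℂ}
    (hc : ∀ x ∈ T, IsLocallySmoothAt (Γ : Set (Eu d)) c x) :
    ∃ b : SmoothFun Γ, tsupport b.1 ⊆ T ∧ ∀ x, b.1 x = χ.1 x * c x := by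
  refine ⟨⟨fun x => χ.1 x * c x, isSmoothOn_of_forall_isLocallySmoothAt Γ.isCompact.isClosed
    fun x => ?_⟩, (tsupport_mul_subset_left (f := χ.1) (g := c)).trans hχ, fun x => rfl⟩
  by_cases hx : x ∈ T
  · exact (χ.2.isLocallySmoothAt x).mul (hc x hx)
  · obtain ⟨O, hO, hOe⟩ := isOpen_induced_iff.1 (isClosed_tsupport χ.1).isOpen_compl
    have hmem : ∀ z : ↥(Γ : Set (Eu d)), (z : Eu d) ∈ O ↔ z ∉ tsupport χ.1 := fun z =>
      Set.ext_iff.1 hOe z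
    refine ⟨O, hO.mem_nhds ((hmem x).2 fun h => hx (hχ h)), 0, contDiffOn_const, fun y hy => ?_⟩
    simp [image_eq_zero_of_notMem_tsupport ((hmem y).1 hy)]

/-- Smooth functions of the parameters are locally smooth on the hypersurface. -/
theorem LocalParam.isLocallySmoothAt {S : Set (Eu d)} (p : LocalParam S) {F : Type*}
    [NormedAddCommGroup F] [NormedSpace ℝ F] {c : Eu (d - 1) → F}
    (hc : ContDiffOn ℝ ∞ c p.φ.source) {x : S} (hx : x ∈ p.φ.target) :
    IsLocallySmoothAt S (fun z => c (p.φ.symm z)) x := by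
  obtain ⟨U, hU, hxU, ψ, hψ, hψφ⟩ := p.exists_leftInverse hx
  refine ⟨U ∩ ψ ⁻¹' p.φ.source, ?_, fun z => c (ψ z), ?_, fun z hz => ?_⟩
  · refine (hψ.continuousOn.isOpen_inter_preimage hU p.φ.open_source).mem_nhds ⟨hxU, ?_⟩
    rw [mem_preimage, (hψφ x hxU).2]
    exact p.φ.map_target hx
  · exact hc.comp (hψ.mono inter_subset_left) fun z hz => hz.2
  · simp only [(hψφ z hz.1).2]

/-- The localization with another cutoff function. -/
def Localization.withCutoff (i : Localization Γ) (b : SmoothFun Γ)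
    (hb : tsupport b.1 ⊆ i.φ.target) : Localization Γ :=
  { i with
    χ := b
    support_subset := hb }

theorem localize_of_mem (i : Localization Γ) (u : SmoothFun Γ) {y : Eu (d - 1)}
    (hy : y ∈ i.φ.source) : localize i u y = i.χ.1 (i.φ y) * u.1 (i.φ y) :=
  indicator_of_mem hy fun y => i.χ.1 (i.φ y) * u.1 (i.φ y)

theorem localize_of_notMem (i : Localization Γ) (u : SmoothFun Γ) {y : Eu (d - 1)}
    (hy : y ∉ i.φ.source) : localize i u y = 0 :=
  indicator_of_notMem hy fun y => i.χ.1 (i.φ y) * u.1 (i.φ y)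

theorem localize_withCutoff_of_mem (i : Localization Γ) {b : SmoothFun Γ}
    (hb : tsupport b.1 ⊆ i.φ.target) (u : SmoothFun Γ) {y : Eu (d - 1)} (hy : y ∈ i.φ.source) :
    localize (i.withCutoff b hb) u y = b.1 (i.φ y) * u.1 (i.φ y) :=
  localize_of_mem (i.withCutoff b hb) u hy

theorem localize_withCutoff_of_notMem (i : Localization Γ) {b : SmoothFun Γ}
    (hb : tsupport b.1 ⊆ i.φ.target) (u : SmoothFun Γ) {y : Eu (d - 1)} (hy : y ∉ i.φ.source) :
    localize (i.withCutoff b hb) u y = 0 :=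
  localize_of_notMem (i.withCutoff b hb) u hy

theorem localize_eventuallyEq_zero (i : Localization Γ) (u : SmoothFun Γ) {y : Eu (d - 1)}
    (hy : y ∉ i.φ.source) : ∀ᶠ z in 𝓝 y, localize i u z = 0 := by
  have hK : IsCompact (i.φ.symm '' tsupport (i.χ : ↥(Γ : Set (Eu d)) → ℂ)) :=
    (isClosed_tsupport _).isCompact.image_of_continuousOn
      (i.φ.continuousOn_symm.mono i.support_subset)
  have hyK : y ∈ (i.φ.symm '' tsupport (i.χ : ↥(Γ : Set (Eu d)) → ℂ))ᶜ := by
    rintro ⟨x, hx, rfl⟩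
    exact hy (i.φ.map_target (i.support_subset hx))
  filter_upwards [hK.isClosed.isOpen_compl.mem_nhds hyK] with z hz
  by_cases hzs : z ∈ i.φ.source
  · rw [localize_of_mem i u hzs, image_eq_zero_of_notMem_tsupport (f := i.χ.1), zero_mul]
    exact fun h => hz ⟨_, h, i.φ.left_inv hzs⟩
  · exact localize_of_notMem i u hzs

variable (h : IsSmoothBoundary Ω Γ)

/-- The velocity of the parametrization in the direction of the `j`-th coordinate. -/
abbrev paramVelocity (i : Localization Γ) (j : Fin (d - 1)) (y : Eu (d - 1)) : Eu d :=
  fderiv ℝ (fun z => (i.φ z : Eu d)) y (EuclideanSpace.single j 1)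

-- Chain rule for an extension of `χ u` composed with the parametrization; its velocities are
-- tangent to `Γ`, so only tangential derivatives enter.
open LineDeriv in
theorem lineDeriv_localize_of_mem (i : Localization Γ) (j : Fin (d - 1)) (u : SmoothFun Γ)
    {y : Eu (d - 1)} (hy : y ∈ i.φ.source) :
    (∂_{(EuclideanSpace.single j 1 : Eu (d - 1))} (localize i u)) y =
      ∑ l, ((paramVelocity i j y l : ℝ) : ℂ) *
        (tangentialDeriv h l (i.χ * u)).1 (i.φ y) := by
  have hsn : i.φ.source ∈ 𝓝 y := i.φ.open_source.mem_nhds hy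
  have hd : DifferentiableAt ℝ (fun z => (i.φ z : Eu d)) y :=
    (i.smooth.contDiffAt hsn).differentiableAt (by simp)
  have hg := smoothExt_contDiff (S := (Γ : Set (Eu d))) (i.χ * u).1
  have he : (fun z => localize i u z) =ᶠ[𝓝 y]
      smoothExt (Γ : Set (Eu d)) (i.χ * u).1 ∘ fun z => (i.φ z : Eu d) := by
    filter_upwards [hsn] with z hz
    rw [localize_of_mem i u hz, Function.comp_apply, smoothExt_apply (i.χ * u).2]
    rfl
  rw [SchwartzMap.lineDerivOp_apply_eq_fderiv, Filter.EventuallyEq.fderiv_eq he,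
    fderiv_comp y (hg.differentiable (by simp) _) hd, ContinuousLinearMap.comp_apply]
  refine fderiv_eq_sum_tangentialDeriv h (i.χ * u) (i.φ y)
    (hg.of_le (by exact_mod_cast le_top)).contDiffAt
    (.of_forall fun z hz => smoothExt_apply (i.χ * u).2 ⟨z, hz⟩) ?_
  exact h.inner_fderiv_eq_zero hd (.of_forall fun z => (i.φ z).2) _

theorem tsupport_tangentialDeriv_subset (l : Fin d) (u : SmoothFun Γ) :
    tsupport (tangentialDeriv h l u).1 ⊆ tsupport u.1 := by
  refine closure_minimal (fun x hx => ?_) (isClosed_tsupport _)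
  by_contra hxu
  refine hx ?_
  obtain ⟨O, hO, hOe⟩ := isOpen_induced_iff.1 (isClosed_tsupport u.1).isOpen_compl
  have hmem : ∀ z : ↥(Γ : Set (Eu d)), (z : Eu d) ∈ O ↔ z ∉ tsupport u.1 := fun z =>
    Set.ext_iff.1 hOe z
  rw [tangentialDeriv_eq_fderiv h l u x (g := fun _ => 0) contDiffAt_const]
  · simp
  · filter_upwards [hO.mem_nhds ((hmem x).2 hxu)] with y hy hyΓ
    exact (image_eq_zero_of_notMem_tsupport ((hmem ⟨y, hyΓ⟩).1 hy)).symm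

open LineDeriv in
/-- Coordinate derivatives of the local representatives, in terms of the local representatives of
the tangential derivatives. -/
theorem exists_lineDeriv_localize_eq (i : Localization Γ) (j : Fin (d - 1)) :
    ∃ (A : Fin d → SmoothFun Γ) (hA : ∀ l, tsupport (A l).1 ⊆ i.φ.target) (B : SmoothFun Γ)
      (hB : tsupport B.1 ⊆ i.φ.target),
      (∀ l, ∀ y ∈ i.φ.source, (A l).1 (i.φ y) = i.χ.1 (i.φ y) * (paramVelocity i j y l : ℝ)) ∧
      ∀ u, ∂_{(EuclideanSpace.single j 1 : Eu (d - 1))} (localize i u) =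
        ∑ l, localize (i.withCutoff (A l) (hA l)) (tangentialDeriv h l u) +
          localize (i.withCutoff B hB) u := by
  have hv : ∀ l, ContDiffOn ℝ ∞ (fun y => ((paramVelocity i j y l : ℝ) : ℂ)) i.φ.source := by
    intro l
    have h1 : ContDiffOn ℝ ∞ (fun y => paramVelocity i j y) i.φ.source :=
      (i.smooth.fderiv_of_isOpen i.φ.open_source (by simp)).clm_apply contDiffOn_const
    exact Complex.ofRealCLM.contDiff.comp_contDiffOn
      ((EuclideanSpace.proj (𝕜 := ℝ) l).contDiff.comp_contDiffOn h1)
  have hs := fun l (x) (hx : x ∈ i.φ.target) => i.toLocalParam.isLocallySmoothAt (hv l) hx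
  -- By the Leibniz rule for `χ u`, the velocity times `χ` is the coefficient of `∂_l u`, and the
  -- velocity times `∂_l χ` contributes to the zeroth order coefficient.
  choose A hA hAe using fun l => exists_smoothFun_mul i.χ i.support_subset (hs l)
  choose B hB hBe using fun l => exists_smoothFun_mul (tangentialDeriv h l i.χ)
    ((tsupport_tangentialDeriv_subset h l i.χ).trans i.support_subset) (hs l)
  have hsum : tsupport (∑ l, B l).1 ⊆ i.φ.target := by
    refine (closure_minimal (fun x hx => ?_) (isClosed_iUnion_of_finite fun l =>
      isClosed_tsupport (B l).1)).trans (iUnion_subset hB)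
    have e : (∑ l, B l).1 x = ∑ l, (B l).1 x := by
      simp
    rw [Function.mem_support, e] at hx
    obtain ⟨l, -, hl⟩ := Finset.exists_ne_zero_of_sum_ne_zero hx
    exact mem_iUnion.2 ⟨l, subset_tsupport _ hl⟩
  refine ⟨A, hA, ∑ l, B l, hsum, fun l y hy => ?_, fun u => ?_⟩
  · rw [hAe, i.φ.left_inv hy]
  · ext y
    rw [_root_.add_apply, _root_.sum_apply]
    by_cases hy : y ∈ i.φ.source
    · rw [lineDeriv_localize_of_mem h i j u hy, localize_withCutoff_of_mem i _ _ hy]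
      have e : (∑ l, B l).1 (i.φ y) = ∑ l, (B l).1 (i.φ y) := by
        simp
      rw [e, Finset.sum_mul, ← Finset.sum_add_distrib]
      refine Finset.sum_congr rfl fun l _ => ?_
      rw [localize_withCutoff_of_mem i _ _ hy, hAe, hBe, i.φ.left_inv hy, Derivation.leibniz]
      change _ * (i.χ.1 _ * (tangentialDeriv h l u).1 _ + u.1 _ * (tangentialDeriv h l i.χ).1 _) = _
      ring
    · rw [localize_withCutoff_of_notMem i _ _ hy, SchwartzMap.lineDerivOp_apply_eq_fderiv,
        Filter.EventuallyEq.fderiv_eq (f := fun _ => (0 : ℂ)) (localize_eventuallyEq_zero i u hy)]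
      simp [localize_withCutoff_of_notMem i _ _ hy]

end Localizations

/-! ### Completions of topological vector spaces -/

section Completion

open UniformSpace

variable {P : Type*} [AddCommGroup P] [UniformSpace P]

theorem exists_closed_nhds_preimage_completion {V : Set (Completion P)} (hV : V ∈ 𝓝 0) :
    ∃ V' ⊆ V, IsClosed V' ∧ ((↑) : P → Completion P) ⁻¹' V' ∈ 𝓝 0 := by
  obtain ⟨V', hV', hc, hVV'⟩ := exists_mem_nhds_isClosed_subset hV
  refine ⟨V', hVV', hc, ?_⟩
  refine (Completion.continuous_coe P).continuousAt.preimage_mem_nhds ?_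
  rwa [Completion.coe_zero]

theorem closure_coe_image_mem_nhds {W : Set P} (hW : W ∈ 𝓝 (0 : P)) :
    closure (((↑) : P → Completion P) '' W) ∈ 𝓝 (0 : Completion P) := by
  rw [← Completion.coe_zero]
  exact (Completion.isDenseInducing_coe (α := P)).closure_image_mem_nhds hW

variable [Module ℂ P] [IsUniformAddGroup P] [UniformContinuousConstSMul ℂ P]

/-- Closed neighbourhoods of zero are tested on the dense subspace `P`, where scalar multiplication
is jointly continuous. For the continuity of `a ↦ a • x` at zero, `x` is written as `(x - u) + u`
with `u` in `P` close to `x`. -/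
instance [ContinuousSMul ℂ P] : ContinuousSMul ℂ (Completion P) := by
  have small : ∀ V ∈ 𝓝 (0 : Completion P), ∃ A ∈ 𝓝 (0 : ℂ), ∃ W ∈ 𝓝 (0 : Completion P),
      ∀ a ∈ A, ∀ x ∈ W, a • x ∈ V := by
    intro V hV
    obtain ⟨V', hVV', hc, hV'⟩ := exists_closed_nhds_preimage_completion hV
    have h0 : Tendsto (fun p : ℂ × P => p.1 • p.2) (𝓝 0 ×ˢ 𝓝 0) (𝓝 0) := by
      rw [← nhds_prod_eq]
      simpa using (continuous_smul (M := ℂ) (X := P)).tendsto (0, 0)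
    obtain ⟨A, hA, W, hW, hAW⟩ := mem_prod_iff.1 (h0 hV')
    refine ⟨A, hA, _, closure_coe_image_mem_nhds hW, fun a ha x hx => hVV' ?_⟩
    have hm : MapsTo (fun x : Completion P => a • x) (((↑) : P → Completion P) '' W) V' := by
      rintro _ ⟨u, hu, rfl⟩
      change a • (u : Completion P) ∈ V'
      rw [← Completion.coe_smul]
      exact hAW (mk_mem_prod ha hu)
    have := hm.closure (continuous_const_smul a) hx
    rwa [hc.closure_eq] at this
  refine ContinuousSMul.of_nhds_zero ?_ (fun x => ?_) fun a => ?_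
  · intro V hV
    obtain ⟨A, hA, W, hW, hAW⟩ := small V hV
    exact mem_prod_iff.2 ⟨A, hA, W, hW, fun p hp => hAW _ hp.1 _ hp.2⟩
  · intro V hV
    obtain ⟨V₁, hV₁, hVV⟩ := exists_nhds_zero_half hV
    obtain ⟨A, hA, W, hW, hAW⟩ := small V₁ hV₁
    have hne : ∃ u : P, x - (u : Completion P) ∈ W := by
      have : ∀ᶠ y in 𝓝 x, x - y ∈ W := by
        have : Tendsto (fun y => x - y) (𝓝 x) (𝓝 (x - x)) := tendsto_const_nhds.sub tendsto_id
        rw [sub_self] at this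
        exact this hW
      obtain ⟨_, ⟨u, rfl⟩, hy⟩ := (Completion.denseRange_coe (α := P)).inter_nhds_nonempty this
      exact ⟨u, hy⟩
    obtain ⟨u, hu⟩ := hne
    have h1 : Tendsto (fun a : ℂ => a • (u : Completion P)) (𝓝 0) (𝓝 0) := by
      have : Continuous fun a : ℂ => ((a • u : P) : Completion P) :=
        (Completion.continuous_coe P).comp (continuous_id.smul continuous_const)
      simpa [Completion.coe_smul, Completion.coe_zero] using this.tendsto 0
    change ∀ᶠ a in 𝓝 (0 : ℂ), a • x ∈ V
    filter_upwards [hA, h1.eventually_mem hV₁] with a ha hau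
    have e : a • x = a • (x - u) + a • (u : Completion P) := by
      rw [← smul_add, sub_add_cancel]
    rw [e]
    exact hVV _ (hAW a ha _ hu) _ hau
  · simpa using (continuous_const_smul a).tendsto (0 : Completion P)

/-- A continuity criterion for families of operators on a completion in the topology of bounded
convergence. -/
theorem continuous_completion_of_bounds {E : Type*} [AddCommGroup E] [TopologicalSpace E]
    [IsTopologicalAddGroup E] (A : E → P →L[ℂ] P) (B : E →+ (Completion P →L[ℂ] Completion P))
    (hB : ∀ a, B a = (A a).completion)
    (H : ∀ V ∈ 𝓝 (0 : P), ∃ W ∈ 𝓝 (0 : P), ∀ c : ℂ, ∀ᶠ a in 𝓝 (0 : E), ∀ u ∈ W,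
      A a (c • u) ∈ V) : Continuous B := by
  refine continuous_of_continuousAt_zero B ?_
  rw [ContinuousAt, map_zero, ContinuousLinearMap.hasBasis_nhds_zero.tendsto_right_iff]
  rintro ⟨S, V⟩ ⟨hS, hV⟩
  obtain ⟨V', hVV', hc, hV'⟩ := exists_closed_nhds_preimage_completion hV
  obtain ⟨W, hW, hWV⟩ := H _ hV'
  -- The bounded set `S` is absorbed by the closure of `W`. A single scalar `c` thus reduces
  -- uniformity on `S` to an estimate on `W`, which passes to the closure.
  obtain ⟨c, hcS⟩ := (hS (closure_coe_image_mem_nhds hW)).exists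
  filter_upwards [hWV c] with a ha x hx
  obtain ⟨w, hw, rfl⟩ := hcS hx
  refine hVV' ?_
  have hm : MapsTo (fun x : Completion P => (A a).completion (c • x))
      (((↑) : P → Completion P) '' W) V' := by
    rintro _ ⟨u, hu, rfl⟩
    change (A a).completion (c • (u : Completion P)) ∈ V'
    rw [← Completion.coe_smul, ContinuousLinearMap.completion_apply_coe]
    exact ha u hu
  have := hm.closure ((A a).completion.continuous.comp (continuous_const_smul c)) hw
  rw [hc.closure_eq] at this
  rw [hB]
  exact this

end Completion

/-! ### Operators on the Sobolev spaces of a hypersurface -/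

section SobolevOperators

variable {d : ℕ} {Ω : Set (Eu d)} {Γ : Compacts (Eu d)}

/-- Tangent vectors are velocities of the parametrization, with locally smooth coefficients. -/
theorem exists_tangent_coefficients (h : IsSmoothBoundary Ω Γ) (i : Localization Γ) (k : Fin d) :
    ∃ β : ↥(Γ : Set (Eu d)) → Eu (d - 1), ∀ x ∈ i.φ.target,
      IsLocallySmoothAt (Γ : Set (Eu d)) β x ∧
        fderiv ℝ (fun y => (i.φ y : Eu d)) (i.φ.symm x) (β x) = tangentBasis Ω x k := by
  obtain ⟨ν, hν, hνe⟩ := h.isSmoothOn_outerUnitNormal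
  have key : ∀ x ∈ i.φ.target, ∃ U ∈ 𝓝 (x : Eu d), ∃ g : Eu d → Eu (d - 1),
      ContDiffOn ℝ ∞ g U ∧ ∀ z : ↥(Γ : Set (Eu d)), (z : Eu d) ∈ U → z ∈ i.φ.target ∧
        fderiv ℝ (fun y => (i.φ y : Eu d)) (i.φ.symm z) (g z) = tangentBasis Ω z k := by
    intro x hx
    obtain ⟨U, hU, hxU, ψ, hψ, hψφ⟩ := i.toLocalParam.exists_leftInverse hx
    refine ⟨U, hU.mem_nhds hxU, fun z => fderiv ℝ ψ z (EuclideanSpace.single k 1 -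
      inner ℝ (ν z) (EuclideanSpace.single k 1) • ν z), ?_, fun z hz => ?_⟩
    · refine (hψ.fderiv_of_isOpen hU (by simp)).clm_apply (ContDiff.contDiffOn ?_)
      exact contDiff_const.sub ((hν.inner ℝ contDiff_const).smul hν)
    · obtain ⟨hzt, hzψ⟩ := hψφ z hz
      refine ⟨hzt, ?_⟩
      have hzs : i.φ.symm z ∈ i.φ.source := i.φ.map_target hzt
      have hφ : ContDiffAt ℝ ∞ (fun y => (i.φ y : Eu d)) (ψ z) :=
        i.smooth.contDiffAt (i.φ.open_source.mem_nhds (by rw [hzψ]; exact hzs))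
      have hψz : ContDiffAt ℝ ∞ ψ z := hψ.contDiffAt (hU.mem_nhds hz)
      -- `φ ∘ ψ` is the identity on `Γ`, so its differential fixes tangent vectors; the coefficients
      -- are the image of the tangent vector under the differential of `ψ`.
      have h0 := h.fderiv_eq_zero z.2
        (f := fun w => ((i.φ (ψ w) : ↥(Γ : Set (Eu d))) : Eu d) - w)
        (((hφ.comp (z : Eu d) hψz).sub contDiffAt_id).of_le (by exact_mod_cast le_top)) ?_
        (h.inner_tangentProj z.2 (EuclideanSpace.single k 1))
      · have h1 : HasFDerivAt (fun w => ((i.φ (ψ w) : ↥(Γ : Set (Eu d))) : Eu d) - w)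
            ((fderiv ℝ (fun y => (i.φ y : Eu d)) (ψ z)) ∘L (fderiv ℝ ψ z) -
              ContinuousLinearMap.id ℝ (Eu d)) z :=
          ((hφ.differentiableAt (by simp)).hasFDerivAt.comp (z : Eu d)
            (hψz.differentiableAt (by simp)).hasFDerivAt).sub (hasFDerivAt_id _)
        rw [h1.fderiv, hzψ] at h0
        simpa [sub_eq_zero, hνe, tangentProj] using h0
      · filter_upwards [hU.mem_nhds hz] with w hw hwΓ
        obtain ⟨hwt, hwψ⟩ := hψφ ⟨w, hwΓ⟩ hw
        change ((i.φ (ψ (⟨w, hwΓ⟩ : ↥(Γ : Set (Eu d)))) : ↥(Γ : Set (Eu d))) : Eu d) - w = 0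
        rw [hwψ, i.φ.right_inv hwt, sub_self]
  have hex : ∀ x : ↥(Γ : Set (Eu d)), ∃ β : Eu (d - 1), x ∈ i.φ.target →
      fderiv ℝ (fun y => (i.φ y : Eu d)) (i.φ.symm x) β = tangentBasis Ω x k := by
    intro x
    by_cases hx : x ∈ i.φ.target
    · obtain ⟨U, hU, g, hg, hgU⟩ := key x hx
      exact ⟨g x, fun _ => (hgU x (mem_of_mem_nhds hU)).2⟩
    · exact ⟨0, fun h => absurd h hx⟩
  choose β hβ using hex
  refine ⟨β, fun x hx => ⟨?_, hβ x hx⟩⟩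
  obtain ⟨U, hU, g, hg, hgU⟩ := key x hx
  refine ⟨U, hU, g, hg, fun z hz => ?_⟩
  obtain ⟨hzt, hzg⟩ := hgU z hz
  -- The chosen `β` and the smooth local `g` have the same image under an injective differential, so
  -- `β` inherits smoothness from `g`.
  exact i.immersive _ (i.φ.map_target hzt) (hzg.trans (hβ z hzt).symm)

open LineDeriv in
/-- Local representatives of tangential derivatives. -/
theorem exists_localize_tangentialDeriv_eq (h : IsSmoothBoundary Ω Γ) (i : Localization Γ)
    (k : Fin d) : ∃ a b : Fin (d - 1) → Localization Γ, ∀ u,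
      localize i (tangentialDeriv h k u) =
        ∑ j, (∂_{(EuclideanSpace.single j 1 : Eu (d - 1))} (localize (a j) u) -
          localize (b j) u) := by
  obtain ⟨β, hβ⟩ := exists_tangent_coefficients h i k
  have hβs : ∀ (j : Fin (d - 1)), ∀ x ∈ i.φ.target,
      IsLocallySmoothAt (Γ : Set (Eu d)) (fun x => ((β x j : ℝ) : ℂ)) x := by
    intro j x hx
    obtain ⟨U, hU, g, hg, hgβ⟩ := (hβ x hx).1
    refine ⟨U, hU, fun z => ((g z j : ℝ) : ℂ), ?_, fun z hz => by simp only [hgβ z hz]⟩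
    exact Complex.ofRealCLM.contDiff.comp_contDiffOn
      ((EuclideanSpace.proj (𝕜 := ℝ) j).contDiff.comp_contDiffOn hg)
  -- In the chart `∂_k = ∑ j, β_j ∂_{y_j}`. The factor `β_j` is absorbed into the cutoff `c j = χ
  -- β_j`, and the term in which the cutoff is differentiated, with cutoff `B j`, is subtracted.
  choose c hc hce using fun j => exists_smoothFun_mul i.χ i.support_subset (hβs j)
  choose A hA B hB hAe hAB using fun j =>
    exists_lineDeriv_localize_eq h (i.withCutoff (c j) (hc j)) j
  refine ⟨fun j => i.withCutoff (c j) (hc j),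
    fun j => (i.withCutoff (c j) (hc j)).withCutoff (B j) (hB j), fun u => ?_⟩
  simp only [hAB, add_sub_cancel_right]
  ext y
  simp only [_root_.sum_apply]
  by_cases hy : y ∈ i.φ.source
  · rw [localize_of_mem i _ hy, Finset.sum_comm]
    have hT := (hβ (i.φ y) (i.φ.map_source hy)).2
    rw [i.φ.left_inv hy] at hT
    have hk : (tangentialDeriv h k u).1 (i.φ y) =
        ∑ l, ((tangentBasis Ω (i.φ y) k l : ℝ) : ℂ) * (tangentialDeriv h l u).1 (i.φ y) := by
      rw [tangentialDeriv_apply]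
      exact fderiv_eq_sum_tangentialDeriv h u (i.φ y)
        ((smoothExt_contDiff u.1).of_le (by exact_mod_cast le_top)).contDiffAt
        (.of_forall fun z hz => smoothExt_apply u.2 ⟨z, hz⟩) (h.inner_tangentProj (i.φ y).2 _)
    rw [hk, Finset.mul_sum]
    refine Finset.sum_congr rfl fun l _ => ?_
    have e1 : ∀ j, localize ((i.withCutoff (c j) (hc j)).withCutoff (A j l) (hA j l))
        (tangentialDeriv h l u) y = i.χ.1 (i.φ y) * ((β (i.φ y) j : ℝ) : ℂ) *
          ((paramVelocity i j y l : ℝ) : ℂ) * (tangentialDeriv h l u).1 (i.φ y) := by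
      intro j
      rw [localize_withCutoff_of_mem (i.withCutoff (c j) (hc j)) (hA j l) _ hy, hAe j l y hy]
      exact congrArg (fun z => z * ((paramVelocity i j y l : ℝ) : ℂ) *
        (tangentialDeriv h l u).1 (i.φ y)) (hce j (i.φ y))
    simp only [e1]
    have e2 : β (i.φ y) = ∑ j, β (i.φ y) j • EuclideanSpace.single j (1 : ℝ) := by
      simpa using ((EuclideanSpace.basisFun (Fin (d - 1)) ℝ).sum_repr (β (i.φ y))).symm
    have e3 : (tangentBasis Ω (i.φ y) k l : ℝ) = ∑ j, β (i.φ y) j * paramVelocity i j y l := by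
      rw [← hT]
      conv_lhs => rw [e2]
      simp [paramVelocity]
    rw [e3]
    push_cast
    rw [Finset.sum_mul, Finset.mul_sum]
    exact Finset.sum_congr rfl fun j _ => by ring
  · rw [localize_of_notMem i _ hy]
    refine (Finset.sum_eq_zero fun j _ => Finset.sum_eq_zero fun l _ => ?_).symm
    exact localize_withCutoff_of_notMem (i.withCutoff (c j) (hc j)) (hA j l) _ hy

/-- The tangential derivative on `C^∞(Γ, ℂ)`, from `H^(t+1)(Γ)` to `H^t(Γ)`. -/
def preTangentialDeriv (h : IsSmoothBoundary Ω Γ) (t : ℝ) (k : Fin d) :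
    PreSobolev Γ (t + 1) →L[ℂ] PreSobolev Γ t where
  toLinearMap := ((tangentialDeriv h k).toLinearMap : SmoothFun Γ →ₗ[ℂ] SmoothFun Γ)
  cont := by
    classical
    refine (withSeminorms_preSobolev Γ (t + 1)).continuous_of_isBounded
      (withSeminorms_preSobolev Γ t) _ fun i => ?_
    obtain ⟨a, b, hab⟩ := exists_localize_tangentialDeriv_eq h i k
    set s : Finset (Localization Γ) := Finset.univ.image a ∪ Finset.univ.image b
    -- For each coordinate, `2π` comes from the derivative and `1` from the zeroth order correction.
    refine ⟨s, ⟨∑ _j : Fin (d - 1), (2 * Real.pi + 1), by positivity⟩, fun u => ?_⟩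
    refine (congrArg (sobolevNorm (d - 1) t) (hab u)).le.trans ?_
    change _ ≤ (∑ _j : Fin (d - 1), (2 * Real.pi + 1)) * (s.sup (sobolevSeminorm Γ (t + 1))) u
    rw [Finset.sum_mul]
    refine (Finset.le_sum_of_subadditive (sobolevNorm (d - 1) t) (map_zero _).le
      (map_add_le_add _) _ _).trans (Finset.sum_le_sum fun j _ => ?_)
    refine (map_sub_le_add _ _ _).trans ?_
    rw [add_mul, one_mul]
    refine add_le_add ?_ ?_
    · refine (sobolevNorm_lineDeriv_le t _ _).trans ?_
      have h1 : sobolevNorm (d - 1) (t + 1) (localize (a j) u) ≤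
          (s.sup (sobolevSeminorm Γ (t + 1))) u :=
        Seminorm.le_finset_sup_apply (p := sobolevSeminorm Γ (t + 1)) (x := u)
          (Finset.mem_union_left _ (Finset.mem_image_of_mem a (Finset.mem_univ j)))
      have h2 : ‖(EuclideanSpace.single j 1 : Eu (d - 1))‖ = 1 := by simp
      rw [h2, mul_one]
      gcongr
    · refine (sobolevNorm_le_succ t _).trans ?_
      exact Seminorm.le_finset_sup_apply (p := sobolevSeminorm Γ (t + 1)) (x := u)
          (Finset.mem_union_right _ (Finset.mem_image_of_mem b (Finset.mem_univ j)))

/-- The `k`-th component of the tangential gradient, from `H^(t+1)(Γ)` to `H^t(Γ)`. -/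
def sobolevTangentialDeriv (h : IsSmoothBoundary Ω Γ) (t : ℝ) (k : Fin d) :
    Sobolev Γ (t + 1) →L[ℂ] Sobolev Γ t := (preTangentialDeriv h t k).completion

theorem sobolevTangentialDeriv_toSobolev (h : IsSmoothBoundary Ω Γ) (t : ℝ) (k : Fin d)
    (u : SmoothFun Γ) : sobolevTangentialDeriv h t k (toSobolev (t + 1) u) =
      toSobolev t (tangentialDeriv h k u) :=
  ContinuousLinearMap.completion_apply_coe (preTangentialDeriv h t k) u

end SobolevOperators

/-! ### Multiplication operators depend continuously on the multiplier -/

section Multiplication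

variable {d : ℕ} {Ω : Set (Eu d)} {Γ : Compacts (Eu d)}

-- The differential of `f` is the sum of the coordinate functionals times `∂_j f`, and these
-- functionals have norm at most one. Only coordinate derivatives are then left, which for
-- localizations become tangential derivatives.
open LineDeriv in
theorem seminorm_succ_le_sum_lineDeriv {n : ℕ} (k m : ℕ) (f : 𝓢(Eu n, ℂ)) :
    SchwartzMap.seminorm ℂ k (m + 1) f ≤ ∑ j : Fin n,
      SchwartzMap.seminorm ℂ k m (∂_{(EuclideanSpace.single j 1 : Eu n)} f) := by
  refine SchwartzMap.seminorm_le_bound ℂ k (m + 1) f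
    (Finset.sum_nonneg fun j _ => apply_nonneg _ _) fun x => ?_
  let L : Fin n → ℂ →L[ℝ] (Eu n →L[ℝ] ℂ) := fun j =>
    (ContinuousLinearMap.smulRightL ℝ (Eu n) ℂ) (EuclideanSpace.proj j)
  have hL : ∀ j, ‖L j‖ ≤ 1 := by
    intro j
    refine ContinuousLinearMap.opNorm_le_bound _ zero_le_one fun z =>
      ContinuousLinearMap.opNorm_le_bound _ (by positivity) fun v => ?_
    have : ‖v j‖ ≤ ‖v‖ := PiLp.norm_apply_le v j
    calc ‖L j z v‖ = ‖v j‖ * ‖z‖ := by simp [L]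
      _ ≤ 1 * ‖z‖ * ‖v‖ := by
          rw [one_mul, mul_comm]
          gcongr
  have e : fderiv ℝ (f : Eu n → ℂ) = fun x => ∑ j, L j
      ((∂_{(EuclideanSpace.single j 1 : Eu n)} f) x) := by
    ext y v
    have hv : v = ∑ j, v j • EuclideanSpace.single j (1 : ℝ) := by
      simpa using ((EuclideanSpace.basisFun (Fin n) ℝ).sum_repr v).symm
    conv_lhs => rw [hv]
    simp [L, SchwartzMap.lineDerivOp_apply_eq_fderiv]
  rw [← norm_iteratedFDeriv_fderiv, e, iteratedFDeriv_sum]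
  · rw [Finset.sum_apply]
    refine (mul_le_mul_of_nonneg_left (norm_sum_le _ _) (by positivity)).trans ?_
    rw [Finset.mul_sum]
    refine Finset.sum_le_sum fun j _ => ?_
    refine le_trans ?_ (SchwartzMap.le_seminorm ℂ k m _ x)
    gcongr
    refine ((L j).norm_iteratedFDeriv_comp_left (SchwartzMap.contDiffAt _ m) le_rfl).trans ?_
    exact mul_le_of_le_one_left (norm_nonneg _) (hL j)
  · exact fun j _ => (L j).contDiff.comp (SchwartzMap.smooth _ m)

/-- The localization map on the topological algebra `C^∞(Γ, ℂ)`. -/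
def topLocalize (h : IsSmoothBoundary Ω Γ) (i : Localization Γ) :
    TopSmoothFun h →ₗ[ℂ] 𝓢(Eu (d - 1), ℂ) := localize i

/-- The induction on `m` runs over all localizations at once, since a coordinate derivative changes
the cutoff. For `m = 0` the weight `‖y‖ ^ k` is bounded on a compact set outside which every
representative vanishes. -/
theorem tendsto_seminorm_topLocalize (h : IsSmoothBoundary Ω Γ) (k m : ℕ) (i : Localization Γ) :
    Tendsto (fun a => SchwartzMap.seminorm ℂ k m (topLocalize h i a)) (𝓝 0) (𝓝 0) := by
  induction m generalizing i with
  | zero =>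
    have hK : IsCompact (i.φ.symm '' tsupport (i.χ : ↥(Γ : Set (Eu d)) → ℂ)) :=
      (isClosed_tsupport _).isCompact.image_of_continuousOn
        (i.φ.continuousOn_symm.mono i.support_subset)
    obtain ⟨R, hR, hKR⟩ := hK.isBounded.exists_pos_norm_le
    have h1 : Tendsto (fun a => R ^ k * (‖toContinuousMapₐ Γ i.χ‖ * ‖topEval h a‖))
        (𝓝 0) (𝓝 0) := by
      have h2 := tendstoUpTo_zero.1 (tendsto_iff_tendstoUpTo.1 (tendsto_id (x := 𝓝 (0 :
        TopSmoothFun h))) 0)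
      rw [map_zero] at h2
      simpa using ((h2.norm).const_mul ‖toContinuousMapₐ Γ i.χ‖).const_mul (R ^ k)
    refine squeeze_zero (fun a => apply_nonneg _ _) (fun a => ?_) h1
    refine SchwartzMap.seminorm_le_bound ℂ k 0 _ (by positivity) fun y => ?_
    rw [norm_iteratedFDeriv_zero]
    by_cases hy : y ∈ i.φ.source
    · change ‖y‖ ^ k * ‖localize i a y‖ ≤ _
      rw [localize_of_mem i a hy]
      by_cases hχ : i.φ y ∈ tsupport i.χ.1
      · have hyR : ‖y‖ ≤ R := hKR y ⟨_, hχ, i.φ.left_inv hy⟩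
        rw [norm_mul]
        gcongr
        · exact (toContinuousMapₐ Γ i.χ).norm_coe_le_norm (i.φ y)
        · exact (topEval h a).norm_coe_le_norm (i.φ y)
      · rw [image_eq_zero_of_notMem_tsupport hχ, zero_mul, norm_zero, mul_zero]
        positivity
    · change ‖y‖ ^ k * ‖localize i a y‖ ≤ _
      rw [localize_of_notMem i a hy, norm_zero, mul_zero]
      positivity
  | succ m ih =>
    have h1 : ∀ j : Fin (d - 1), Tendsto (fun a => SchwartzMap.seminorm ℂ k m
        (LineDeriv.lineDerivOp (EuclideanSpace.single j 1 : Eu (d - 1)) (topLocalize h i a)))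
        (𝓝 0) (𝓝 0) := by
      intro j
      obtain ⟨A, hA, B, hB, -, hAB⟩ := exists_lineDeriv_localize_eq h i j
      have h2 : Tendsto (fun a : TopSmoothFun h => ∑ l, SchwartzMap.seminorm ℂ k m
          (topLocalize h (i.withCutoff (A l) (hA l)) (topDeriv h l a)) +
          SchwartzMap.seminorm ℂ k m (topLocalize h (i.withCutoff B hB) a)) (𝓝 0) (𝓝 0) := by
        have h3 : ∀ l, Tendsto (fun a : TopSmoothFun h => topDeriv h l a) (𝓝 0) (𝓝 0) := fun l => by
          simpa using (continuous_topDeriv (h := h) l).tendsto 0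
        simpa using (tendsto_finsetSum Finset.univ
          fun l _ => (ih (i.withCutoff (A l) (hA l))).comp (h3 l)).add (ih (i.withCutoff B hB))
      refine squeeze_zero (fun a => apply_nonneg _ _) (fun a => ?_) h2
      refine (congrArg (SchwartzMap.seminorm ℂ k m) (hAB a)).le.trans ?_
      refine (map_add_le_add _ _ _).trans (add_le_add ?_ le_rfl)
      exact Finset.le_sum_of_subadditive (SchwartzMap.seminorm ℂ k m) (map_zero _).le
        (map_add_le_add _) _ _
    refine squeeze_zero (fun a => apply_nonneg _ _)
      (fun a => seminorm_succ_le_sum_lineDeriv k m _) ?_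
    simpa using tendsto_finsetSum Finset.univ fun j _ => h1 j

theorem continuous_topLocalize (h : IsSmoothBoundary Ω Γ) (i : Localization Γ) :
    Continuous (topLocalize h i) := by
  refine continuous_of_continuousAt_zero (topLocalize h i) ?_
  rw [ContinuousAt, map_zero, (schwartz_withSeminorms ℂ (Eu (d - 1)) ℂ).tendsto_nhds]
  intro p ε hε
  simp only [sub_zero]
  exact (tendsto_seminorm_topLocalize h p.1 p.2 i).eventually_lt_const hε

open scoped Manifold in
/-- There are smooth cutoff functions on the hypersurface. -/
theorem exists_smoothFun_eq_one {K T : Set ↥(Γ : Set (Eu d))} (hK : IsClosed K) (hT : IsOpen T)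
    (hKT : K ⊆ T) : ∃ χ : SmoothFun Γ, tsupport χ.1 ⊆ T ∧ ∀ x ∈ K, χ.1 x = 1 := by
  obtain ⟨O, hO, rfl⟩ := isOpen_induced_iff.1 hT
  have hKc : IsClosed (((↑) : ↥(Γ : Set (Eu d)) → Eu d) '' K) :=
    Γ.isCompact.isClosed.isClosedEmbedding_subtypeVal.isClosedMap K hK
  have hd : Disjoint Oᶜ (((↑) : ↥(Γ : Set (Eu d)) → Eu d) '' K) := by
    rw [disjoint_compl_left_iff_subset]
    rintro _ ⟨x, hx, rfl⟩
    exact hKT hx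
  obtain ⟨f, hf0, hf1, -⟩ := exists_contMDiffMap_zero_one_nhds_of_isClosed (n := (⊤ : ℕ∞))
    (𝓘(ℝ, Eu d)) hO.isClosed_compl hKc hd
  refine ⟨⟨fun x => ((f x : ℝ) : ℂ), fun x => ((f x : ℝ) : ℂ),
    Complex.ofRealCLM.contDiff.comp f.contMDiff.contDiff, fun x => rfl⟩, fun x hx => ?_,
    fun x hx => ?_⟩
  · by_contra hxO
    have h0 : ∀ᶠ y in 𝓝 (x : Eu d), f y = 0 := hf0.filter_mono (nhds_le_nhdsSet hxO)
    refine (notMem_tsupport_iff_eventuallyEq.2 ?_) hx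
    have h1 : Tendsto ((↑) : ↥(Γ : Set (Eu d)) → Eu d) (𝓝 x) (𝓝 (x : Eu d)) :=
      continuous_subtype_val.tendsto x
    filter_upwards [h1.eventually h0] with y hy
    simp [hy]
  · have : f x = 1 := (hf1.filter_mono (nhds_le_nhdsSet (mem_image_of_mem _ hx))).self_of_nhds
    simp [this]

/-- A local estimate for products in `H^t(Γ)`. -/
theorem exists_sobolevSeminorm_mul_le (h : IsSmoothBoundary Ω Γ) (t : ℝ) (i : Localization Γ) :
    ∃ (j : Localization Γ) (N : TopSmoothFun h → ℝ), Tendsto N (𝓝 0) (𝓝 0) ∧ (∀ a, 0 ≤ N a) ∧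
      ∀ (a : TopSmoothFun h) (u : PreSobolev Γ t),
        sobolevSeminorm Γ t i (preMul t a u) ≤ N a * sobolevSeminorm Γ t j u := by
  -- A second cutoff, equal to one on the support of the first, splits `i.χ a u = (i.χ a) (χ u)`
  -- into two localized factors, to which `sobolevNorm_mul_le` applies.
  obtain ⟨χ, hχ, hχ1⟩ := exists_smoothFun_eq_one (isClosed_tsupport i.χ.1) i.φ.open_target
    i.support_subset
  refine ⟨i.withCutoff χ hχ, fun a => 2 ^ (|t| / 2) *
    ‖SchwartzMap.toLpCLM ℂ ℂ 1 (volume : Measure (Eu (d - 1)))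
      (weightedFourier (d - 1) |t| (topLocalize h i a))‖, ?_, fun a => by positivity, ?_⟩
  · have : Continuous fun a => 2 ^ (|t| / 2) *
        ‖SchwartzMap.toLpCLM ℂ ℂ 1 (volume : Measure (Eu (d - 1)))
          (weightedFourier (d - 1) |t| (topLocalize h i a))‖ :=
      continuous_const.mul ((SchwartzMap.toLpCLM ℂ ℂ 1 _).continuous.comp
        ((weightedFourier (d - 1) |t|).continuous.comp (continuous_topLocalize h i))).norm
    have h0 := this.tendsto 0
    simp only [map_zero, norm_zero, mul_zero] at h0
    exact h0
  · intro a u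
    refine sobolevNorm_mul_le t (f := localize i a) (g := localize (i.withCutoff χ hχ) u)
      (h := localize i ((show SmoothFun Γ from a) * (show SmoothFun Γ from u))) fun y => ?_
    by_cases hy : y ∈ i.φ.source
    · refine (localize_of_mem i _ hy).trans ?_
      rw [localize_of_mem i a hy, localize_withCutoff_of_mem i hχ u hy]
      change i.χ.1 _ * (a.1 _ * u.1 _) = _
      by_cases hy' : i.φ y ∈ tsupport i.χ.1
      · rw [hχ1 _ hy', one_mul, mul_assoc]
      · rw [image_eq_zero_of_notMem_tsupport hy']
        ring
    · refine (localize_of_notMem i _ hy).trans ?_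
      rw [localize_of_notMem i a hy, zero_mul]

theorem sobolevMul_add (t : ℝ) (a b : SmoothFun Γ) :
    sobolevMul t (a + b) = sobolevMul t a + sobolevMul t b := by
  ext x
  refine UniformSpace.Completion.induction_on x (isClosed_eq (sobolevMul t (a + b)).continuous
    ((sobolevMul t a).continuous.add (sobolevMul t b).continuous)) fun u => ?_
  refine (sobolevMul_toSobolev t (a + b) u).trans ?_
  refine Eq.trans ?_ (congrArg₂ (· + ·) (sobolevMul_toSobolev t a u)
    (sobolevMul_toSobolev t b u)).symm
  refine Eq.trans (congrArg (toSobolev t) (add_mul a b u)) ?_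
  exact UniformSpace.Completion.coe_add (α := PreSobolev Γ t) _ _

theorem sobolevMul_smul (t : ℝ) (c : ℂ) (a : SmoothFun Γ) :
    sobolevMul t (c • a) = c • sobolevMul t a := by
  ext x
  refine UniformSpace.Completion.induction_on x (isClosed_eq (sobolevMul t (c • a)).continuous
    ((sobolevMul t a).continuous.const_smul c)) fun u => ?_
  refine (sobolevMul_toSobolev t (c • a) u).trans ?_
  refine Eq.trans ?_ (congrArg (c • ·) (sobolevMul_toSobolev t a u)).symm
  refine Eq.trans (congrArg (toSobolev t) (smul_mul_assoc c a u)) ?_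
  exact UniformSpace.Completion.coe_smul (X := PreSobolev Γ t) c _

theorem sobolevMul_mul (t : ℝ) (a b : SmoothFun Γ) (x : Sobolev Γ t) :
    sobolevMul t (a * b) x = sobolevMul t a (sobolevMul t b x) := by
  refine UniformSpace.Completion.induction_on x (isClosed_eq (sobolevMul t (a * b)).continuous
    ((sobolevMul t a).continuous.comp (sobolevMul t b).continuous)) fun u => ?_
  refine (sobolevMul_toSobolev t (a * b) u).trans ?_
  refine Eq.trans ?_ (congrArg (sobolevMul t a) (sobolevMul_toSobolev t b u)).symm
  refine Eq.trans ?_ (sobolevMul_toSobolev t a (b * (show SmoothFun Γ from u))).symm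
  exact congrArg (toSobolev t) (mul_assoc a b u)

/-- The operators of multiplication by smooth functions, as a complex linear map. -/
def sobolevMulₗ (h : IsSmoothBoundary Ω Γ) (t : ℝ) :
    TopSmoothFun h →ₗ[ℂ] (Sobolev Γ t →L[ℂ] Sobolev Γ t) where
  toFun a := sobolevMul t a
  map_add' a b := sobolevMul_add t a b
  map_smul' c a := sobolevMul_smul t c a

/-- The constants `N i a` of the local product estimate tend to zero with `a` and so outweigh any
fixed scalar `c`, on a neighbourhood `W` that does not depend on `c`. -/
theorem continuous_sobolevMulₗ (h : IsSmoothBoundary Ω Γ) (t : ℝ) :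
    Continuous (sobolevMulₗ h t) := by
  refine continuous_completion_of_bounds (fun a : TopSmoothFun h => preMul t a)
    (sobolevMulₗ h t).toAddMonoidHom (fun a => rfl) fun V hV => ?_
  obtain ⟨⟨s, ε⟩, hε, hsV⟩ := (withSeminorms_preSobolev Γ t).hasBasis_zero_ball.mem_iff.1 hV
  choose j N hN hN0 hNu using exists_sobolevSeminorm_mul_le h t
  have hW : ∀ i ∈ s, {u : PreSobolev Γ t | sobolevSeminorm Γ t (j i) u < 1} ∈ 𝓝 0 := by
    intro i _
    have := ((withSeminorms_preSobolev Γ t).continuous_seminorm (j i)).tendsto 0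
    rw [map_zero] at this
    exact this.eventually_lt_const zero_lt_one
  refine ⟨⋂ i ∈ s, {u : PreSobolev Γ t | sobolevSeminorm Γ t (j i) u < 1},
    (Filter.biInter_finset_mem s).2 hW, fun c => ?_⟩
  have h1 : ∀ i ∈ s, ∀ᶠ a in 𝓝 (0 : TopSmoothFun h), N i a * ‖c‖ < ε := by
    intro i _
    have := (hN i).mul_const ‖c‖
    rw [zero_mul] at this
    exact this.eventually_lt_const hε
  filter_upwards [(Filter.eventually_all_finset s).2 h1] with a ha u hu
  refine hsV ?_
  rw [Seminorm.mem_ball_zero]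
  refine Seminorm.finset_sup_apply_lt hε fun i hi => ?_
  have hu' : sobolevSeminorm Γ t (j i) u < 1 := mem_iInter₂.1 hu i hi
  calc sobolevSeminorm Γ t i (preMul t a (c • u))
      ≤ N i a * sobolevSeminorm Γ t (j i) (c • u) := hNu i a _
    _ = N i a * ‖c‖ * sobolevSeminorm Γ t (j i) u := by
        rw [map_smul_eq_mul, mul_assoc]
    _ ≤ N i a * ‖c‖ * 1 := by
        have := hN0 i a
        gcongr
    _ < ε := by
        rw [mul_one]
        exact ha i hi

/-- The operator `w ↦ a ∂_k w_i` from `H^(t+1)(Γ)^d` to `H^t(Γ)`, as a continuous function of the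
coefficient `a`. -/
def mulDerivProj (h : IsSmoothBoundary Ω Γ) (t : ℝ) (p : Fin d × Fin d) :
    TopSmoothFun h →L[ℝ] ((Fin d → Sobolev Γ (t + 1)) →L[ℂ] Sobolev Γ t) where
  toFun a := sobolevMulₗ h t a ∘L (sobolevTangentialDeriv h t p.1 ∘L
    ContinuousLinearMap.proj (R := ℂ) (φ := fun _ : Fin d => Sobolev Γ (t + 1)) p.2)
  map_add' a b := by
    rw [map_add, ContinuousLinearMap.add_comp]
  map_smul' c a := by
    change sobolevMulₗ h t ((c : ℂ) • a) ∘L _ = (c : ℂ) • (sobolevMulₗ h t a ∘L _)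
    rw [map_smul, ContinuousLinearMap.smul_comp]
  cont := ((sobolevTangentialDeriv h t p.1 ∘L ContinuousLinearMap.proj (R := ℂ)
    (φ := fun _ : Fin d => Sobolev Γ (t + 1)) p.2).precomp (Sobolev Γ t)).continuous.comp
      (continuous_sobolevMulₗ h t)

end Multiplication

/-! ### The Fréchet space of deformations -/

section Deformations

variable {d : ℕ} {Ω : Set (Eu d)} {Γ : Compacts (Eu d)}

theorem withSeminorms_smoothVec (Γ : Compacts (Eu d)) (F : Type*) [NormedAddCommGroup F]
    [NormedSpace ℝ F] : WithSeminorms (fun k => ckNorm Γ F k) := ⟨rfl⟩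

instance (F : Type*) [NormedAddCommGroup F] [NormedSpace ℝ F] :
    IsTopologicalAddGroup (SmoothVec Γ F) :=
  (withSeminorms_smoothVec Γ F).topologicalAddGroup

instance (F : Type*) [NormedAddCommGroup F] [NormedSpace ℝ F] : ContinuousSMul ℝ (SmoothVec Γ F) :=
  (withSeminorms_smoothVec Γ F).continuousSMul

theorem isOpen_ballInfty (Γ : Compacts (Eu d)) (ε : ℝ) : IsOpen (ballInfty Γ ε) := by
  have hc : ∀ k, Continuous fun r : SmoothVec Γ (Eu d) => ckNorm Γ (Eu d) k (0 - r) := fun k =>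
    ((withSeminorms_smoothVec Γ (Eu d)).continuous_seminorm k).comp (continuous_const.sub
      continuous_id)
  have : Continuous fun r : SmoothVec Γ (Eu d) => dInfty 0 r := by
    refine continuous_tsum (u := fun k : ℕ => (1 / 2 : ℝ) ^ k) (fun k => ?_)
      (summable_geometric_of_lt_one (by norm_num) (by norm_num)) fun k r => ?_
    · refine continuous_const.mul ((hc k).div (continuous_const.add (hc k)) fun r => ?_)
      have := apply_nonneg (ckNorm Γ (Eu d) k) (0 - r)
      positivity
    · have h0 := apply_nonneg (ckNorm Γ (Eu d) k) (0 - r)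
      rw [Real.norm_of_nonneg (by positivity)]
      refine mul_le_of_le_one_right (by positivity) ?_
      rw [div_le_one (by positivity)]
      linarith
  exact isOpen_lt this continuous_const

theorem eventually_add_smul_mem_ballInfty {ε : ℝ} {r : SmoothVec Γ (Eu d)}
    (hr : r ∈ ballInfty Γ ε) (ξ : SmoothVec Γ (Eu d)) :
    ∀ᶠ s : ℝ in 𝓝 0, r + s • ξ ∈ ballInfty Γ ε := by
  have hc : Continuous fun s : ℝ => r + s • ξ :=
    continuous_const.add (continuous_id.smul continuous_const)
  refine hc.continuousAt.eventually ((isOpen_ballInfty Γ ε).mem_nhds ?_)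
  simpa using hr

/-- `u` has a smooth extension with derivatives of order at most `k` bounded by `C`. -/
def HasCkBound (k : ℕ) (u : SmoothFun Γ) (C : ℝ) : Prop :=
  ∃ g : Eu d → ℂ, ContDiff ℝ ∞ g ∧ (∀ x : (Γ : Set (Eu d)), g x = u.1 x) ∧
    ∀ m ≤ k, ∀ x, ‖iteratedFDeriv ℝ m g x‖ ≤ C

/-- Since `ckNorm` is an infimum over extensions, each extension is estimated separately: it is
differentiated along an extension `V` of the projected basis field with bounded derivatives. The
factor `2 ^ k` bounds the sum of the binomial coefficients in the Leibniz rule. -/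
theorem HasCkBound.tangentialDeriv (h : IsSmoothBoundary Ω Γ) (l : Fin d) (k : ℕ) :
    ∃ K : ℝ, 0 ≤ K ∧ ∀ (u : SmoothFun Γ) (C : ℝ), 0 ≤ C → HasCkBound (k + 1) u C →
      HasCkBound k (tangentialDeriv h l u) (K * C) := by
  have hV : IsSmoothOn (Γ : Set (Eu d)) (fun x => tangentBasis Ω x l) := by
    obtain ⟨ν, hν, hνe⟩ := h.isSmoothOn_outerUnitNormal
    refine ⟨fun x => EuclideanSpace.single l 1 - inner ℝ (ν x) (EuclideanSpace.single l 1) • ν x,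
      contDiff_const.sub ((hν.inner ℝ contDiff_const).smul hν), fun x => ?_⟩
    simp only [hνe, tangentBasis, tangentProj]
  obtain ⟨K, hK, V, hVs, hVe, hVK⟩ := ckBounds_nonempty k (⟨_, hV⟩ : SmoothVec Γ (Eu d))
  refine ⟨2 ^ k * K, by positivity, fun u C hC ⟨g, hg, hgu, hgC⟩ =>
    ⟨fun x => fderiv ℝ g x (V x), (hg.fderiv_right (by simp)).clm_apply hVs, fun x => ?_,
      fun m hm x => ?_⟩⟩
  · rw [tangentialDeriv_eq_fderiv h l u x ((hg.of_le (by exact_mod_cast le_top)).contDiffAt)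
      (.of_forall fun y hy => hgu ⟨y, hy⟩)]
    exact congrArg (fderiv ℝ g x) (hVe x)
  · refine (norm_iteratedFDeriv_clm_apply (N := ∞) (hg.fderiv_right (by simp)) hVs x
      (by exact_mod_cast le_top)).trans ?_
    calc ∑ i ∈ Finset.range (m + 1), (m.choose i : ℝ) * ‖iteratedFDeriv ℝ i (fderiv ℝ g) x‖ *
          ‖iteratedFDeriv ℝ (m - i) V x‖
        ≤ ∑ i ∈ Finset.range (m + 1), (m.choose i : ℝ) * C * K := by
          refine Finset.sum_le_sum fun i hi => ?_
          have hi' : i ≤ m := Nat.lt_succ_iff.1 (Finset.mem_range.1 hi)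
          rw [norm_iteratedFDeriv_fderiv]
          gcongr
          · exact hgC _ (by omega) x
          · exact hVK _ (by omega) x
      _ = 2 ^ m * K * C := by
          rw [← Finset.sum_mul, ← Finset.sum_mul]
          have := Nat.sum_range_choose m
          rw [← Nat.cast_sum, this]
          push_cast
          ring
      _ ≤ 2 ^ k * K * C := by
          gcongr
          norm_num

theorem HasCkBound.norm_wordDeriv_le (h : IsSmoothBoundary Ω Γ) (w : List (Fin d)) :
    ∃ K : ℝ, 0 ≤ K ∧ ∀ (u : SmoothFun Γ) (C : ℝ), 0 ≤ C → HasCkBound w.length u C →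
      ‖topEval h (wordDeriv h w u)‖ ≤ K * C := by
  induction w with
  | nil =>
    refine ⟨1, zero_le_one, fun u C hC ⟨g, hg, hgu, hgC⟩ => ?_⟩
    rw [one_mul, ContinuousMap.norm_le _ hC]
    intro x
    change ‖u.1 x‖ ≤ C
    rw [← hgu, ← norm_iteratedFDeriv_zero (𝕜 := ℝ)]
    exact hgC 0 le_rfl x
  | cons l w ih =>
    obtain ⟨K, hK, H⟩ := ih
    obtain ⟨K', hK', H'⟩ := HasCkBound.tangentialDeriv h l w.length
    refine ⟨K * K', by positivity, fun u C hC hu => ?_⟩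
    rw [mul_assoc]
    exact H _ _ (by positivity) (H' u C hC hu)

/-- The components of a vector field, as complex-valued functions. -/
def component (i : Fin d) : SmoothVec Γ (Eu d) →ₗ[ℝ] SmoothFun Γ where
  toFun ξ := ⟨fun x => ((ξ x i : ℝ) : ℂ), by
    obtain ⟨g, hg, hgξ⟩ := ξ.2
    refine ⟨fun x => ((g x i : ℝ) : ℂ), Complex.ofRealCLM.contDiff.comp
      ((EuclideanSpace.proj (𝕜 := ℝ) i).contDiff.comp hg), fun x => ?_⟩
    exact congrArg (fun v : Eu d => ((v i : ℝ) : ℂ)) (hgξ x)⟩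
  map_add' ξ η := by
    ext x
    exact Complex.ofReal_add (ξ x i) (η x i)
  map_smul' c ξ := by
    ext x
    exact Complex.ofReal_mul c (ξ x i)

theorem hasCkBound_component (i : Fin d) {k : ℕ} {ξ : SmoothVec Γ (Eu d)} {C : ℝ}
    (hC : C ∈ ckBounds k ξ) : HasCkBound k (component i ξ) C := by
  obtain ⟨hC0, g, hg, hgξ, hgC⟩ := hC
  let L : Eu d →L[ℝ] ℂ := Complex.ofRealCLM ∘L EuclideanSpace.proj i
  have hL : ‖L‖ ≤ 1 := L.opNorm_le_bound zero_le_one fun v => by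
    simpa [L] using PiLp.norm_apply_le v i
  refine ⟨fun x => L (g x), L.contDiff.comp hg, fun x => ?_, fun m hm x => ?_⟩
  · exact congrArg L (hgξ x)
  · refine (L.norm_iteratedFDeriv_comp_left hg.contDiffAt
      (by exact_mod_cast le_top : ((m : ℕ∞) : ℕ∞ω) ≤ ∞)).trans ?_
    exact (mul_le_of_le_one_left (norm_nonneg _) hL).trans (hgC m hm x)

/-- The tangential derivatives of the components of a deformation. -/
def jacobianEntry (h : IsSmoothBoundary Ω Γ) (p : Fin d × Fin d) :
    SmoothVec Γ (Eu d) →L[ℝ] TopSmoothFun h where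
  toLinearMap :=
    { toFun := fun ξ => tangentialDeriv h p.1 (component p.2 ξ)
      map_add' := fun ξ η => by
        rw [map_add, map_add]
        rfl
      map_smul' := fun c ξ => by
        rw [map_smul]
        exact (tangentialDeriv h p.1).map_smul (c : ℂ) (component p.2 ξ) }
  cont := by
    let f : SmoothVec Γ (Eu d) →+ TopSmoothFun h :=
      { toFun := fun ξ => tangentialDeriv h p.1 (component p.2 ξ)
        map_zero' := by
          rw [map_zero, map_zero]
          rfl
        map_add' := fun ξ η => by
          rw [map_add, map_add]
          rfl }
    have hf : Continuous f := by
      refine continuous_of_continuousAt_zero f ?_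
      refine tendsto_iff_wordDeriv.2 fun w => ?_
      obtain ⟨K, hK, H⟩ := HasCkBound.norm_wordDeriv_le h (p.1 :: w)
      have hle : ∀ ξ : SmoothVec Γ (Eu d),
          ‖topEval h (wordDeriv h (p.1 :: w) (component p.2 ξ))‖ ≤
            K * ckNorm Γ (Eu d) (p.1 :: w).length ξ := by
        intro ξ
        change _ ≤ K * sInf (ckBounds (p.1 :: w).length ξ)
        -- The estimate holds for every admissible bound `C`, hence for the infimum, into which `K`
        -- is first moved.
        rw [← smul_eq_mul K, ← Real.sInf_smul_of_nonneg hK]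
        refine le_csInf ((ckBounds_nonempty _ ξ).image _) ?_
        rintro _ ⟨C, hC, rfl⟩
        exact H _ C hC.1 (hasCkBound_component p.2 hC)
      have h0 : Tendsto (fun ξ => K * ckNorm Γ (Eu d) (p.1 :: w).length ξ) (𝓝 0) (𝓝 0) := by
        have := (((withSeminorms_smoothVec Γ (Eu d)).continuous_seminorm
          (p.1 :: w).length).tendsto 0).const_mul K
        rwa [map_zero, mul_zero] at this
      have h1 := squeeze_zero_norm hle h0
      rw [map_zero, map_zero, map_zero]
      exact h1
    exact hf

end Deformations

/-! ### Small deformations are diffeomorphisms -/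

section SmallDeformations

variable {d : ℕ} {Γ : Compacts (Eu d)}

open scoped NNReal in
/-- A perturbation of the identity by a contraction is a global diffeomorphism. -/
theorem exists_smooth_inverse_id_sub {E : Type*} [NormedAddCommGroup E] [NormedSpace ℝ E]
    [CompleteSpace E] {g : E → E} (hg : ContDiff ℝ ∞ g) {c : ℝ≥0} (hc : c < 1)
    (hgc : ∀ x, ‖fderiv ℝ g x‖ ≤ c) :
    ∃ f : E → E, ContDiff ℝ ∞ f ∧ ∀ x, f (x - g x) = x := by
  have hlip : LipschitzWith c g := lipschitzWith_of_nnnorm_fderiv_le (𝕜 := ℝ)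
    (hg.differentiable (by simp)) hgc
  have ha : ApproximatesLinearOn (fun x => x - g x)
      ((ContinuousLinearEquiv.refl ℝ E : E ≃L[ℝ] E) : E →L[ℝ] E) univ c := by
    rw [ApproximatesLinearOn.approximatesLinearOn_iff_lipschitzOnWith, lipschitzOnWith_univ]
    have e : (fun x => x - g x) - ⇑((ContinuousLinearEquiv.refl ℝ E : E ≃L[ℝ] E) : E →L[ℝ] E) =
        -g := by
      ext x
      simp
    rw [e]
    exact hlip.neg
  have hN : Subsingleton E ∨
      c < ‖((ContinuousLinearEquiv.refl ℝ E).symm : E →L[ℝ] E)‖₊⁻¹ := by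
    rcases subsingleton_or_nontrivial E with hE | hE
    · exact Or.inl hE
    · right
      have : ((ContinuousLinearEquiv.refl ℝ E).symm : E →L[ℝ] E) =
        ContinuousLinearMap.id ℝ E := rfl
      rw [this, ContinuousLinearMap.nnnorm_id, inv_one]
      exact hc
  let φ := ha.toHomeomorph (fun x => x - g x) hN
  -- The derivative `1 - fderiv ℝ g x` is invertible by the Neumann series, so the inverse
  -- homeomorphism is smooth.
  refine ⟨φ.symm, φ.contDiff_symm (f₀' := fun x => ContinuousLinearEquiv.unitsEquiv ℝ E
    (Units.oneSub (fderiv ℝ g x) ((hgc x).trans_lt (by exact_mod_cast hc)))) (fun x => ?_)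
    (contDiff_id.sub hg), fun x => φ.symm_apply_apply x⟩
  exact (hasFDerivAt_id x).sub (hg.differentiable (by simp) x).hasFDerivAt

/-- The term `k = 1` of the distance alone gives `(1/2) c / (1 + c) < 1/8` for the `C¹` norm `c`, so
`c < 1/3`. Hence `-r` extends to a map `g` with derivative bounded by `1/2`, and `Id + r` is the
restriction of `Id - g`. -/
theorem isDeformation_of_mem_ballInfty {r : SmoothVec Γ (Eu d)} (hr : r ∈ ballInfty Γ (1 / 8)) :
    IsDeformation r := by
  have h0 : ∀ k, 0 ≤ ckNorm Γ (Eu d) k (0 - r) := fun k => apply_nonneg _ _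
  have hnn : ∀ k : ℕ, 0 ≤ (1 / 2 : ℝ) ^ k *
      (ckNorm Γ (Eu d) k (0 - r) / (1 + ckNorm Γ (Eu d) k (0 - r))) := fun k => by
    have := h0 k
    positivity
  have hs : Summable fun k : ℕ => (1 / 2 : ℝ) ^ k *
      (ckNorm Γ (Eu d) k (0 - r) / (1 + ckNorm Γ (Eu d) k (0 - r))) := by
    refine Summable.of_nonneg_of_le hnn (fun k => ?_)
      (summable_geometric_of_lt_one (r := (1 / 2 : ℝ)) (by norm_num) (by norm_num))
    have := h0 k
    refine mul_le_of_le_one_right (by positivity) ?_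
    rw [div_le_one (by positivity)]
    linarith
  have h1 := (hs.le_tsum 1 fun k _ => hnn k).trans_lt hr
  have h2 : ckNorm Γ (Eu d) 1 (0 - r) < 1 / 2 := by
    have := h0 1
    rw [pow_one, ← mul_div_assoc, div_lt_iff₀ (by positivity)] at h1
    linarith
  obtain ⟨C, ⟨hC0, g, hg, hgr, hgC⟩, hC⟩ := exists_lt_of_csInf_lt (ckBounds_nonempty 1 (0 - r)) h2
  obtain ⟨f, hf, hfg⟩ := exists_smooth_inverse_id_sub hg (c := 1 / 2)
    (NNReal.half_lt_self one_ne_zero) fun x => by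
      rw [← norm_iteratedFDeriv_one]
      exact (hgC 1 le_rfl x).trans (by simpa using hC.le)
  have hfr : ∀ x : (Γ : Set (Eu d)), f (x + r x) = x := by
    intro x
    have e : g x = -r x := (hgr x).trans (zero_sub (r x))
    have := hfg x
    rwa [e, sub_neg_eq_add] at this
  refine ⟨fun y => ⟨f y, ?_⟩, ⟨f, hf, fun y => rfl⟩, fun x => Subtype.ext (hfr x)⟩
  obtain ⟨_, x, rfl⟩ := y
  rw [hfr x]
  exact x.2

end SmallDeformations

/-! ### Cofactors and the transport of normals -/

section Cofactors

set_option linter.unusedSectionVars false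

open Matrix

variable {n R : Type*} [Fintype n] [DecidableEq n] [CommRing R]

theorem vecMul_adjugate_apply (A : Matrix n n R) (v : n → R) (i : n) :
    (v ᵥ* A.adjugate) i = (A.updateRow i v).det := by
  rw [← cramer_transpose_apply, cramer_eq_adjugate_mulVec, ← adjugate_transpose, mulVec_transpose]

/-- The determinant of a rank one perturbation. -/
theorem det_add_vecMulVec (A : Matrix n n R) (u v : n → R) :
    (A + vecMulVec u v).det = A.det + (v ᵥ* A.adjugate) ⬝ᵥ u := by
  -- The rows are perturbed one at a time. Once row `k` equals `v`, row operations remove the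
  -- multiples of `v` already added to the other rows.
  have key : ∀ s : Finset n, (A + vecMulVec (fun i => if i ∈ s then u i else 0) v).det =
      A.det + ∑ i ∈ s, (A.updateRow i v).det * u i := by
    intro s
    induction s using Finset.induction_on with
    | empty =>
      have : A + vecMulVec (fun i => if i ∈ (∅ : Finset n) then u i else 0) v = A := by
        ext i j
        simp [vecMulVec_apply]
      rw [this, Finset.sum_empty, add_zero]
    | insert k s hk ih =>
      have e : A + vecMulVec (fun i => if i ∈ insert k s then u i else 0) v =
          (A + vecMulVec (fun i => if i ∈ s then u i else 0) v).updateRow k (A k + u k • v) := by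
        ext i j
        by_cases hik : i = k
        · subst hik
          simp [vecMulVec_apply]
        · simp [vecMulVec_apply, hik]
      have e1 : (A + vecMulVec (fun i => if i ∈ s then u i else 0) v).updateRow k (A k) =
          A + vecMulVec (fun i => if i ∈ s then u i else 0) v := by
        ext i j
        by_cases hik : i = k
        · subst hik
          simp [vecMulVec_apply, hk]
        · simp [updateRow_ne hik]
      have e2 : ((A + vecMulVec (fun i => if i ∈ s then u i else 0) v).updateRow k v).det =
          (A.updateRow k v).det := by
        refine det_eq_of_forall_row_eq_smul_add_const (fun i => if i ∈ s then u i else 0) k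
          (by simp [hk]) fun i j => ?_
        by_cases hik : i = k
        · subst hik
          simp [hk]
        · simp [updateRow_ne hik, vecMulVec_apply]
      rw [e, det_updateRow_add, det_updateRow_smul, e1, e2, ih, Finset.sum_insert hk]
      ring
  have := key Finset.univ
  simp only [Finset.mem_univ, if_true] at this
  rw [this]
  simp only [dotProduct, vecMul_adjugate_apply]

/-- The cofactor vector does not change under perturbations in the direction of the vector. -/
theorem vecMul_adjugate_add_vecMulVec (A : Matrix n n R) (c v : n → R) :
    v ᵥ* (A + vecMulVec c v).adjugate = v ᵥ* A.adjugate := by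
  -- Against any `u`, the determinant of `A + (c + u) vᵀ` is expanded by the rank one formula in two
  -- ways.
  refine dotProduct_eq _ _ fun u => ?_
  have h1 := det_add_vecMulVec (A + vecMulVec c v) u v
  rw [add_assoc, ← add_vecMulVec, det_add_vecMulVec, det_add_vecMulVec, dotProduct_add] at h1
  linear_combination -h1

/-- The normal vector `cof(1 + J) n`. -/
def cofNormal (v : n → R) (J : Matrix n n R) : n → R := v ᵥ* (1 + J).adjugate

/-- The tangential part of `1 + J`. -/
def tangentJacobian (v : n → R) (J : Matrix n n R) : Matrix n n R := 1 + J - vecMulVec v v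

/-- The tangential part of `1 + J`, completed by a map between the normal lines. -/
def fullJacobian (v : n → R) (J : Matrix n n R) (N : n → R) : Matrix n n R :=
  1 + J + vecMulVec (N - v) v

/-- The inverse of the completed Jacobian matrix. -/
def invJacobian (v : n → R) (J : Matrix n n R) (a : R) : Matrix n n R :=
  a • (fullJacobian v J (a • cofNormal v J)).adjugate

variable {v : n → R} {J : Matrix n n R} {a : R}

theorem fullJacobian_eq (v : n → R) (J : Matrix n n R) (N : n → R) :
    fullJacobian v J N = tangentJacobian v J + vecMulVec N v := by
  rw [fullJacobian, tangentJacobian, sub_vecMulVec]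
  abel

theorem normal_dotProduct_normal (ha : a ^ 2 * (cofNormal v J ⬝ᵥ cofNormal v J) = 1) :
    (a • cofNormal v J) ⬝ᵥ (a • cofNormal v J) = 1 := by
  rw [smul_dotProduct, dotProduct_smul, smul_eq_mul, smul_eq_mul, ← ha]
  ring

theorem tangentJacobian_mulVec (hv : v ⬝ᵥ v = 1) (hJ : J *ᵥ v = 0) :
    tangentJacobian v J *ᵥ v = 0 := by
  rw [tangentJacobian, sub_mulVec, add_mulVec, one_mulVec, hJ, vecMulVec_mulVec, hv]
  simp

/-- `1 + J` fixes `v`, so `cofNormal v J ⬝ᵥ v` is the determinant of `1 + J`. In the rank one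
formula this cancels the contribution of `-v`. -/
theorem det_fullJacobian (hv : v ⬝ᵥ v = 1) (hJ : J *ᵥ v = 0) (N : n → R) :
    (fullJacobian v J N).det = cofNormal v J ⬝ᵥ N := by
  have h1 : (1 + J) *ᵥ v = v := by rw [add_mulVec, one_mulVec, hJ, add_zero]
  have h2 : cofNormal v J ⬝ᵥ v = (1 + J).det := by
    have h3 : cofNormal v J ⬝ᵥ ((1 + J) *ᵥ v) = (1 + J).det := by
      rw [cofNormal, dotProduct_mulVec, vecMul_vecMul, adjugate_mul, vecMul_smul, vecMul_one,
        smul_dotProduct, hv, smul_eq_mul, mul_one]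
    rwa [h1] at h3
  rw [fullJacobian, det_add_vecMulVec, ← cofNormal, dotProduct_sub, h2]
  ring

/-- For `N = a w` the determinant is `a (w · w)`, whose inverse is `a` itself. No division occurs,
so the argument works over the ring of smooth functions. -/
theorem invJacobian_mul (hv : v ⬝ᵥ v = 1) (hJ : J *ᵥ v = 0)
    (ha : a ^ 2 * (cofNormal v J ⬝ᵥ cofNormal v J) = 1) :
    invJacobian v J a * fullJacobian v J (a • cofNormal v J) = 1 := by
  rw [invJacobian, smul_mul, adjugate_mul, det_fullJacobian hv hJ, smul_smul, dotProduct_smul,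
    smul_eq_mul, ← mul_assoc, ← sq, ha, one_smul]

theorem mul_invJacobian (hv : v ⬝ᵥ v = 1) (hJ : J *ᵥ v = 0)
    (ha : a ^ 2 * (cofNormal v J ⬝ᵥ cofNormal v J) = 1) :
    fullJacobian v J (a • cofNormal v J) * invJacobian v J a = 1 :=
  mul_eq_one_comm.1 (invJacobian_mul hv hJ ha)

/-- `w` times `1 + J` is a multiple of `v`, hence so is the product considered here; its pairing
with `v` vanishes because the tangential Jacobian kills `v`. -/
theorem normal_vecMul_tangentJacobian (hv : v ⬝ᵥ v = 1) (hJ : J *ᵥ v = 0) (a : R) :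
    (a • cofNormal v J) ᵥ* tangentJacobian v J = 0 := by
  have h1 : (a • cofNormal v J) ᵥ* tangentJacobian v J =
      (a * (1 + J).det - (a • cofNormal v J) ⬝ᵥ v) • v := by
    rw [tangentJacobian, vecMul_sub, vecMul_vecMulVec, sub_smul, smul_vecMul, cofNormal,
      vecMul_vecMul, adjugate_mul, vecMul_smul, vecMul_one, smul_smul]
  have h2 : ((a • cofNormal v J) ᵥ* tangentJacobian v J) ⬝ᵥ v = 0 := by
    rw [← dotProduct_mulVec, tangentJacobian_mulVec hv hJ, dotProduct_zero]
  rw [h1, smul_dotProduct, hv, smul_eq_mul, mul_one] at h2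
  rw [h1, h2, zero_smul]

theorem vecMul_invJacobian (hv : v ⬝ᵥ v = 1) (hJ : J *ᵥ v = 0)
    (ha : a ^ 2 * (cofNormal v J ⬝ᵥ cofNormal v J) = 1) :
    v ᵥ* invJacobian v J a = a • cofNormal v J := by
  have h1 : (a • cofNormal v J) ᵥ* fullJacobian v J (a • cofNormal v J) = v := by
    rw [fullJacobian_eq, vecMul_add, normal_vecMul_tangentJacobian hv hJ, vecMul_vecMulVec,
      normal_dotProduct_normal ha, one_smul, zero_add]
  have h2 := vecMul_vecMul (a • cofNormal v J) (fullJacobian v J (a • cofNormal v J))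
    (invJacobian v J a)
  rwa [h1, mul_invJacobian hv hJ ha, vecMul_one] at h2

/-- The right-hand side is the projection orthogonal to `𝒩(r)`: combined with the chain rule, this
identity produces the tangential gradient on `Γ_r`. -/
theorem tangentJacobian_mul_invJacobian (hv : v ⬝ᵥ v = 1) (hJ : J *ᵥ v = 0)
    (ha : a ^ 2 * (cofNormal v J ⬝ᵥ cofNormal v J) = 1) :
    tangentJacobian v J * invJacobian v J a =
      1 - vecMulVec (a • cofNormal v J) (a • cofNormal v J) := by
  have h1 := mul_invJacobian hv hJ ha
  rw [fullJacobian_eq, add_mul, vecMulVec_mul, vecMul_invJacobian hv hJ ha] at h1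
  rw [← h1, add_sub_cancel_right]

/-- If the cofactor vector vanished, `det (A + u vᵀ)` would equal `det A = 0` for every `u`. Take `u
= m - A v`, with `m ≠ 0` orthogonal to the image under `A` of the complement of `v`. Pairing a
kernel vector `w` with `m` gives `(v · w)(m · m) = 0`, so `w` is orthogonal to `v` and `A w = 0`,
against the left inverse `Q`. Real entries are used for `m · m ≠ 0`. -/
theorem cofNormal_ne_zero {v : n → ℝ} {A Q : Matrix n n ℝ}
    (hv : v ⬝ᵥ v = 1) (hQ : ∀ w, v ⬝ᵥ w = 0 → Q *ᵥ (A *ᵥ w) = w) : v ᵥ* A.adjugate ≠ 0 := by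
  intro h0
  have hdet : (A - vecMulVec (A *ᵥ v) v).det = 0 := by
    refine exists_mulVec_eq_zero_iff.1 ⟨v, ?_, ?_⟩
    · rintro rfl
      simp at hv
    · rw [sub_mulVec, vecMulVec_mulVec, hv]
      simp
  obtain ⟨m, hm, hmA⟩ := exists_vecMul_eq_zero_iff.2 hdet
  have h1 : (A - vecMulVec (A *ᵥ v) v + vecMulVec m v).det = 0 := by
    have h2 := det_add_vecMulVec A (m - A *ᵥ v) v
    have h3 : A.det = 0 := by
      have := vecMul_vecMul v A.adjugate A
      rw [h0, zero_vecMul, adjugate_mul, vecMul_smul, vecMul_one] at this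
      have h4 := congrArg (· ⬝ᵥ v) this
      simpa [hv] using h4.symm
    rw [h0, zero_dotProduct, h3, add_zero, sub_vecMulVec] at h2
    rw [← h2]
    congr 1
    abel
  obtain ⟨w, hw, hAw⟩ := exists_mulVec_eq_zero_iff.2 h1
  rw [add_mulVec, vecMulVec_mulVec] at hAw
  have h2 : v ⬝ᵥ w = 0 := by
    have h3 := congrArg (m ⬝ᵥ ·) hAw
    simp only [dotProduct_add, dotProduct_mulVec, hmA, zero_dotProduct, zero_add,
      dotProduct_zero] at h3
    have h4 : (v ⬝ᵥ w) * (m ⬝ᵥ m) = 0 := by simpa [mul_comm] using h3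
    exact (mul_eq_zero.1 h4).resolve_right fun h => hm (dotProduct_self_eq_zero.1 h)
  refine hw ?_
  rw [sub_mulVec, vecMulVec_mulVec, h2] at hAw
  rw [← hQ w h2]
  have h3 : A *ᵥ w = 0 := by simpa using hAw
  rw [h3, mulVec_zero]

end Cofactors

/-! ### Gâteaux differentiable maps into an algebra -/

section GateauxSubalgebra

set_option linter.unusedSectionVars false

variable {X E : Type*} [AddCommGroup X] [Module ℝ X] [TopologicalSpace X]
  [CommRing E] [Algebra ℝ E] [TopologicalSpace E] [IsTopologicalRing E]

/-- The maps that are continuous on `U` and have semiderivatives at the points of `U`. -/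
def gateauxSubalgebra (U : Set X) : Subalgebra E (X → E) where
  carrier := {f | ContinuousOn f U ∧ ∀ r ∈ U, ∀ ξ,
    Tendsto (fun s : ℝ => f (r + s • ξ)) (𝓝[≠] 0) (𝓝 (f r)) ∧ ∃ D, HasGateauxSemideriv f r ξ D}
  add_mem' := by
    rintro f g ⟨hf, hf'⟩ ⟨hg, hg'⟩
    refine ⟨hf.add hg, fun r hr ξ => ?_⟩
    obtain ⟨h1, D, hD⟩ := hf' r hr ξ
    obtain ⟨h2, D', hD'⟩ := hg' r hr ξ
    exact ⟨h1.add h2, _, hD.add hD'⟩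
  mul_mem' := by
    rintro f g ⟨hf, hf'⟩ ⟨hg, hg'⟩
    refine ⟨hf.mul hg, fun r hr ξ => ?_⟩
    obtain ⟨h1, D, hD⟩ := hf' r hr ξ
    obtain ⟨h2, D', hD'⟩ := hg' r hr ξ
    exact ⟨h1.mul h2, _, hD.mul hD' h2⟩
  algebraMap_mem' c := by
    refine ⟨continuousOn_const, fun r _ ξ => ⟨tendsto_const_nhds, 0, ?_⟩⟩
    refine (tendsto_const_nhds (x := (0 : E))).congr fun s => ?_
    simp

theorem const_mem_subalgebra (S : Subalgebra E (X → E)) (c : E) : (fun _ => c) ∈ S :=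
  S.algebraMap_mem c

theorem sum_mem_subalgebra (S : Subalgebra E (X → E)) {ι : Type*} [Fintype ι] {f : ι → X → E}
    (hf : ∀ i, f i ∈ S) : (fun r => ∑ i, f i r) ∈ S := by
  have : (fun r => ∑ i, f i r) = ∑ i, f i := by
    ext r
    simp
  rw [this]
  exact sum_mem fun i _ => hf i

variable {n : Type*} [Fintype n] [DecidableEq n]

/-- The adjugate is formed over the ring `S` itself and then evaluated at each `r`, evaluation being
a ring homomorphism. -/
theorem adjugate_mem_subalgebra (S : Subalgebra E (X → E)) {M : X → Matrix n n E}
    (hM : ∀ i j, (fun r => M r i j) ∈ S) (i j : n) : (fun r => (M r).adjugate i j) ∈ S := by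
  let M' : Matrix n n S := Matrix.of fun i j => ⟨_, hM i j⟩
  have : (fun r => (M r).adjugate i j) = ((M'.adjugate i j : S) : X → E) := by
    ext r
    have := ((Pi.evalRingHom (fun _ : X => E) r).comp (S.val : S →+* (X → E))).map_adjugate M'
    exact (congrFun (congrFun this i) j).symm
  rw [this]
  exact (M'.adjugate i j).2

theorem cofNormal_mem_subalgebra (S : Subalgebra E (X → E)) {J : X → Matrix n n E} (v : n → E)
    (hJ : ∀ i j, (fun r => J r i j) ∈ S) (i : n) : (fun r => cofNormal v (J r) i) ∈ S := by
  refine sum_mem_subalgebra S (f := fun k r => v k * (1 + J r).adjugate k i) fun k => ?_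
  exact mul_mem (const_mem_subalgebra S (v k)) (adjugate_mem_subalgebra S
    (fun i j => add_mem (const_mem_subalgebra S ((1 : Matrix n n E) i j)) (hJ i j)) k i)

theorem invJacobian_mem_subalgebra (S : Subalgebra E (X → E)) {J : X → Matrix n n E} (v : n → E)
    {a : X → E} (hJ : ∀ i j, (fun r => J r i j) ∈ S) (ha : a ∈ S) (i j : n) :
    (fun r => invJacobian v (J r) (a r) i j) ∈ S := by
  refine mul_mem ha (adjugate_mem_subalgebra S (fun i j => ?_) i j)
  exact add_mem (add_mem (const_mem_subalgebra S ((1 : Matrix n n E) i j)) (hJ i j))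
    (mul_mem (sub_mem (mul_mem ha (cofNormal_mem_subalgebra S v hJ i))
      (const_mem_subalgebra S (v i))) (const_mem_subalgebra S (v j)))

theorem HasGateauxSemideriv.sum {ι : Type*} [Fintype ι] {f : ι → X → E} {a : ι → E} {r ξ : X}
    (hf : ∀ i, HasGateauxSemideriv (f i) r ξ (a i)) :
    HasGateauxSemideriv (fun r => ∑ i, f i r) r ξ (∑ i, a i) := by
  refine (tendsto_finsetSum Finset.univ fun i _ => hf i).congr fun s => ?_
  rw [← Finset.smul_sum, ← Finset.sum_sub_distrib]

end GateauxSubalgebra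

/-! ### Inverse square roots of positive functions -/

section InvSqrt

variable {d : ℕ} {Ω : Set (Eu d)} {Γ : Compacts (Eu d)} {h : IsSmoothBoundary Ω Γ}

theorem continuous_topEval : Continuous (topEval h) :=
  continuous_iff_continuousAt.2 fun a => tendstoUpTo_zero.1
    (tendsto_iff_tendstoUpTo.1 (tendsto_id (x := 𝓝 a)) 0)

instance : T2Space (TopSmoothFun h) :=
  T2Space.of_injective_continuous (topEval_injective h) continuous_topEval

theorem IsPosReal.add {a b : TopSmoothFun h} (ha : IsPosReal a) (hb : IsPosReal b) :
    IsPosReal (a + b) := by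
  intro x
  obtain ⟨c, hc, hcx⟩ := ha x
  obtain ⟨e, he, hex⟩ := hb x
  exact ⟨c + e, by positivity, by rw [map_add, ContinuousMap.add_apply, hcx, hex]; push_cast; rfl⟩

theorem IsPosReal.exists_sq_mul_eq_one {q : TopSmoothFun h} (hq : IsPosReal q) :
    ∃ a : TopSmoothFun h, IsPosReal a ∧ a ^ 2 * q = 1 := by
  choose c hc hcq using hq
  have hs : IsSmoothOn (Γ : Set (Eu d)) (fun x => (((Real.sqrt (c x))⁻¹ : ℝ) : ℂ)) := by
    refine isSmoothOn_of_forall_isLocallySmoothAt Γ.isCompact.isClosed fun x => ?_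
    obtain ⟨g, hg, hgq⟩ := (show IsSmoothOn (Γ : Set (Eu d)) (Subtype.val (show SmoothFun Γ from q))
      from (show SmoothFun Γ from q).2)
    have hgc : ∀ y : (Γ : Set (Eu d)), (g y).re = c y := fun y => by
      rw [hgq y]
      exact congrArg Complex.re (hcq y)
    have hre : ContDiff ℝ ∞ (fun y => (g y).re) := Complex.reCLM.contDiff.comp hg
    have hU : ∀ᶠ y in 𝓝 (x : Eu d), 0 < (g y).re := by
      refine hre.continuous.continuousAt.eventually_const_lt ?_
      exact (hc x).trans_eq (hgc x).symm
    refine ⟨_, hU, fun y => (((Real.sqrt (g y).re)⁻¹ : ℝ) : ℂ), ?_, fun y hy => ?_⟩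
    · intro y hy
      have hy' : 0 < (g y).re := hy
      refine ContDiffAt.contDiffWithinAt ?_
      exact Complex.ofRealCLM.contDiff.contDiffAt.comp y
        ((hre.contDiffAt.sqrt hy'.ne').inv (Real.sqrt_pos.2 hy').ne')
    · change (((Real.sqrt (g y).re)⁻¹ : ℝ) : ℂ) = _
      rw [hgc y]
  let a : TopSmoothFun h := (⟨_, hs⟩ : SmoothFun Γ)
  refine ⟨a, fun x => ⟨(Real.sqrt (c x))⁻¹, inv_pos.2 (Real.sqrt_pos.2 (hc x)), rfl⟩, ?_⟩
  refine topEval_injective h (ContinuousMap.ext fun x => ?_)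
  have h1 : topEval h a x = (((Real.sqrt (c x))⁻¹ : ℝ) : ℂ) := rfl
  rw [map_mul, map_pow, map_one, ContinuousMap.mul_apply, ContinuousMap.pow_apply, h1, hcq,
    ContinuousMap.one_apply, ← Complex.ofReal_pow, ← Complex.ofReal_mul, inv_pow,
    Real.sq_sqrt (hc x).le, inv_mul_cancel₀ (hc x).ne', Complex.ofReal_one]

open Classical in
/-- The inverse square root of a positive function. -/
def invSqrt (q : TopSmoothFun h) : TopSmoothFun h :=
  if hq : IsPosReal q then hq.exists_sq_mul_eq_one.choose else 0

theorem IsPosReal.invSqrt {q : TopSmoothFun h} (hq : IsPosReal q) :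
    IsPosReal (invSqrt q) ∧ ShapeCalc.invSqrt q ^ 2 * q = 1 := by
  rw [ShapeCalc.invSqrt, dif_pos hq]
  exact hq.exists_sq_mul_eq_one.choose_spec

theorem tendsto_invSqrt {α : Type*} {l : Filter α} {q : α → TopSmoothFun h} {q₀ : TopSmoothFun h}
    (hq : Tendsto q l (𝓝 q₀)) (hpos : ∀ᶠ s in l, IsPosReal (q s)) (h0 : IsPosReal q₀) :
    Tendsto (fun s => invSqrt (q s)) l (𝓝 (invSqrt q₀)) :=
  tendsto_of_sq_mul_eq_one hq (hpos.mono fun _ hs => hs.invSqrt) h0.invSqrt.1 h0.invSqrt.2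

/-- With `f = q^(-1/2)` one has `f_s - f = -f_s² f² (q_s - q) / (f_s + f)`. The quotient is realized
inside the algebra as the factor `invSqrt (f_s + f) ^ 2`, which converges by a second use of
`tendsto_invSqrt`. -/
theorem invSqrt_mem_gateauxSubalgebra {X : Type*} [AddCommGroup X] [Module ℝ X]
    [TopologicalSpace X] {U : Set X} (hU : ∀ r ∈ U, ∀ ξ, ∀ᶠ s : ℝ in 𝓝 0, r + s • ξ ∈ U)
    {q : X → TopSmoothFun h} (hq : q ∈ gateauxSubalgebra (E := TopSmoothFun h) U)
    (hpos : ∀ r ∈ U, IsPosReal (q r)) :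
    (fun r => invSqrt (q r)) ∈ gateauxSubalgebra (E := TopSmoothFun h) U := by
  refine ⟨fun r hr => tendsto_invSqrt (hq.1 r hr) (eventually_mem_nhdsWithin.mono hpos)
    (hpos r hr), fun r hr ξ => ?_⟩
  obtain ⟨hline, D, hD⟩ := hq.2 r hr ξ
  have hUs : ∀ᶠ s : ℝ in 𝓝[≠] 0, IsPosReal (q (r + s • ξ)) :=
    Filter.Eventually.mono (nhdsWithin_le_nhds (hU r hr ξ)) fun s hs => hpos _ hs
  have h1 := tendsto_invSqrt hline hUs (hpos r hr)
  have h2 := tendsto_invSqrt (h1.add (tendsto_const_nhds (x := invSqrt (q r))))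
    (hUs.mono fun s hs => hs.invSqrt.1.add (hpos r hr).invSqrt.1)
    ((hpos r hr).invSqrt.1.add (hpos r hr).invSqrt.1)
  refine ⟨h1, _, Tendsto.congr' ?_ (((((h1.pow 2).mul (tendsto_const_nhds (x := invSqrt (q r) ^ 2))).mul
    hD).mul (h2.pow 2)).neg)⟩
  filter_upwards [hUs] with s hs
  have e1 := hs.invSqrt.2
  have e0 := (hpos r hr).invSqrt.2
  have e2 := (hs.invSqrt.1.add (hpos r hr).invSqrt.1).invSqrt.2
  rw [Algebra.mul_smul_comm, Algebra.smul_mul_assoc, ← smul_neg]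
  congr 1
  linear_combination (- invSqrt (invSqrt (q (r + s • ξ)) + invSqrt (q r)) ^ 2 *
    invSqrt (q r) ^ 2) * e1 + (invSqrt (invSqrt (q (r + s • ξ)) + invSqrt (q r)) ^ 2 *
    invSqrt (q (r + s • ξ)) ^ 2) * e0 + (invSqrt (q (r + s • ξ)) - invSqrt (q r)) * e2

end InvSqrt

/-! ### Pulled-back surface operators -/

section PulledBack

open Matrix

variable {d : ℕ} {Ω : Set (Eu d)} {Γ : Compacts (Eu d)}

/-- Evaluation at a point. -/
def evalHom (h : IsSmoothBoundary Ω Γ) (x : (Γ : Set (Eu d))) : TopSmoothFun h →+* ℂ :=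
  (ContinuousMap.evalAlgHom ℂ ℂ x : C(↥(Γ : Set (Eu d)), ℂ) →+* ℂ).comp
    (topEval h : TopSmoothFun h →+* C(↥(Γ : Set (Eu d)), ℂ))

theorem topSmoothFun_ext {h : IsSmoothBoundary Ω Γ} {a b : TopSmoothFun h}
    (hab : ∀ x, evalHom h x a = evalHom h x b) : a = b :=
  topEval_injective h (ContinuousMap.ext hab)

/-- The components of the outer unit normal. -/
def normalFun (h : IsSmoothBoundary Ω Γ) (i : Fin d) : TopSmoothFun h :=
  component i (⟨_, h.isSmoothOn_outerUnitNormal⟩ : SmoothVec Γ (Eu d))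

theorem evalHom_normalFun (h : IsSmoothBoundary Ω Γ) (x : (Γ : Set (Eu d))) (i : Fin d) :
    evalHom h x (normalFun h i) = ((outerUnitNormal Ω x i : ℝ) : ℂ) := rfl

theorem outerUnitNormal_dotProduct (h : IsSmoothBoundary Ω Γ) (x : (Γ : Set (Eu d))) :
    (outerUnitNormal Ω x).ofLp ⬝ᵥ (outerUnitNormal Ω x).ofLp = 1 := by
  have := EuclideanSpace.real_norm_sq_eq (outerUnitNormal Ω (x : Eu d))
  rw [h.norm_outerUnitNormal x.2] at this
  simpa [dotProduct, sq] using this.symm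

theorem normalFun_dotProduct (h : IsSmoothBoundary Ω Γ) : normalFun h ⬝ᵥ normalFun h = 1 := by
  refine topSmoothFun_ext fun x => ?_
  have := congrArg Complex.ofReal (outerUnitNormal_dotProduct h x)
  simp only [dotProduct, Complex.ofReal_sum, Complex.ofReal_mul] at this
  simpa only [dotProduct, map_sum, map_mul, map_one, evalHom_normalFun, Complex.ofReal_one]
    using this

theorem tangentBasis_apply (x : Eu d) (l i : Fin d) : tangentBasis Ω x l i =
    (1 : Matrix (Fin d) (Fin d) ℝ) i l - outerUnitNormal Ω x i * outerUnitNormal Ω x l := by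
  simp [tangentBasis, tangentProj, Matrix.one_apply, EuclideanSpace.inner_single_right, mul_comm]

theorem sum_smul_tangentBasis (h : IsSmoothBoundary Ω Γ) (x : (Γ : Set (Eu d))) :
    ∑ l, outerUnitNormal Ω (x : Eu d) l • tangentBasis Ω (x : Eu d) l = 0 := by
  ext i
  have hn := outerUnitNormal_dotProduct h x
  simp only [dotProduct] at hn
  simp only [WithLp.ofLp_sum, WithLp.ofLp_smul, Finset.sum_apply, Pi.smul_apply, smul_eq_mul,
    tangentBasis_apply, mul_sub, Finset.sum_sub_distrib, WithLp.ofLp_zero, Pi.zero_apply]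
  have e : ∀ l, outerUnitNormal Ω (x : Eu d) l * (outerUnitNormal Ω (x : Eu d) i *
      outerUnitNormal Ω (x : Eu d) l) = outerUnitNormal Ω (x : Eu d) i *
      (outerUnitNormal Ω (x : Eu d) l * outerUnitNormal Ω (x : Eu d) l) := fun l => by ring
  simp only [e, ← Finset.mul_sum, hn]
  simp [Matrix.one_apply]

/-- The matrix of tangential derivatives of a deformation. -/
def jacobian (h : IsSmoothBoundary Ω Γ) (r : SmoothVec Γ (Eu d)) :
    Matrix (Fin d) (Fin d) (TopSmoothFun h) := Matrix.of fun i j => jacobianEntry h (j, i) r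

theorem jacobian_apply (h : IsSmoothBoundary Ω Γ) (r : SmoothVec Γ (Eu d)) (i j : Fin d) :
    jacobian h r i j = jacobianEntry h (j, i) r := rfl

/-- Weighted by the components of `n`, the projected basis vectors add up to the projection of `n`,
which is zero. -/
theorem jacobian_mulVec_normalFun (h : IsSmoothBoundary Ω Γ) (r : SmoothVec Γ (Eu d)) :
    jacobian h r *ᵥ normalFun h = 0 := by
  ext i
  refine topSmoothFun_ext fun x => ?_
  have h1 := congrArg (fderiv ℝ (smoothExt (Γ : Set (Eu d)) (component i r).1) x)
    (sum_smul_tangentBasis h x)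
  rw [map_sum, map_zero] at h1
  simp only [map_smul, Complex.real_smul] at h1
  rw [Pi.zero_apply, map_zero, ← h1]
  simp only [mulVec, dotProduct, map_sum, map_mul, evalHom_normalFun]
  exact Finset.sum_congr rfl fun l _ => mul_comm _ _

/-- The real matrix of tangential derivatives of a deformation at a point. -/
def realJacobian (Ω : Set (Eu d)) (r : SmoothVec Γ (Eu d)) (x : Eu d) :
    Matrix (Fin d) (Fin d) ℝ :=
  Matrix.of fun i j => fderiv ℝ (smoothExt (Γ : Set (Eu d)) (fun x => r x)) x
    (tangentBasis Ω x j) i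

theorem evalHom_jacobian (h : IsSmoothBoundary Ω Γ) (r : SmoothVec Γ (Eu d))
    (x : (Γ : Set (Eu d))) (i j : Fin d) :
    evalHom h x (jacobian h r i j) = ((realJacobian Ω r x i j : ℝ) : ℂ) := by
  let L : Eu d →L[ℝ] ℂ := Complex.ofRealCLM ∘L EuclideanSpace.proj i
  have hr : ContDiff ℝ ∞ (smoothExt (Γ : Set (Eu d)) (fun x => r x)) := smoothExt_contDiff _
  have e := tangentialDeriv_eq_fderiv h j (component i r) x
    (g := fun y => L (smoothExt (Γ : Set (Eu d)) (fun x => r x) y))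
    (L.contDiff.comp (hr.of_le (by exact_mod_cast le_top))).contDiffAt
    (.of_forall fun y hy => congrArg L (smoothExt_apply r.2 ⟨y, hy⟩))
  refine e.trans ?_
  have := (L.hasFDerivAt.comp (x : Eu d) (hr.differentiable (by simp) x).hasFDerivAt).fderiv
  exact DFunLike.congr_fun this (tangentBasis Ω x j)

theorem mulVec_of_clm (L : Eu d →L[ℝ] Eu d) (w : Eu d) :
    (Matrix.of fun i j => L (EuclideanSpace.single j 1) i) *ᵥ w.ofLp = (L w).ofLp := by
  have hw : w = ∑ l, w l • EuclideanSpace.single l (1 : ℝ) := by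
    simpa using ((EuclideanSpace.basisFun (Fin d) ℝ).sum_repr w).symm
  ext i
  conv_rhs => rw [hw, map_sum]
  simp [mulVec, dotProduct, mul_comm]

theorem deformationMatrix_mulVec (r : SmoothVec Γ (Eu d)) (x w : Eu d) :
    deformationMatrix r x *ᵥ w.ofLp =
      (w + fderiv ℝ (smoothExt (Γ : Set (Eu d)) (fun x => r x)) x w).ofLp := by
  rw [deformationMatrix, add_mulVec, one_mulVec, mulVec_of_clm]
  rfl

theorem deformationMatrix_eq (r : SmoothVec Γ (Eu d)) (x : Eu d) :
    deformationMatrix r x = 1 + realJacobian Ω r x +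
      vecMulVec (fderiv ℝ (smoothExt (Γ : Set (Eu d)) (fun x => r x)) x
        (outerUnitNormal Ω x)).ofLp (outerUnitNormal Ω x).ofLp := by
  ext i j
  simp [deformationMatrix, realJacobian, vecMulVec_apply, tangentBasis, tangentProj,
    EuclideanSpace.inner_single_right]
  ring

/-- The ambient `Dr` depends on the chosen extension, but differs from the tangential Jacobian by
the rank one matrix `(Dr n) nᵀ`, which the cofactor vector does not see. -/
theorem normalW_ofLp (r : SmoothVec Γ (Eu d)) (x : Eu d) :
    (normalW Ω r x).ofLp = cofNormal (outerUnitNormal Ω x).ofLp (realJacobian Ω r x) := by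
  rw [cofNormal, ← vecMul_adjugate_add_vecMulVec _ (fderiv ℝ (smoothExt (Γ : Set (Eu d))
    (fun x => r x)) x (outerUnitNormal Ω x)).ofLp, ← deformationMatrix_eq, normalW, mulVec_transpose]

theorem evalHom_cofNormal (h : IsSmoothBoundary Ω Γ) (r : SmoothVec Γ (Eu d))
    (x : (Γ : Set (Eu d))) (i : Fin d) : evalHom h x (cofNormal (normalFun h) (jacobian h r) i) =
      ((normalW Ω r x i : ℝ) : ℂ) := by
  have e1 : (evalHom h x).mapMatrix (1 + jacobian h r) =
      Complex.ofRealHom.mapMatrix (1 + realJacobian Ω r x) := by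
    ext i j
    rw [map_add, map_add, map_one, map_one, Matrix.add_apply, Matrix.add_apply]
    exact congrArg _ (evalHom_jacobian h r x i j)
  have e2 := (evalHom h x).map_adjugate (1 + jacobian h r)
  rw [e1, ← RingHom.map_adjugate] at e2
  rw [show normalW Ω r x i = (normalW Ω r x).ofLp i from rfl, normalW_ofLp]
  simp only [cofNormal, vecMul, dotProduct, map_sum, map_mul, Complex.ofReal_sum,
    Complex.ofReal_mul]
  refine Finset.sum_congr rfl fun k _ => ?_
  exact congrArg₂ (· * ·) rfl (congrFun (congrFun e2 k) i)

theorem IsDeformation.injective {r : SmoothVec Γ (Eu d)} (hr : IsDeformation r)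
    {x y : (Γ : Set (Eu d))} (hxy : (x : Eu d) + r x = y + r y) : x = y := by
  obtain ⟨s, -, hs⟩ := hr
  rw [← hs x, ← hs y]
  congr 1
  exact Subtype.ext hxy

theorem IsDeformation.exists_leftInverse {r : SmoothVec Γ (Eu d)} (hr : IsDeformation r) :
    ∃ f : Eu d → Eu d, ContDiff ℝ ∞ f ∧ ∀ x : (Γ : Set (Eu d)), f (x + r x) = x := by
  obtain ⟨s, ⟨f, hf, hfs⟩, hs⟩ := hr
  exact ⟨f, hf, fun x => (hfs ⟨_, x, rfl⟩).trans (congrArg Subtype.val (hs x))⟩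

theorem hasFDerivAt_deformation (r : SmoothVec Γ (Eu d)) (x : (Γ : Set (Eu d))) {F : Type*}
    [NormedAddCommGroup F] [NormedSpace ℝ F] {g : Eu d → F} (hg : ContDiff ℝ ∞ g) :
    HasFDerivAt (fun z => g (z + smoothExt (Γ : Set (Eu d)) (fun x => r x) z))
      ((fderiv ℝ g (x + r x)).comp (ContinuousLinearMap.id ℝ (Eu d) +
        fderiv ℝ (smoothExt (Γ : Set (Eu d)) (fun x => r x)) x)) x := by
  have h1 : HasFDerivAt g (fderiv ℝ g (x + r x))
      ((x : Eu d) + smoothExt (Γ : Set (Eu d)) (fun x => r x) x) := by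
    rw [smoothExt_apply r.2 x]
    exact (hg.differentiable (by simp) _).hasFDerivAt
  exact h1.comp (x : Eu d) ((hasFDerivAt_id (x : Eu d)).add
    ((smoothExt_contDiff _).differentiable (by simp) _).hasFDerivAt)

theorem contDiff_deformation (r : SmoothVec Γ (Eu d)) {F : Type*}
    [NormedAddCommGroup F] [NormedSpace ℝ F] {g : Eu d → F} (hg : ContDiff ℝ ∞ g) :
    ContDiff ℝ ∞ (fun z => g (z + smoothExt (Γ : Set (Eu d)) (fun x => r x) z)) :=
  hg.comp (contDiff_id.add (smoothExt_contDiff _))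

/-- A smooth left inverse `f` satisfies `f (z + r z) = z` on `Γ`. Differentiated along tangent
vectors, this makes the differential of `f` a left inverse of `1 + Dr` there, as `cofNormal_ne_zero`
requires. -/
theorem IsDeformation.normalW_ne_zero (h : IsSmoothBoundary Ω Γ) {r : SmoothVec Γ (Eu d)}
    (hr : IsDeformation r) (x : (Γ : Set (Eu d))) : (normalW Ω r x).ofLp ≠ 0 := by
  obtain ⟨f, hf, hfr⟩ := hr.exists_leftInverse
  rw [normalW, mulVec_transpose]
  refine cofNormal_ne_zero (outerUnitNormal_dotProduct h x)
    (Q := Matrix.of fun i j => fderiv ℝ f (x + r x) (EuclideanSpace.single j 1) i) fun w hw => ?_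
  have e := deformationMatrix_mulVec r x (WithLp.toLp 2 w)
  rw [show (WithLp.toLp 2 w : Eu d).ofLp = w from rfl] at e
  rw [e, mulVec_of_clm]
  have h1 := h.fderiv_eq_zero x.2 (v := WithLp.toLp 2 w)
    (f := fun z => f (z + smoothExt (Γ : Set (Eu d)) (fun x => r x) z) - z)
    (((contDiff_deformation r hf).sub contDiff_id).of_le (by exact_mod_cast le_top)).contDiffAt
    (.of_forall fun y hy => ?_) ?_
  · have h2 := ((hasFDerivAt_deformation r x hf).sub (hasFDerivAt_id (x : Eu d))).fderiv
    exact congrArg WithLp.ofLp (sub_eq_zero.1 ((DFunLike.congr_fun h2 _).symm.trans h1))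
  · change f (y + smoothExt (Γ : Set (Eu d)) (fun x => r x) y) - y = 0
    rw [smoothExt_apply r.2 ⟨y, hy⟩]
    exact sub_eq_zero.2 (hfr ⟨y, hy⟩)
  · rw [EuclideanSpace.inner_eq_star_dotProduct, dotProduct_comm]
    simpa using hw

/-- The length of the normal vector `cof(1 + Dr) n`, inverted. -/
def normalScale (h : IsSmoothBoundary Ω Γ) (r : SmoothVec Γ (Eu d)) : TopSmoothFun h :=
  invSqrt (cofNormal (normalFun h) (jacobian h r) ⬝ᵥ cofNormal (normalFun h) (jacobian h r))

/-- The normal `𝒩(r)`, with components in the topological algebra `C^∞(Γ, ℂ)`. -/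
def normalVec (h : IsSmoothBoundary Ω Γ) (r : SmoothVec Γ (Eu d)) : Fin d → TopSmoothFun h :=
  normalScale h r • cofNormal (normalFun h) (jacobian h r)

/-- The coefficients of the pulled-back tangential gradient. -/
def gradCoeff (h : IsSmoothBoundary Ω Γ) (r : SmoothVec Γ (Eu d)) :
    Matrix (Fin d) (Fin d) (TopSmoothFun h) :=
  invJacobian (normalFun h) (jacobian h r) (normalScale h r)

theorem evalHom_cofNormal_dotProduct (h : IsSmoothBoundary Ω Γ) (r : SmoothVec Γ (Eu d))
    (x : (Γ : Set (Eu d))) : evalHom h x (cofNormal (normalFun h) (jacobian h r) ⬝ᵥ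
      cofNormal (normalFun h) (jacobian h r)) = ((‖normalW Ω r x‖ ^ 2 : ℝ) : ℂ) := by
  rw [EuclideanSpace.real_norm_sq_eq]
  simp only [dotProduct, map_sum, map_mul, evalHom_cofNormal, Complex.ofReal_sum, sq,
    Complex.ofReal_mul]

theorem IsDeformation.isPosReal (h : IsSmoothBoundary Ω Γ) {r : SmoothVec Γ (Eu d)}
    (hr : IsDeformation r) : IsPosReal (cofNormal (normalFun h) (jacobian h r) ⬝ᵥ
      cofNormal (normalFun h) (jacobian h r)) := by
  refine fun x => ⟨_, ?_, evalHom_cofNormal_dotProduct h r x⟩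
  have : normalW Ω r x ≠ 0 := fun h0 => hr.normalW_ne_zero h x (by rw [h0]; rfl)
  positivity

theorem IsDeformation.normalScale_sq (h : IsSmoothBoundary Ω Γ) {r : SmoothVec Γ (Eu d)}
    (hr : IsDeformation r) : normalScale h r ^ 2 * (cofNormal (normalFun h) (jacobian h r) ⬝ᵥ
      cofNormal (normalFun h) (jacobian h r)) = 1 := (hr.isPosReal h).invSqrt.2

theorem IsDeformation.evalHom_normalVec (h : IsSmoothBoundary Ω Γ) {r : SmoothVec Γ (Eu d)}
    (hr : IsDeformation r) (x : (Γ : Set (Eu d))) (i : Fin d) :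
    evalHom h x (normalVec h r i) = ((pulledNormal Ω r x i : ℝ) : ℂ) := by
  obtain ⟨c, hc, hcx⟩ := (hr.isPosReal h).invSqrt.1 x
  have hcx' : evalHom h x (normalScale h r) = c := hcx
  have h1 := congrArg (evalHom h x) (hr.normalScale_sq h)
  rw [map_mul, map_pow, map_one, evalHom_cofNormal_dotProduct, hcx', ← Complex.ofReal_pow,
    ← Complex.ofReal_mul, ← mul_pow] at h1
  have h2 : (c * ‖normalW Ω r x‖) ^ 2 = 1 := by exact_mod_cast h1
  have h3 : c * ‖normalW Ω r x‖ = 1 :=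
    (pow_eq_one_iff_of_nonneg (by positivity) two_ne_zero).1 h2
  have h4 : c = ‖normalW Ω r x‖⁻¹ := eq_inv_of_mul_eq_one_left h3
  rw [normalVec, Pi.smul_apply, smul_eq_mul, map_mul, hcx', evalHom_cofNormal, pulledNormal, ← h4,
    ← Complex.ofReal_mul]
  rfl

theorem evalHom_tangentJacobian (h : IsSmoothBoundary Ω Γ) (r : SmoothVec Γ (Eu d))
    (x : (Γ : Set (Eu d))) (i l : Fin d) :
    evalHom h x (tangentJacobian (normalFun h) (jacobian h r) i l) =
      (((tangentBasis Ω x l + fderiv ℝ (smoothExt (Γ : Set (Eu d)) (fun x => r x)) x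
        (tangentBasis Ω x l)) i : ℝ) : ℂ) := by
  rw [tangentJacobian, Matrix.sub_apply, Matrix.add_apply, vecMulVec_apply, map_sub, map_add, map_mul,
    evalHom_normalFun, evalHom_normalFun, evalHom_jacobian, PiLp.add_apply, tangentBasis_apply,
    realJacobian, of_apply, one_apply, one_apply]
  split_ifs
  · rw [map_one]
    push_cast
    ring
  · rw [map_zero]
    push_cast
    ring

theorem fderiv_apply_eq_sum {g : Eu d → ℂ} (y w : Eu d) :
    fderiv ℝ g y w = ∑ i, fderiv ℝ g y (EuclideanSpace.single i 1) * ((w i : ℝ) : ℂ) := by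
  have hw : w = ∑ l, w l • EuclideanSpace.single l (1 : ℝ) := by
    simpa using ((EuclideanSpace.basisFun (Fin d) ℝ).sum_repr w).symm
  conv_lhs => rw [hw, map_sum]
  exact Finset.sum_congr rfl fun i _ => by rw [map_smul, Complex.real_smul, mul_comm]

/-- The tangential gradient on the deformed surface in terms of the undeformed surface. -/
theorem IsDeformation.sum_gradCoeff_mul (h : IsSmoothBoundary Ω Γ) {r : SmoothVec Γ (Eu d)}
    (hr : IsDeformation r) (u : SmoothFun Γ) {g : Eu d → ℂ} (hg : ContDiff ℝ ∞ g)
    (hgu : ∀ x : (Γ : Set (Eu d)), g (x + r x) = u.1 x) (x : (Γ : Set (Eu d))) (k : Fin d) :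
    ∑ l, evalHom h x (gradCoeff h r l k) * (tangentialDeriv h l u).1 x =
      fderiv ℝ g (x + r x) (EuclideanSpace.single k 1) -
        (∑ i, fderiv ℝ g (x + r x) (EuclideanSpace.single i 1) * (pulledNormal Ω r x i : ℂ)) *
          (pulledNormal Ω r x k : ℂ) := by
  -- Chain rule for `u = g ∘ (Id + r)`: the image of the `l`-th projected basis vector is the `l`-th
  -- column of the tangential Jacobian.
  have h1 : ∀ l, (tangentialDeriv h l u).1 x = ∑ i, fderiv ℝ g (x + r x)
      (EuclideanSpace.single i 1) *
        evalHom h x (tangentJacobian (normalFun h) (jacobian h r) i l) := by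
    intro l
    rw [tangentialDeriv_eq_fderiv h l u x
      (g := fun z => g (z + smoothExt (Γ : Set (Eu d)) (fun x => r x) z))
      ((contDiff_deformation r hg).of_le (by exact_mod_cast le_top)).contDiffAt
      (.of_forall fun y hy => ?_), (hasFDerivAt_deformation r x hg).fderiv]
    · refine (fderiv_apply_eq_sum ((x : Eu d) + r x) _).trans (Finset.sum_congr rfl fun i _ => ?_)
      rw [evalHom_tangentJacobian]
      rfl
    · rw [smoothExt_apply r.2 ⟨y, hy⟩]
      exact hgu ⟨y, hy⟩
  have h2 : ∀ i, ∑ l, evalHom h x (tangentJacobian (normalFun h) (jacobian h r) i l) *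
      evalHom h x (gradCoeff h r l k) = (1 : Matrix (Fin d) (Fin d) ℂ) i k -
        (pulledNormal Ω r x i : ℂ) * (pulledNormal Ω r x k : ℂ) := by
    intro i
    have e := congrArg (evalHom h x) (congrFun (congrFun (tangentJacobian_mul_invJacobian
      (normalFun_dotProduct h) (jacobian_mulVec_normalFun h r) (hr.normalScale_sq h)) i) k)
    rw [Matrix.sub_apply, vecMulVec_apply, map_sub, map_mul, ← normalVec, hr.evalHom_normalVec,
      hr.evalHom_normalVec, mul_apply, map_sum] at e
    simp only [map_mul] at e
    refine e.trans ?_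
    rw [one_apply, one_apply]
    split_ifs
    · rw [map_one]
    · rw [map_zero]
  simp only [h1, Finset.mul_sum]
  rw [Finset.sum_comm]
  have h3 : ∀ i, ∑ l, evalHom h x (gradCoeff h r l k) * (fderiv ℝ g (x + r x)
      (EuclideanSpace.single i 1) *
        evalHom h x (tangentJacobian (normalFun h) (jacobian h r) i l)) =
      fderiv ℝ g (x + r x) (EuclideanSpace.single i 1) * (1 : Matrix (Fin d) (Fin d) ℂ) i k -
        fderiv ℝ g (x + r x) (EuclideanSpace.single i 1) * (pulledNormal Ω r x i : ℂ) *
          (pulledNormal Ω r x k : ℂ) := by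
    intro i
    rw [mul_assoc _ (pulledNormal Ω r x i : ℂ), ← mul_sub, ← h2, Finset.mul_sum]
    exact Finset.sum_congr rfl fun l _ => by ring
  simp only [h3, Finset.sum_sub_distrib, ← Finset.sum_mul]
  congr 1
  simp [one_apply]

theorem IsDeformation.tauInv_apply {r : SmoothVec Γ (Eu d)} (hr : IsDeformation r) {A : Type*}
    (u : ↥(Γ : Set (Eu d)) → A) (x : (Γ : Set (Eu d))) (hx : (x : Eu d) + r x ∈ deformed r) :
    tauInv r u ⟨x + r x, hx⟩ = u x :=
  congrArg u (hr.injective hx.choose_spec)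

theorem IsDeformation.isSmoothOn_tauInv {r : SmoothVec Γ (Eu d)} (hr : IsDeformation r)
    {F : Type*} [NormedAddCommGroup F] [NormedSpace ℝ F] {u : ↥(Γ : Set (Eu d)) → F}
    (hu : IsSmoothOn (Γ : Set (Eu d)) u) : IsSmoothOn (deformed r) (tauInv r u) := by
  obtain ⟨f, hf, hfr⟩ := hr.exists_leftInverse
  obtain ⟨g, hg, hgu⟩ := hu
  refine ⟨fun y => g (f y), hg.comp hf, fun y => ?_⟩
  obtain ⟨_, x, rfl⟩ := y
  change g (f (x + r x)) = _
  rw [hfr, hgu]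
  exact (hr.tauInv_apply u x _).symm

theorem IsDeformation.smoothExt_tauInv {r : SmoothVec Γ (Eu d)} (hr : IsDeformation r)
    {F : Type*} [NormedAddCommGroup F] [NormedSpace ℝ F] {u : ↥(Γ : Set (Eu d)) → F}
    (hu : IsSmoothOn (Γ : Set (Eu d)) u) (x : (Γ : Set (Eu d))) :
    smoothExt (deformed r) (tauInv r u) (x + r x) = u x := by
  rw [← hr.tauInv_apply u x ⟨x, rfl⟩]
  exact smoothExt_apply (hr.isSmoothOn_tauInv hu) ⟨x + r x, x, rfl⟩

theorem IsDeformation.pulledGrad_eq (h : IsSmoothBoundary Ω Γ) {r : SmoothVec Γ (Eu d)}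
    (hr : IsDeformation r) (u : SmoothFun Γ) (x : (Γ : Set (Eu d))) (k : Fin d) :
    pulledGrad Ω r u.1 x k =
      ∑ l, evalHom h x (gradCoeff h r l k) * (tangentialDeriv h l u).1 x := by
  rw [hr.sum_gradCoeff_mul h u (smoothExt_contDiff _) (hr.smoothExt_tauInv u.2)]
  exact congrArg (fun ν : Eu d => fderiv ℝ (smoothExt (deformed r) (tauInv r u.1)) (x + r x)
    (EuclideanSpace.single k 1) - (∑ l, fderiv ℝ (smoothExt (deformed r) (tauInv r u.1)) (x + r x)
      (EuclideanSpace.single l 1) * ((ν l : ℝ) : ℂ)) * ((ν k : ℝ) : ℂ))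
    (hr.tauInv_apply (pulledNormal Ω r) x ⟨x, rfl⟩)

/-- The surface divergence is the sum over `k` of the `k`-th component of the tangential gradient of
`u_k`, so the scalar formula applies to each component. -/
theorem IsDeformation.pulledDiv_eq (h : IsSmoothBoundary Ω Γ) {r : SmoothVec Γ (Eu d)}
    (hr : IsDeformation r) (u : Fin d → SmoothFun Γ) (x : (Γ : Set (Eu d))) :
    pulledDiv Ω r (fun x i => (u i).1 x) x =
      ∑ k, ∑ l, evalHom h x (gradCoeff h r l k) * (tangentialDeriv h l (u k)).1 x := by
  have hu : IsSmoothOn (Γ : Set (Eu d)) (fun x i => (u i).1 x) := by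
    choose g hg hgu using fun i => (u i).2
    exact ⟨fun y i => g i y, contDiff_pi.2 hg, fun y => funext fun i => hgu i y⟩
  set G := smoothExt (deformed r) (tauInv r fun x i => (u i).1 x) with hG
  have hGs : ContDiff ℝ ∞ G := smoothExt_contDiff _
  have hGk : ∀ k (y w : Eu d), fderiv ℝ (fun z => G z k) y w = fderiv ℝ G y w k := by
    intro k y w
    have h1 := hasFDerivAt_pi'.1 (hGs.differentiable (by simp) y).hasFDerivAt k
    rw [h1.fderiv]
    rfl
  have e : ∀ k, _ := fun k => hr.sum_gradCoeff_mul h (u k) (g := fun z => G z k)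
    (contDiff_pi.1 hGs k) (fun y => congrFun (hr.smoothExt_tauInv hu y) k) x k
  have e' : pulledDiv Ω r (fun x i => (u i).1 x) x =
      ∑ i, fderiv ℝ G (x + r x) (EuclideanSpace.single i 1) i - ∑ i, (pulledNormal Ω r x i : ℂ) *
        fderiv ℝ G (x + r x) (pulledNormal Ω r x) i :=
    congrArg (fun ν : Eu d => ∑ i, fderiv ℝ G (x + r x) (EuclideanSpace.single i 1) i -
      ∑ i, ((ν i : ℝ) : ℂ) * fderiv ℝ G (x + r x) ν i)
      (hr.tauInv_apply (pulledNormal Ω r) x ⟨x, rfl⟩)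
  simp only [e, e', Finset.sum_sub_distrib, hGk]
  congr 1
  refine Finset.sum_congr rfl fun k _ => ?_
  rw [← hGk, fderiv_apply_eq_sum, mul_comm]
  simp only [hGk]

end PulledBack

/-! ### Semiderivatives of the normal and of the coefficients -/

section SemiderivHelpers

set_option linter.unusedSectionVars false

variable {X E : Type*} [AddCommGroup X] [Module ℝ X] [TopologicalSpace X]
  [CommRing E] [Algebra ℝ E] [TopologicalSpace E] [IsTopologicalRing E]

theorem HasGateauxSemideriv.sum_mul {ι : Type*} [Fintype ι] {f g : ι → X → E} {a b : ι → E}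
    {r ξ : X} (hf : ∀ i, HasGateauxSemideriv (f i) r ξ (a i))
    (hg : ∀ i, HasGateauxSemideriv (g i) r ξ (b i))
    (hc : ∀ i, Tendsto (fun s : ℝ => g i (r + s • ξ)) (𝓝[≠] 0) (𝓝 (g i r))) :
    HasGateauxSemideriv (fun r => ∑ i, f i r * g i r) r ξ (∑ i, (a i * g i r + f i r * b i)) :=
  HasGateauxSemideriv.sum fun i => (hf i).mul (hg i) (hc i)

/-- Turns algebraic identities valid on `U` into linear equations for the unknown semiderivatives.
-/
theorem HasGateauxSemideriv.eq_zero_of_eqOn_const [T2Space E] {U : Set X} {f : X → E} {r ξ : X}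
    {a c : E} (hf : HasGateauxSemideriv f r ξ a) (hU : ∀ᶠ s : ℝ in 𝓝 0, r + s • ξ ∈ U)
    (hr : r ∈ U) (hc : ∀ r ∈ U, f r = c) : a = 0 := by
  refine tendsto_nhds_unique hf ?_
  refine tendsto_const_nhds.congr' ?_
  filter_upwards [nhdsWithin_le_nhds hU] with s hs
  rw [hc _ hs, hc r hr, sub_self, smul_zero]

end SemiderivHelpers

/-- Displays the derivative of `M` as a linear form in the entries of `J` with coefficients
polynomial in `M` and `N`. The pair `p` goes with `J p.2 p.1` because `jacobianEntry` takes the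
direction of differentiation first. -/
theorem sum_prod_gradCoeff_deriv {n R : Type*} [Fintype n] [CommRing R] (M J : Matrix n n R)
    (N : n → R) (k i : n) : (-(M * (J * M)) + Matrix.vecMulVec (M *ᵥ (N ᵥ* (J * M))) N) k i =
      ∑ p : n × n, (-(M k p.2 * M p.1 i) + (∑ c, M k c * M p.1 c) * (N p.2 * N i)) * J p.2 p.1 := by
  have h1 : (M * (J * M)) k i = ∑ a, ∑ b, M k a * M b i * J a b := by
    simp only [Matrix.mul_apply, Finset.mul_sum]
    exact Finset.sum_congr rfl fun a _ => Finset.sum_congr rfl fun b _ => by ring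
  have h2 : (M *ᵥ (N ᵥ* (J * M))) k = ∑ a, ∑ b, (∑ c, M k c * M b c) * (N a * J a b) := by
    simp only [Matrix.mulVec, Matrix.vecMul, dotProduct, Matrix.mul_apply, Finset.mul_sum,
      Finset.sum_mul]
    rw [Finset.sum_comm]
    refine Finset.sum_congr rfl fun a _ => ?_
    rw [Finset.sum_comm]
    exact Finset.sum_congr rfl fun b _ => Finset.sum_congr rfl fun c _ => by ring
  rw [Matrix.add_apply, Matrix.neg_apply, Matrix.vecMulVec_apply, h1, h2,
    Fintype.sum_prod_type_right, Finset.sum_mul, ← Finset.sum_neg_distrib,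
    ← Finset.sum_add_distrib]
  refine Finset.sum_congr rfl fun a _ => ?_
  rw [Finset.sum_mul, ← Finset.sum_neg_distrib, ← Finset.sum_add_distrib]
  exact Finset.sum_congr rfl fun b _ => by ring

section Coefficients

open Matrix

variable {d : ℕ} {Ω : Set (Eu d)} {Γ : Compacts (Eu d)} {h : IsSmoothBoundary Ω Γ}
  {U : Set (SmoothVec Γ (Eu d))}

theorem hasGateauxSemideriv_jacobian (h : IsSmoothBoundary Ω Γ) (r ξ : SmoothVec Γ (Eu d))
    (i j : Fin d) : HasGateauxSemideriv (fun r => jacobian h r i j) r ξ (jacobian h ξ i j) := by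
  refine tendsto_const_nhds.congr' ?_
  filter_upwards [self_mem_nhdsWithin] with s hs
  have hs0 : s ≠ 0 := hs
  simp only [jacobian_apply]
  rw [map_add, map_smul, add_sub_cancel_left, smul_smul, inv_mul_cancel₀ hs0, one_smul]

theorem continuous_jacobian (h : IsSmoothBoundary Ω Γ) (i j : Fin d) :
    Continuous fun r => jacobian h r i j := (jacobianEntry h (j, i)).continuous

theorem jacobian_mem_gateauxSubalgebra (h : IsSmoothBoundary Ω Γ) (i j : Fin d) :
    (fun r => jacobian h r i j) ∈ gateauxSubalgebra (E := TopSmoothFun h) U := by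
  refine ⟨(continuous_jacobian h i j).continuousOn, fun r _ ξ =>
    ⟨?_, _, hasGateauxSemideriv_jacobian h r ξ i j⟩⟩
  have : Continuous fun s : ℝ => r + s • ξ :=
    continuous_const.add (continuous_id.smul continuous_const)
  have h1 := ((continuous_jacobian h i j).comp this).tendsto 0
  simp only [Function.comp_apply, zero_smul, add_zero] at h1
  exact h1.mono_left nhdsWithin_le_nhds

theorem normalScale_mem_gateauxSubalgebra
    (hU : ∀ r ∈ U, ∀ ξ, ∀ᶠ s : ℝ in 𝓝 0, r + s • ξ ∈ U) (hdef : ∀ r ∈ U, IsDeformation r) :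
    (fun r => normalScale h r) ∈ gateauxSubalgebra (E := TopSmoothFun h) U := by
  refine invSqrt_mem_gateauxSubalgebra hU (sum_mem_subalgebra _ fun i => ?_)
    fun r hr => (hdef r hr).isPosReal h
  exact mul_mem (cofNormal_mem_subalgebra _ _ (jacobian_mem_gateauxSubalgebra h) i)
    (cofNormal_mem_subalgebra _ _ (jacobian_mem_gateauxSubalgebra h) i)

theorem normalVec_mem_gateauxSubalgebra
    (hU : ∀ r ∈ U, ∀ ξ, ∀ᶠ s : ℝ in 𝓝 0, r + s • ξ ∈ U) (hdef : ∀ r ∈ U, IsDeformation r) (i : Fin d) :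
    (fun r => normalVec h r i) ∈ gateauxSubalgebra (E := TopSmoothFun h) U :=
  mul_mem (normalScale_mem_gateauxSubalgebra hU hdef)
    (cofNormal_mem_subalgebra _ _ (jacobian_mem_gateauxSubalgebra h) i)

theorem gradCoeff_mem_gateauxSubalgebra
    (hU : ∀ r ∈ U, ∀ ξ, ∀ᶠ s : ℝ in 𝓝 0, r + s • ξ ∈ U) (hdef : ∀ r ∈ U, IsDeformation r) (i j : Fin d) :
    (fun r => gradCoeff h r i j) ∈ gateauxSubalgebra (E := TopSmoothFun h) U :=
  invJacobian_mem_subalgebra _ _ (jacobian_mem_gateauxSubalgebra h)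
    (normalScale_mem_gateauxSubalgebra hU hdef) i j

theorem tangentJacobian_mem_gateauxSubalgebra (h : IsSmoothBoundary Ω Γ) (i j : Fin d) :
    (fun r => tangentJacobian (normalFun h) (jacobian h r) i j) ∈
      gateauxSubalgebra (E := TopSmoothFun h) U :=
  sub_mem (add_mem (const_mem_subalgebra _ ((1 : Matrix (Fin d) (Fin d) (TopSmoothFun h)) i j))
    (jacobian_mem_gateauxSubalgebra h i j))
    (const_mem_subalgebra _ (vecMulVec (normalFun h) (normalFun h) i j))

theorem hasGateauxSemideriv_tangentJacobian (h : IsSmoothBoundary Ω Γ) (r ξ : SmoothVec Γ (Eu d)) (i j : Fin d) :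
    HasGateauxSemideriv (fun r => tangentJacobian (normalFun h) (jacobian h r) i j) r ξ
      (jacobian h ξ i j) := by
  refine (hasGateauxSemideriv_jacobian h r ξ i j).congr' (.of_forall fun s => ?_)
  simp only [tangentJacobian, Matrix.sub_apply, Matrix.add_apply]
  congr 1
  ring

/-- Existence comes from `gateauxSubalgebra`. Differentiating `N · N = 1` and the orthogonality of
`N` to the columns of the tangential Jacobian determines the product of the derivative with the full
Jacobian, which is invertible. -/
theorem hasGateauxSemideriv_normalVec
    (hU : ∀ r ∈ U, ∀ ξ, ∀ᶠ s : ℝ in 𝓝 0, r + s • ξ ∈ U) (hdef : ∀ r ∈ U, IsDeformation r)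
    {r : SmoothVec Γ (Eu d)} (hr : r ∈ U)
    (ξ : SmoothVec Γ (Eu d)) (i : Fin d) : HasGateauxSemideriv (fun r => normalVec h r i) r ξ
      (-(normalVec h r ᵥ* (jacobian h ξ * gradCoeff h r)) i) := by
  have hv := normalFun_dotProduct h
  have hJ := jacobian_mulVec_normalFun h
  choose hNc D hD using fun i => (normalVec_mem_gateauxSubalgebra (h := h) hU hdef i).2 r hr ξ
  have e1 : D ⬝ᵥ normalVec h r = 0 := by
    have h1 := (HasGateauxSemideriv.sum_mul hD hD hNc).eq_zero_of_eqOn_const (hU r hr ξ) hr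
      (c := 1) fun r hr => normal_dotProduct_normal ((hdef r hr).normalScale_sq h)
    have h2 : (2 : ℝ) • (D ⬝ᵥ normalVec h r) = 0 := by
      rw [two_smul, ← h1, dotProduct, ← Finset.sum_add_distrib]
      exact Finset.sum_congr rfl fun i _ => by ring
    exact (smul_eq_zero_iff_right two_ne_zero).1 h2
  have e2 : D ᵥ* tangentJacobian (normalFun h) (jacobian h r) + normalVec h r ᵥ* jacobian h ξ =
      0 := by
    ext j
    have h1 := (HasGateauxSemideriv.sum_mul hD
      (fun i => hasGateauxSemideriv_tangentJacobian h r ξ i j)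
      fun i => ((tangentJacobian_mem_gateauxSubalgebra h i j).2 r hr ξ).1).eq_zero_of_eqOn_const (hU r hr ξ) hr
      (c := 0) fun r hr => congrFun (normal_vecMul_tangentJacobian hv (hJ r) _) j
    rw [Finset.sum_add_distrib] at h1
    exact h1
  have e3 : D ᵥ* fullJacobian (normalFun h) (jacobian h r) (normalVec h r) =
      -(normalVec h r ᵥ* jacobian h ξ) := by
    rw [fullJacobian_eq, vecMul_add, vecMul_vecMulVec, e1, zero_smul, add_zero]
    exact eq_neg_of_add_eq_zero_left e2
  have e4 : D = -(normalVec h r ᵥ* (jacobian h ξ * gradCoeff h r)) := by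
    have h1 := congrArg (· ᵥ* gradCoeff h r) e3
    simp only [vecMul_vecMul, neg_vecMul] at h1
    rwa [normalVec, gradCoeff, mul_invJacobian hv (hJ r) ((hdef r hr).normalScale_sq h),
      vecMul_one] at h1
  rw [← Pi.neg_apply, ← e4]
  exact hD i

/-- From `T M = 1` follows `dM = -M dT M` with `dT = J_ξ + dN nᵀ`, and `nᵀ M = Nᵀ` turns the second
term into a rank one matrix. -/
theorem hasGateauxSemideriv_gradCoeff
    (hU : ∀ r ∈ U, ∀ ξ, ∀ᶠ s : ℝ in 𝓝 0, r + s • ξ ∈ U) (hdef : ∀ r ∈ U, IsDeformation r)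
    {r : SmoothVec Γ (Eu d)} (hr : r ∈ U) (ξ : SmoothVec Γ (Eu d)) (k i : Fin d) :
    HasGateauxSemideriv (fun r => gradCoeff h r k i) r ξ
      ((-(gradCoeff h r * (jacobian h ξ * gradCoeff h r)) + vecMulVec (gradCoeff h r *ᵥ
        (normalVec h r ᵥ* (jacobian h ξ * gradCoeff h r))) (normalVec h r)) k i) := by
  have hv := normalFun_dotProduct h
  have hJ := jacobian_mulVec_normalFun h
  have ha := (hdef r hr).normalScale_sq h
  choose hCc C hC using fun k i => (gradCoeff_mem_gateauxSubalgebra (h := h) hU hdef k i).2 r hr ξ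
  set D : Fin d → TopSmoothFun h := -(normalVec h r ᵥ* (jacobian h ξ * gradCoeff h r)) with hD
  have hT : ∀ i j, HasGateauxSemideriv
      (fun r => fullJacobian (normalFun h) (jacobian h r) (normalVec h r) i j) r ξ
      ((jacobian h ξ + vecMulVec D (normalFun h)) i j) := by
    intro i j
    have h1 := (hasGateauxSemideriv_normalVec (h := h) hU hdef hr ξ i).mul
      (g := fun _ => normalFun h j) (b := 0)
      ((tendsto_const_nhds (x := (0 : TopSmoothFun h))).congr fun s => by simp) tendsto_const_nhds
    have h2 := (hasGateauxSemideriv_tangentJacobian h r ξ i j).add h1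
    rw [mul_zero, add_zero] at h2
    refine Tendsto.congr (fun s => ?_) h2
    simp only [fullJacobian_eq]
    rfl
  have e1 : (jacobian h ξ + vecMulVec D (normalFun h)) * gradCoeff h r +
      fullJacobian (normalFun h) (jacobian h r) (normalVec h r) * Matrix.of C = 0 := by
    ext i k
    have h1 := (HasGateauxSemideriv.sum_mul (hT i) (fun j => hC j k)
      fun j => hCc j k).eq_zero_of_eqOn_const (hU r hr ξ) hr
      (c := (1 : Matrix (Fin d) (Fin d) (TopSmoothFun h)) i k) fun r hr =>
        congrFun (congrFun (mul_invJacobian hv (hJ r) ((hdef r hr).normalScale_sq h)) i) k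
    rw [Finset.sum_add_distrib] at h1
    exact h1
  have e2 := congrArg (gradCoeff h r * ·) e1
  simp only [mul_add, ← mul_assoc, mul_zero] at e2
  rw [show gradCoeff h r * fullJacobian (normalFun h) (jacobian h r) (normalVec h r) = 1 from
    invJacobian_mul hv (hJ r) ha, one_mul, add_mul, mul_vecMulVec, vecMulVec_mul,
    show normalFun h ᵥ* gradCoeff h r = normalVec h r from vecMul_invJacobian hv (hJ r) ha] at e2
  have e3 : Matrix.of C = -(gradCoeff h r * (jacobian h ξ * gradCoeff h r)) +
      vecMulVec (gradCoeff h r *ᵥ (normalVec h r ᵥ* (jacobian h ξ * gradCoeff h r)))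
        (normalVec h r) := by
    rw [eq_neg_of_add_eq_zero_right e2, hD, mulVec_neg, neg_vecMulVec, neg_add, neg_neg, mul_assoc]
  rw [← e3]
  exact hC k i

/-- The normal and the coefficients of the pulled-back gradient. -/
def coefficientMaps (h : IsSmoothBoundary Ω Γ) : Set (SmoothVec Γ (Eu d) → TopSmoothFun h) :=
  range (fun (i : Fin d) r => normalVec h r i) ∪
    range (fun (p : Fin d × Fin d) r => gradCoeff h r p.1 p.2)

/-- The closure property behind smoothness of all orders: the coefficients of `J_ξ` in `dN` and `dM`
are polynomials in the entries of `N` and `M`. -/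
theorem isDifferentialModule_coefficientMaps (h : IsSmoothBoundary Ω Γ)
    (hU : ∀ r ∈ U, ∀ ξ, ∀ᶠ s : ℝ in 𝓝 0, r + s • ξ ∈ U) (hdef : ∀ r ∈ U, IsDeformation r) :
    IsDifferentialModule U (jacobianEntry h)
      (Subalgebra.toSubmodule (Algebra.adjoin (TopSmoothFun h) (coefficientMaps h))) := by
  have hmem : ∀ f ∈ coefficientMaps h, f ∈ gateauxSubalgebra (E := TopSmoothFun h) U := by
    rintro _ (⟨i, rfl⟩ | ⟨p, rfl⟩)
    · exact normalVec_mem_gateauxSubalgebra hU hdef i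
    · exact gradCoeff_mem_gateauxSubalgebra hU hdef p.1 p.2
  have hN : ∀ i, (fun r => normalVec h r i) ∈
      Algebra.adjoin (TopSmoothFun h) (coefficientMaps h) := fun i =>
    Algebra.subset_adjoin (Or.inl ⟨i, rfl⟩)
  have hM : ∀ k i, (fun r => gradCoeff h r k i) ∈
      Algebra.adjoin (TopSmoothFun h) (coefficientMaps h) := fun k i =>
    Algebra.subset_adjoin (Or.inr ⟨(k, i), rfl⟩)
  refine isDifferentialModule_adjoin hU (fun f hf => (hmem f hf).1)
    (fun f hf r hr ξ => ((hmem f hf).2 r hr ξ).1) ?_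
  rintro _ (⟨i, rfl⟩ | ⟨⟨k, i⟩, rfl⟩)
  · refine ⟨fun p r => -(normalVec h r p.2 * gradCoeff h r p.1 i),
      fun p => neg_mem (mul_mem (hN p.2) (hM p.1 i)), fun r hr ξ => ?_⟩
    refine (hasGateauxSemideriv_normalVec hU hdef hr ξ i).trans_eq ?_
    congr 1
    rw [Fintype.sum_prod_type_right]
    simp only [vecMul, dotProduct, mul_apply, Finset.mul_sum, neg_mul, Finset.sum_neg_distrib,
      jacobian_apply]
    congr 1
    exact Finset.sum_congr rfl fun a _ => Finset.sum_congr rfl fun b _ => by ring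
  · refine ⟨fun p r => -(gradCoeff h r k p.2 * gradCoeff h r p.1 i) +
      (∑ c, gradCoeff h r k c * gradCoeff h r p.1 c) * (normalVec h r p.2 * normalVec h r i),
      fun p => add_mem (neg_mem (mul_mem (hM k p.2) (hM p.1 i)))
        (mul_mem (sum_mem_subalgebra _ fun c => mul_mem (hM k c) (hM p.1 c))
          (mul_mem (hN p.2) (hN i))), fun r hr ξ => ?_⟩
    refine (hasGateauxSemideriv_gradCoeff hU hdef hr ξ k i).trans_eq ?_
    congr 1
    exact sum_prod_gradCoeff_deriv _ _ _ k i

end Coefficients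

/-! ### The operators on Sobolev spaces -/

section Operators

open Matrix

variable {d : ℕ} {Ω : Set (Eu d)} {Γ : Compacts (Eu d)}

theorem toSobolev_sum (t : ℝ) {ι : Type*} (s : Finset ι) (f : ι → SmoothFun Γ) :
    toSobolev t (∑ i ∈ s, f i) = ∑ i ∈ s, toSobolev t (f i) :=
  map_sum ({ toFun := toSobolev t
             map_zero' := UniformSpace.Completion.coe_zero (α := PreSobolev Γ t)
             map_add' := fun u v => UniformSpace.Completion.coe_add (α := PreSobolev Γ t) u v } :
    SmoothFun Γ →+ Sobolev Γ t) f s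

theorem sum_mul_smoothFun_apply {ι : Type*} [Fintype ι] (a b : ι → SmoothFun Γ)
    (x : (Γ : Set (Eu d))) : (∑ i, a i * b i).1 x = ∑ i, (a i).1 x * (b i).1 x :=
  map_sum ((Pi.evalRingHom (fun _ => ℂ) x).comp ((smoothAlg Γ).val : SmoothFun Γ →+* _))
    (fun i => a i * b i) Finset.univ

theorem sobolevMul_one (t : ℝ) (x : Sobolev Γ t) : sobolevMul t (1 : SmoothFun Γ) x = x := by
  refine UniformSpace.Completion.induction_on x (isClosed_eq
    (sobolevMul t (1 : SmoothFun Γ)).continuous continuous_id) fun u => ?_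
  exact (sobolevMul_toSobolev t 1 u).trans (congrArg (toSobolev t) (one_mul _))

/-- `H^t(Γ)` as a module over the smooth functions. -/
abbrev sobolevModule (h : IsSmoothBoundary Ω Γ) (t : ℝ) :
    Module (TopSmoothFun h) (Sobolev Γ t) where
  smul a x := sobolevMul t a x
  one_smul x := sobolevMul_one t x
  mul_smul a b x := sobolevMul_mul t a b x
  smul_zero a := map_zero (sobolevMul t a)
  smul_add a x y := map_add (sobolevMul t a) x y
  add_smul a b x := DFunLike.congr_fun (sobolevMul_add t a b) x
  zero_smul x := DFunLike.congr_fun (map_zero (sobolevMulₗ h t)) x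

/-- Pure algebra, used with `Y = J_ξ M` and `w l j = ∂_l u_j`; then `Yᵀ = [𝒢(r) ξ]`, and `∑ l, M l k
• w l j` is the entry `(k, j)` of `[𝒢(r) u]`. -/
theorem sum_prod_smul_eq_divDerivFormula {n R V : Type*} [Fintype n] [CommRing R] [AddCommGroup V]
    [Module R V] (M Y : Matrix n n R) (N : n → R) (w : n → n → V) :
    ∑ p : n × n, (-(M * Y) + vecMulVec (M *ᵥ (N ᵥ* Y)) N) p.1 p.2 • w p.1 p.2 =
      -(∑ j, ∑ k, Yᵀ j k • ∑ l, M l k • w l j) +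
        ∑ k, (Yᵀ *ᵥ N) k • ∑ i, N i • ∑ l, M l k • w l i := by
  rw [mulVec_transpose, Fintype.sum_prod_type_right]
  simp only [Matrix.add_apply, Matrix.neg_apply, vecMulVec_apply, add_smul, neg_smul,
    Finset.sum_add_distrib, Finset.sum_neg_distrib]
  congr 1
  · congr 1
    refine Finset.sum_congr rfl fun i _ => ?_
    simp only [Matrix.mul_apply, Finset.sum_smul, Finset.smul_sum, smul_smul, transpose_apply]
    rw [Finset.sum_comm]
    exact Finset.sum_congr rfl fun a _ => Finset.sum_congr rfl fun l _ => by rw [mul_comm]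
  · have e : ∀ l i, ((M *ᵥ (N ᵥ* Y)) l * N i) • w l i =
        ∑ k, ((N ᵥ* Y) k * (N i * M l k)) • w l i := by
      intro l i
      rw [mulVec, dotProduct, Finset.sum_mul, Finset.sum_smul]
      exact Finset.sum_congr rfl fun k _ => by congr 1; ring
    simp only [e, Finset.smul_sum, smul_smul]
    rw [Finset.sum_comm (s := Finset.univ (α := n)) (f := fun k i =>
      ∑ l, ((N ᵥ* Y) k * (N i * M l k)) • w l i)]
    exact Finset.sum_congr rfl fun i _ => Finset.sum_comm

/-- The coefficients `a` act as the operator `u ↦ (∑ l, a l k ∂_l u)_k`. -/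
def gradOperator (h : IsSmoothBoundary Ω Γ) (t : ℝ) (a : Matrix (Fin d) (Fin d) (TopSmoothFun h)) :
    Sobolev Γ (t + 1) →L[ℂ] (Fin d → Sobolev Γ t) :=
  ContinuousLinearMap.pi fun k => ∑ l, sobolevMulₗ h t (a l k) ∘L sobolevTangentialDeriv h t l

theorem gradOperator_apply (h : IsSmoothBoundary Ω Γ) (t : ℝ)
    (a : Matrix (Fin d) (Fin d) (TopSmoothFun h)) (u : Sobolev Γ (t + 1)) (k : Fin d) :
    gradOperator h t a u k = ∑ l, sobolevMul t (a l k) (sobolevTangentialDeriv h t l u) := by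
  exact _root_.sum_apply Finset.univ
    (fun l => sobolevMulₗ h t (a l k) ∘L sobolevTangentialDeriv h t l) u

/-- The coefficients `a` act as the operator `u ↦ ∑ k, ∑ l, a l k ∂_l u_k`. -/
def divOperator (h : IsSmoothBoundary Ω Γ) (t : ℝ) (a : Matrix (Fin d) (Fin d) (TopSmoothFun h)) :
    (Fin d → Sobolev Γ (t + 1)) →L[ℂ] Sobolev Γ t :=
  ∑ p : Fin d × Fin d, mulDerivProj h t p (a p.1 p.2)

theorem divOperator_apply (h : IsSmoothBoundary Ω Γ) (t : ℝ)
    (a : Matrix (Fin d) (Fin d) (TopSmoothFun h)) (u : Fin d → Sobolev Γ (t + 1)) :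
    divOperator h t a u =
      ∑ p : Fin d × Fin d, sobolevMul t (a p.1 p.2) (sobolevTangentialDeriv h t p.1 (u p.2)) := by
  rw [divOperator, _root_.sum_apply]
  rfl

theorem IsDeformation.isPulledGrad (h : IsSmoothBoundary Ω Γ) (t : ℝ) {r : SmoothVec Γ (Eu d)}
    (hr : IsDeformation r) : IsPulledGrad Ω t r (gradOperator h t (gradCoeff h r)) := by
  intro u
  refine ⟨fun k => ∑ l, (show SmoothFun Γ from gradCoeff h r l k) * tangentialDeriv h l u,
    fun x k => ?_, funext fun k => ?_⟩
  · exact (sum_mul_smoothFun_apply _ _ x).trans (hr.pulledGrad_eq h u x k).symm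
  · rw [gradOperator_apply, toSobolev_sum]
    refine Finset.sum_congr rfl fun l _ => ?_
    rw [sobolevTangentialDeriv_toSobolev]
    exact sobolevMul_toSobolev t _ _

theorem IsDeformation.isPulledDiv (h : IsSmoothBoundary Ω Γ) (t : ℝ) {r : SmoothVec Γ (Eu d)}
    (hr : IsDeformation r) : IsPulledDiv Ω t r (divOperator h t (gradCoeff h r)) := by
  intro u
  refine ⟨∑ p : Fin d × Fin d, (show SmoothFun Γ from gradCoeff h r p.1 p.2) *
    tangentialDeriv h p.1 (u p.2), fun x => ?_, ?_⟩
  · refine (sum_mul_smoothFun_apply _ _ x).trans ?_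
    rw [hr.pulledDiv_eq h u x, Fintype.sum_prod_type_right]
    rfl
  · rw [divOperator_apply, toSobolev_sum]
    refine Finset.sum_congr rfl fun p _ => ?_
    rw [sobolevTangentialDeriv_toSobolev]
    exact sobolevMul_toSobolev t _ _

variable {U : Set (SmoothVec Γ (Eu d))}

theorem isCInftyGateaux_divOperator (h : IsSmoothBoundary Ω Γ) (t : ℝ)
    (hU : ∀ r ∈ U, ∀ ξ, ∀ᶠ s : ℝ in 𝓝 0, r + s • ξ ∈ U) (hdef : ∀ r ∈ U, IsDeformation r) :
    IsCInftyGateaux U fun r => divOperator h t (gradCoeff h r) :=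
  IsCombination.isCInftyGateaux (isDifferentialModule_coefficientMaps h hU hdef)
    (Λ := mulDerivProj h t) ⟨fun p r => gradCoeff h r p.1 p.2, fun p =>
      Algebra.subset_adjoin (Or.inr ⟨p, rfl⟩), fun _ _ => rfl⟩

theorem gateauxDeriv_divOperator (h : IsSmoothBoundary Ω Γ) (t : ℝ)
    (hU : ∀ r ∈ U, ∀ ξ, ∀ᶠ s : ℝ in 𝓝 0, r + s • ξ ∈ U) (hdef : ∀ r ∈ U, IsDeformation r)
    {r : SmoothVec Γ (Eu d)} (hr : r ∈ U) (ξ : SmoothVec Γ (Eu d))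
    (u : Fin d → Sobolev Γ (t + 1)) :
    gateauxDeriv (fun r => divOperator h t (gradCoeff h r)) r ξ u =
      divDerivFormula t (jacobian h ξ * gradCoeff h r)ᵀ (normalVec h r)
        (fun k i => gradOperator h t (gradCoeff h r) (u i) k) := by
  have h1 := hasGateauxSemideriv_sum (Λ := mulDerivProj h t) (hU r hr ξ) hr
    (g := fun r => divOperator h t (gradCoeff h r)) (fun _ _ => rfl)
    fun p => hasGateauxSemideriv_gradCoeff hU hdef hr ξ p.1 p.2
  rw [h1.gateauxDeriv_eq]
  refine (divOperator_apply h t _ u).trans ?_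
  simp only [divDerivFormula, gradOperator_apply]
  let _ := sobolevModule h t
  exact sum_prod_smul_eq_divDerivFormula (gradCoeff h r) (jacobian h ξ * gradCoeff h r)
    (normalVec h r) fun l i => sobolevTangentialDeriv h t l (u i)

theorem IsDeformation.isPulledGradMatrix (h : IsSmoothBoundary Ω Γ) {r : SmoothVec Γ (Eu d)}
    (hr : IsDeformation r) (ξ : SmoothVec Γ (Eu d)) :
    IsPulledGradMatrix Ω r ξ (jacobian h ξ * gradCoeff h r)ᵀ := by
  intro x k i
  refine Eq.trans ?_ (hr.pulledGrad_eq h (component i ξ) x k).symm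
  refine (sum_mul_smoothFun_apply (fun l => jacobian h ξ i l) (fun l => gradCoeff h r l k) x).trans
    (Finset.sum_congr rfl fun l _ => mul_comm _ _)

theorem IsDeformation.isPulledNormal (h : IsSmoothBoundary Ω Γ) {r : SmoothVec Γ (Eu d)}
    (hr : IsDeformation r) : IsPulledNormal Ω r (normalVec h r) :=
  fun x i => hr.evalHom_normalVec h x i

end Operators

end ShapeCalc
end

/-! ### Assembly of the theorem. -/

open ShapeCalc in
theorem mainTheorem5 (d : ℕ) (hd : 2 ≤ d) (Ω : Set (Eu d)) (hΩ_open : IsOpen Ω)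
    (hΩ_conn : IsConnected Ω) (hΩ_bdd : Bornology.IsBounded Ω) (hΩ_smooth : HasSmoothBoundary Ω)
    (Γ : TopologicalSpace.Compacts (Eu d)) (hΓ : (Γ : Set (Eu d)) = frontier Ω) :
    (∃ ε : ℝ, 0 < ε ∧ ∀ r ∈ ballInfty Γ ε, IsDeformation r) ∧
    ∀ ε : ℝ, 0 < ε → (∀ r ∈ ballInfty Γ ε, IsDeformation r) → ∀ t : ℝ,
      ∃ (G : SmoothVec Γ (Eu d) → (Sobolev Γ (t + 1) →L[ℂ] (Fin d → Sobolev Γ t)))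
        (D : SmoothVec Γ (Eu d) → ((Fin d → Sobolev Γ (t + 1)) →L[ℂ] Sobolev Γ t)),
        (∀ r ∈ ballInfty Γ ε, IsPulledGrad Ω t r (G r) ∧ IsPulledDiv Ω t r (D r)) ∧
        IsCInftyGateaux (ballInfty Γ ε) D ∧
        ∀ r₀ ∈ ballInfty Γ ε, ∀ ξ : SmoothVec Γ (Eu d),
          ∃ (A : Matrix (Fin d) (Fin d) (SmoothFun Γ)) (N : Fin d → SmoothFun Γ),
            IsPulledGradMatrix Ω r₀ ξ A ∧ IsPulledNormal Ω r₀ N ∧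
            ∀ u : Fin d → Sobolev Γ (t + 1),
              gateauxDeriv D r₀ ξ u = divDerivFormula t A N (fun k i => G r₀ (u i) k) := by
  have h : IsSmoothBoundary Ω Γ := ⟨hΩ_open, hΩ_smooth, hΓ⟩
  refine ⟨⟨1 / 8, by norm_num, fun r hr => isDeformation_of_mem_ballInfty hr⟩,
    fun ε _ hdef t => ⟨fun r => gradOperator h t (gradCoeff h r),
      fun r => divOperator h t (gradCoeff h r),
      fun r hr => ⟨(hdef r hr).isPulledGrad h t, (hdef r hr).isPulledDiv h t⟩, ?_,
      fun r₀ hr₀ ξ => ?_⟩⟩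
  · exact isCInftyGateaux_divOperator h t (fun r hr => eventually_add_smul_mem_ballInfty hr) hdef
  · exact ⟨(jacobian h ξ * gradCoeff h r₀)ᵀ, normalVec h r₀, (hdef r₀ hr₀).isPulledGradMatrix h ξ,
      (hdef r₀ hr₀).isPulledNormal h, gateauxDeriv_divOperator h t
        (fun r hr => eventually_add_smul_mem_ballInfty hr) hdef hr₀ ξ⟩
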